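/- **Notation.** For $u\in L^2(\mathbb R^n)$ real-valued and $s>0$ let $$\mathcal E_s(u,u)=\int_{\mathbb R^n}|\xi|^{2s}\,|\mathcal Fu(\xi)|^2\,d\xi\in[0,\infty],$$ with $\mathcal F$ the unitary Fourier transform, $\mathcal E_s(u,u):=\infty$ for $u\notin L^2(\mathbb R^n)$, and $H^s(\mathbb R^n)=\{u\in L^2(\mathbb R^n):\mathcal E_s(u,u)<\infty\}$. Let $\mathcal H^s_0(B_1)$ be the set of $u\in H^s(\mathbb R^n)$ with $u=0$ a.e. outside the closed unit ball. For $u$ measurable, $\widetilde u(t)=\inf\{\tau\ge0:|\{|u|>\tau\}|<t\}$ for $t>0$, and $u^*(x)=\widetilde u(\omega_n|x|^n)$, for $x\neq 0$, is the spherical decreasing rearrangement, $\omega_n$ being the volume of the unit ball (the value of $u^*$ at the origin is immaterial). **Theorem.** 1. *(Neither inequality holds.)* Let $s>1$. For every $n\ge1$ there is $u\in H^s(\mathbb R^n)$ with $\mathcal E_s(u^*,u^*)<\mathcal E_s(u,u)$; and there is $u\in H^s(\mathbb R)$ with $\mathcal E_s(u,u)<\mathcal E_s(u^*,u^*)$ (the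 right-hand side being allowed to be $+\infty$). 2. *(Two bumps.)* Let $s>1$, $n\ge1$, $a\ge1$, and let $v\in\mathcal H^s_0(B_1)$ be nonnegative, radial, radially nonincreasing, and not a.e. zero. For $x_0\in\mathbb R^n$ put $u(x)=v(x)+v(ax-x_0)$. - If $|x_0|>1+a$, then $u,u^*\in H^s(\mathbb R^n)$ and $u^*(y)=v(by)$ for a.e. $y$, where $b=a/(1+a^n)^{1/n}$. - If $2k-1\le s\le 2k$ for some $k\in\mathbb N$, or if $n\le 2s$, then $\mathcal E_s(u^*,u^*)<\mathcal E_s(u,u)$ for every $x_0$ with $|x_0|>1+a$. - In all cases there is $R=R(s,n,v,a)$ such that $\mathcal E_s(u^*,u^*)<\mathcal E_s(u,u)$ for every $x_0$ with $|x_0|>R$. 3. *(A piecewise linear function.)* Let $n=1$, $s\in(1,3/2)$, $M>1$, and $$u(x)=\begin{cases}0,&x\le-2\\ x+2,&-2<x\le0\\ -x+2,&0<x\le1\\ 1,&1<x\le2M-1\\ -x+2M,&2M-1<x\le2M\\ 0,&x>2M.\end{cases}$$ Then for $x\ne0$ $$u^*(x)=\begin{cases}-|x|+2,&|x|\le1\\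 1,&1<|x|\le M\\ -|x|+M+1,&M<|x|\le M+1\\ 0,&|x|>M+1,\end{cases}$$ $u,u^*\in H^s(\mathbb R)$, and $\mathcal E_s(u,u)<\mathcal E_s(u^*,u^*)$. -/

import Mathlib

open MeasureTheory Set
open scoped ENNReal FourierTransform

noncomputable section

section Energy

variable {E : Type*} [NormedAddCommGroup E] [InnerProductSpace ℝ E] [FiniteDimensional ℝ E]
  [MeasurableSpace E] [BorelSpace E]

open Classical in
/-- The energy `𝓔_s(u,u) = ∫ |ξ|^{2s} |F u(ξ)|² dξ` with values in `[0,∞]`, where `F` is the unitary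
Fourier–Plancherel transform in the angular frequency `ξ`. Mathlib's `𝓕` on `L²` uses the ordinary
frequency `ξ / (2π)`, whence the factor `2π`. The energy of a function outside `L²` is `∞`. -/
def fracEnergy (s : ℝ) (u : E → ℝ) : ℝ≥0∞ :=
  if h : MemLp (fun x => (u x : ℂ)) 2 (volume : Measure E) then
    ∫⁻ ξ : E, ENNReal.ofReal ((2 * Real.pi * ‖ξ‖) ^ (2 * s)) *
      ‖(𝓕 (h.toLp (fun x => (u x : ℂ))) : Lp (α := E) ℂ 2 volume) ξ‖ₑ ^ 2
  else ⊤

/-- `u ∈ H^s`: the real function `u` is in `L²` and has finite energy. -/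
def MemHs (s : ℝ) (u : E → ℝ) : Prop :=
  MemLp u 2 (volume : Measure E) ∧ fracEnergy s u < ⊤

/-- `u ∈ 𝓗^s_0(Ω)`: `u ∈ H^s` on the whole space and `u = 0` a.e. outside the closure of `Ω`. -/
def MemHs0 (s : ℝ) (Ω : Set E) (u : E → ℝ) : Prop :=
  MemHs s u ∧ ∀ᵐ x ∂(volume : Measure E), x ∉ closure Ω → u x = 0

/-- The decreasing rearrangement `ũ(t) = inf {τ ≥ 0 : |{|u| > τ}| < t}`. At `t = 0` the infimum is over
the empty set (Lean's value is `0`); this affects `u*` only at the origin. -/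
def decRearrangement (u : E → ℝ) (t : ℝ) : ℝ :=
  sInf {τ : ℝ | 0 ≤ τ ∧ volume {x : E | τ < |u x|} < ENNReal.ofReal t}

/-- The spherical decreasing rearrangement `u*(x) = ũ(ω_n |x|^n)`, with `n` the dimension and `ω_n` the
volume of the unit ball. -/
def sphRearrangement (u : E → ℝ) (x : E) : ℝ :=
  decRearrangement u
    ((volume (Metric.ball (0 : E) 1)).toReal * ‖x‖ ^ Module.finrank ℝ E)

/-- The two-bump function `x ↦ v(x) + v(a x - x₀)`. -/
def twoBump (v : E → ℝ) (a : ℝ) (x₀ : E) (x : E) : ℝ :=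
  v x + v (a • x - x₀)

end Energy

/-- The piecewise linear function with parameter `M`. -/
def plateau (M : ℝ) (x : ℝ) : ℝ :=
  if x ≤ -2 then 0
  else if x ≤ 0 then x + 2
  else if x ≤ 1 then -x + 2
  else if x ≤ 2 * M - 1 then 1
  else if x ≤ 2 * M then -x + 2 * M
  else 0

/-- The explicit symmetric decreasing function equimeasurable with `plateau M`. -/
def plateauStar (M : ℝ) (x : ℝ) : ℝ :=
  if |x| ≤ 1 then -|x| + 2
  else if |x| ≤ M then 1
  else if |x| ≤ M + 1 then -|x| + M + 1
  else 0

end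

/-!
On `L¹ ∩ L²` the Fourier–Plancherel transform is the Fourier integral (`Lp_fourier_ae_eq`), so the
energy is the quadratic form of a real bilinear form, `energyForm`, whose value on two functions is
called their interaction. The functions of the theorem have compact support up to a null set, and
belong to this class as soon as they are in `L²`.

**Two bumps.** When the supports of the bumps are disjoint, the distribution function of
`twoBump v a y` is `1 + a^{-n}` times that of `v`, so its rearrangement is `v (b ·)` with
`b^{-n} = 1 + a^{-n}` (`sphRearrangement_twoBump`). With `𝓔 = energyForm s v v` and `B` the
interaction of the bumps, scaling turns the comparison into `b^{2s-n} 𝓔 < (1 + a^{2s-n}) 𝓔 + 2 B`.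
Without `B` this is an elementary inequality (`twoBump_factor_rpow_lt`), so what matters is the sign
and the size of `B`.

* The sign of `B` (`energyForm_sign`). For `m < s < m + 1` the power `y^s` is a superposition, with
  positive weights `t^{-1-s}`, of the Taylor remainders `(-1)^{m+1} (e^{-ty} - ∑_{j ≤ m} (-ty)^j/j!)`
  (`integral_expRem_comp`). With `y = (2π|ξ|)²`, the exponential contributes the pairing of the bumps
  through the heat kernel, which is positive, and flat at `t = 0` because the supports are separated.
  The flatness forces the moments of order `j ≤ s`, which the polynomial contributes, to vanish
  (`moment_eq_zero_and_expansion`). Hence `(-1)^{m+1} B ≥ 0`, and `B = 0` for integer `s`. In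
  particular `B ≥ 0` for `2k - 1 ≤ s ≤ 2k`.
* If `B ≤ 0` and `n ≤ 2s`, the energy of `2 v` surrounded by `2n` copies of the second bump, at the
  points `± |y| e_i`, is nonnegative. The copies interact nonpositively with one another, and by
  radial symmetry each of them has interaction `B` with `v`, so `B` is bounded below
  (`InteractionNonpos.energyForm_dilation_ge`).
* `B` tends to `0` as `|y| → ∞` by the Riemann–Lebesgue lemma
  (`exists_abs_energyForm_dilation_lt`). Applied to a smooth bump, this also shows that rearrangement
  can lower the energy in every dimension.

**The plateau.** The second derivative of a piecewise linear function of compact support is a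
combination `∑ c_i δ_{p_i}`, and for `1 < s < 3/2` its energy is a positive multiple of
`-∑ c_i c_j |p_i - p_j|^{3-2s}` (`energy_rampSum`). The difference of these sums for `plateauStar M`
and `plateau M` is a mixed fifth-order difference of `d ↦ d^{3-2s}`. Writing this power as a
superposition of `1 - e^{-td}`, the difference becomes the integral of the positive function
`(1 - e^{-t})³ (1 - e^{-t(M-1)})²` against `t^{-1-(3-2s)}` (`corner_difference_pos`).

**Raising the energy for `s ≥ 3/2`.** A smooth function equal to `2 - x²` on `(-1, 1)`, at most `1`
elsewhere, and equal to `1` on a further interval has a rearrangement with a corner at `|x| = 1`.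
The second differences of a function with a corner are at least of order `h^{3/2}` in `L²`, whereas those of a function of `H^{3/2}` are
`o(h^{3/2})` (`IntegrableHs.tendsto_secondDiff`). So the energy of the rearrangement is infinite
(`CornerSource.fracEnergy_rearrangement_eq_top`).
-/

set_option linter.unusedSectionVars false

/-! ### The Fourier transform on `L¹ ∩ L²` and the energy form -/

section FourierSide

variable {E : Type*} [NormedAddCommGroup E] [InnerProductSpace ℝ E] [FiniteDimensional ℝ E]
  [MeasurableSpace E] [BorelSpace E]

/-- On `L¹ ∩ L²` the Fourier–Plancherel transform is given by the Fourier integral: both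
represent the same tempered distribution. -/
theorem Lp_fourier_ae_eq {f : E → ℂ} (h1 : Integrable f) (h2 : MemLp f 2) :
    ((𝓕 (h2.toLp f) : Lp (α := E) ℂ 2 volume) : E → ℂ) =ᵐ[volume] 𝓕 f := by
  have hcont : Continuous (𝓕 f) :=
    VectorFourier.fourierIntegral_continuous Real.continuous_fourierChar continuous_inner h1
  apply ae_eq_of_integral_contDiff_smul_eq
  · exact (Lp.memLp _).locallyIntegrable (by norm_num)
  · exact hcont.locallyIntegrable
  intro g g_smooth g_cpt
  have hg₁ : HasCompactSupport (Complex.ofRealCLM ∘ g) := g_cpt.comp_left rfl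
  have hg₂ : ContDiff ℝ (⊤ : ℕ∞) (Complex.ofRealCLM ∘ g) := by fun_prop
  set G : SchwartzMap E ℂ := hg₁.toSchwartzMap hg₂ with hG
  have hGg : ∀ x, G x = (g x : ℂ) := fun x => rfl
  have e1 : ((h2.toLp f : Lp (α := E) ℂ 2 volume) : TemperedDistribution E ℂ) (𝓕 G)
      = ((𝓕 (h2.toLp f) : Lp (α := E) ℂ 2 volume) : TemperedDistribution E ℂ) G := by
    rw [← Lp.fourier_toTemperedDistribution_eq, TemperedDistribution.fourier_apply]
  rw [Lp.toTemperedDistribution_apply, Lp.toTemperedDistribution_apply] at e1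
  have e2 : ∫ ξ, 𝓕 f ξ • G ξ = ∫ x, f x • 𝓕 (G : E → ℂ) x := by
    simpa using! VectorFourier.integral_bilin_fourierIntegral_eq_flip
      (ContinuousLinearMap.lsmul ℂ ℂ) (L := innerₗ E)
      Real.continuous_fourierChar continuous_inner h1 G.integrable
  calc ∫ x, g x • (𝓕 (h2.toLp f) : Lp (α := E) ℂ 2 volume) x
      = ∫ x, G x • (𝓕 (h2.toLp f) : Lp (α := E) ℂ 2 volume) x := by
        congr 1
    _ = ∫ x, (𝓕 G) x • (h2.toLp f : Lp (α := E) ℂ 2 volume) x := e1.symm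
    _ = ∫ x, f x • 𝓕 (G : E → ℂ) x := by
        apply integral_congr_ae
        filter_upwards [h2.coeFn_toLp] with x hx
        rw [hx, SchwartzMap.fourier_coe, smul_eq_mul, smul_eq_mul, mul_comm]
    _ = ∫ ξ, g ξ • 𝓕 f ξ := by
        rw [← e2]
        congr 1
        ext ξ
        rw [hGg, smul_eq_mul, mul_comm, Complex.real_smul]

/-- The Fourier integral of a real function, in ordinary frequency. -/
noncomputable def fhat (u : E → ℝ) : E → ℂ := 𝓕 (fun x => (u x : ℂ))

theorem continuous_fhat {u : E → ℝ} (h1 : Integrable u) : Continuous (fhat u) :=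
  VectorFourier.fourierIntegral_continuous Real.continuous_fourierChar continuous_inner h1.ofReal

theorem memLp_complexOfReal {u : E → ℝ} {p : ℝ≥0∞} (h : MemLp u p) : MemLp (fun x => (u x : ℂ)) p :=
  h.ofReal

theorem integrable_complexOfReal {u : E → ℝ} (h : Integrable u) :
    Integrable (fun x => (u x : ℂ)) :=
  h.ofReal

theorem fracEnergy_eq_lintegral (s : ℝ) {u : E → ℝ} (h1 : Integrable u) (h2 : MemLp u 2) :
    fracEnergy s u = ∫⁻ ξ, ENNReal.ofReal ((2 * Real.pi * ‖ξ‖) ^ (2 * s)) * ‖fhat u ξ‖ₑ ^ 2 := by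
  have h : MemLp (fun x => (u x : ℂ)) 2 (volume : Measure E) := memLp_complexOfReal h2
  rw [fracEnergy, dif_pos h]
  apply lintegral_congr_ae
  filter_upwards [Lp_fourier_ae_eq (integrable_complexOfReal h1) h] with ξ hξ
  rw [hξ]; rfl

theorem fracEnergy_congr_ae (s : ℝ) {u u' : E → ℝ} (h : u =ᵐ[volume] u') :
    fracEnergy s u = fracEnergy s u' := by
  have hc : (fun x => (u x : ℂ)) =ᵐ[volume] (fun x => (u' x : ℂ)) := by
    filter_upwards [h] with x hx
    rw [hx]
  unfold fracEnergy
  by_cases hm : MemLp (fun x => (u x : ℂ)) 2 (volume : Measure E)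
  · have hm' := (memLp_congr_ae hc).1 hm
    rw [dif_pos hm, dif_pos hm', (MemLp.toLp_eq_toLp_iff hm hm').2 hc]
  · have hm' : ¬ MemLp (fun x => (u' x : ℂ)) 2 (volume : Measure E) :=
      fun h' => hm ((memLp_congr_ae hc).2 h')
    rw [dif_neg hm, dif_neg hm']

theorem MemHs.congr_ae {s : ℝ} {u u' : E → ℝ} (hu : MemHs s u) (h : u =ᵐ[volume] u') :
    MemHs s u' :=
  ⟨(memLp_congr_ae h).1 hu.1, fracEnergy_congr_ae s h ▸ hu.2⟩

/-- Plancherel's theorem for a real function of `L¹ ∩ L²`. -/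
theorem integral_norm_fhat_sq {u : E → ℝ} (h1 : Integrable u) (h2 : MemLp u 2) :
    Integrable (fun ξ => ‖fhat u ξ‖ ^ 2) ∧ ∫ ξ, ‖fhat u ξ‖ ^ 2 = ∫ x, u x ^ 2 := by
  have h : MemLp (fun x => (u x : ℂ)) 2 (volume : Measure E) := memLp_complexOfReal h2
  have hae := Lp_fourier_ae_eq (integrable_complexOfReal h1) h
  have hm : MemLp (fhat u) 2 (volume : Measure E) := (memLp_congr_ae hae).1 (Lp.memLp _)
  refine ⟨(memLp_two_iff_integrable_sq_norm hm.1).1 hm, ?_⟩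
  have hn := Lp.norm_fourier_eq (h.toLp _)
  have key : ∀ F : Lp (α := E) ℂ 2 volume, ‖F‖ ^ 2 = ∫ x, ‖F x‖ ^ 2 := by
    intro F
    have := L2.inner_def (𝕜 := ℂ) F F
    rw [inner_self_eq_norm_sq_to_K] at this
    have h3 : ∀ x, inner ℂ (F x) (F x) = ((‖F x‖ ^ 2 : ℝ) : ℂ) := by
      intro x
      rw [inner_self_eq_norm_sq_to_K]; push_cast; rfl
    simp_rw [h3] at this
    rw [integral_complex_ofReal] at this
    exact Complex.ofReal_injective ((Complex.ofReal_pow _ _).trans this)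
  have h4 : ‖(𝓕 (h.toLp _) : Lp (α := E) ℂ 2 volume)‖ ^ 2 = ‖h.toLp _‖ ^ 2 := by rw [hn]
  rw [key, key] at h4
  have e1 : ∫ ξ, ‖fhat u ξ‖ ^ 2 = ∫ x, ‖(𝓕 (h.toLp _) : Lp (α := E) ℂ 2 volume) x‖ ^ 2 := by
    apply integral_congr_ae
    filter_upwards [hae] with x hx
    rw [hx]; rfl
  rw [e1, h4]
  apply integral_congr_ae
  filter_upwards [h.coeFn_toLp] with x hx
  rw [hx, Complex.norm_real, Real.norm_eq_abs, sq_abs]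

/-- The multiplier `(2π|ξ|)^{2s}` of the energy in ordinary frequency. -/
noncomputable def freqWeight (s : ℝ) (ξ : E) : ℝ := (2 * Real.pi * ‖ξ‖) ^ (2 * s)

theorem freqWeight_nonneg (s : ℝ) (ξ : E) : 0 ≤ freqWeight s ξ := by
  unfold freqWeight; positivity

theorem measurable_freqWeight (s : ℝ) : Measurable (freqWeight s : E → ℝ) := by
  unfold freqWeight
  fun_prop

/-- Membership in `L¹ ∩ H^s`, the class on which the energy is a quadratic form given by the
Fourier integral. -/
structure IntegrableHs (s : ℝ) (u : E → ℝ) : Prop where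
  integrable : Integrable u
  memLp : MemLp u 2
  energy : Integrable (fun ξ => freqWeight s ξ * ‖fhat u ξ‖ ^ 2)

/-- The real bilinear form whose quadratic form is the energy of order `s`. -/
noncomputable def energyForm (s : ℝ) (f g : E → ℝ) : ℝ :=
  ∫ ξ, freqWeight s ξ * (fhat f ξ * (starRingEnd ℂ) (fhat g ξ)).re

theorem energyForm_self (s : ℝ) (u : E → ℝ) :
    energyForm s u u = ∫ ξ, freqWeight s ξ * ‖fhat u ξ‖ ^ 2 := by
  unfold energyForm
  congr 1; ext ξ
  rw [Complex.mul_conj, Complex.ofReal_re, Complex.normSq_eq_norm_sq]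

theorem energyForm_self_nonneg (s : ℝ) (u : E → ℝ) : 0 ≤ energyForm s u u := by
  rw [energyForm_self]
  exact integral_nonneg fun ξ => mul_nonneg (freqWeight_nonneg _ _) (by positivity)

theorem lintegral_energy_eq (s : ℝ) (u : E → ℝ) :
    (∫⁻ ξ, ENNReal.ofReal ((2 * Real.pi * ‖ξ‖) ^ (2 * s)) * ‖fhat u ξ‖ₑ ^ 2)
      = ∫⁻ ξ, ENNReal.ofReal (freqWeight s ξ * ‖fhat u ξ‖ ^ 2) := by
  congr 1; ext ξ
  rw [ENNReal.ofReal_mul (freqWeight_nonneg _ _), ENNReal.ofReal_pow (norm_nonneg _),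
    ofReal_norm]
  rfl

theorem IntegrableHs.fracEnergy_eq {s : ℝ} {u : E → ℝ} (h : IntegrableHs s u) :
    fracEnergy s u = ENNReal.ofReal (energyForm s u u) := by
  rw [fracEnergy_eq_lintegral s h.integrable h.memLp, lintegral_energy_eq, energyForm_self,
    ofReal_integral_eq_lintegral_ofReal h.energy]
  exact Filter.Eventually.of_forall fun ξ => mul_nonneg (freqWeight_nonneg _ _) (by positivity)

theorem IntegrableHs.memHs {s : ℝ} {u : E → ℝ} (h : IntegrableHs s u) : MemHs s u :=
  ⟨h.memLp, by rw [h.fracEnergy_eq]; exact ENNReal.ofReal_lt_top⟩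

theorem IntegrableHs.of_fracEnergy_lt_top {s : ℝ} {u : E → ℝ} (h1 : Integrable u)
    (h2 : MemLp u 2) (h : fracEnergy s u < ⊤) : IntegrableHs s u := by
  refine ⟨h1, h2, ?_, ?_⟩
  · exact ((measurable_freqWeight s).mul
      ((continuous_fhat h1).measurable.norm.pow_const 2)).aestronglyMeasurable
  · rw [fracEnergy_eq_lintegral s h1 h2, lintegral_energy_eq] at h
    rwa [hasFiniteIntegral_iff_ofReal]
    exact Filter.Eventually.of_forall fun ξ => mul_nonneg (freqWeight_nonneg _ _) (by positivity)

theorem fhat_add {f g : E → ℝ} (hf : Integrable f) (hg : Integrable g) (ξ : E) :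
    fhat (fun x => f x + g x) ξ = fhat f ξ + fhat g ξ := by
  unfold fhat
  rw [Real.fourier_eq, Real.fourier_eq, Real.fourier_eq, ← integral_add
    ((Real.fourierIntegral_convergent_iff ξ).2 hf.ofReal)
    ((Real.fourierIntegral_convergent_iff ξ).2 hg.ofReal)]
  congr 1; ext x
  rw [← smul_add]; push_cast; rfl

theorem fhat_const_mul (c : ℝ) (f : E → ℝ) (ξ : E) :
    fhat (fun x => c * f x) ξ = c * fhat f ξ := by
  unfold fhat
  rw [Real.fourier_eq, Real.fourier_eq, ← integral_const_mul]
  congr 1; ext x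
  push_cast
  rw [Circle.smul_def, Circle.smul_def, smul_eq_mul, smul_eq_mul]; ring

theorem re_mul_conj_le (z w : ℂ) : |(z * (starRingEnd ℂ) w).re| ≤ ‖z‖ ^ 2 + ‖w‖ ^ 2 := by
  have h1 := Complex.abs_re_le_norm (z * (starRingEnd ℂ) w)
  rw [norm_mul, RCLike.norm_conj] at h1
  nlinarith [sq_nonneg (‖z‖ - ‖w‖), norm_nonneg z, norm_nonneg w]

theorem IntegrableHs.integrable_mixed {s : ℝ} {f g : E → ℝ} (hf : IntegrableHs s f)
    (hg : IntegrableHs s g) :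
    Integrable (fun ξ => freqWeight s ξ * (fhat f ξ * (starRingEnd ℂ) (fhat g ξ)).re) := by
  refine (hf.energy.add hg.energy).mono' ?_ ?_
  · exact ((measurable_freqWeight s).mul (Complex.measurable_re.comp
      ((continuous_fhat hf.integrable).mul
        (Complex.continuous_conj.comp (continuous_fhat hg.integrable))).measurable)).aestronglyMeasurable
  · refine Filter.Eventually.of_forall fun ξ => ?_
    rw [Real.norm_eq_abs, abs_mul, abs_of_nonneg (freqWeight_nonneg s ξ)]
    simp only [Pi.add_apply]
    rw [← mul_add]
    exact mul_le_mul_of_nonneg_left (re_mul_conj_le _ _) (freqWeight_nonneg s ξ)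

theorem IntegrableHs.add {s : ℝ} {f g : E → ℝ} (hf : IntegrableHs s f)
    (hg : IntegrableHs s g) : IntegrableHs s (fun x => f x + g x) := by
  refine ⟨hf.integrable.add hg.integrable, hf.memLp.add hg.memLp, ?_⟩
  refine ((hf.energy.add hg.energy).const_mul 2).mono' ?_ ?_
  · exact ((measurable_freqWeight s).mul ((continuous_fhat
      (hf.integrable.add hg.integrable)).measurable.norm.pow_const 2)).aestronglyMeasurable
  · refine Filter.Eventually.of_forall fun ξ => ?_
    rw [Real.norm_eq_abs, abs_of_nonneg (mul_nonneg (freqWeight_nonneg _ _) (by positivity)),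
      fhat_add hf.integrable hg.integrable]
    simp only [Pi.add_apply]
    rw [← mul_add, mul_left_comm]
    refine mul_le_mul_of_nonneg_left ?_ (freqWeight_nonneg s ξ)
    have := norm_add_le (fhat f ξ) (fhat g ξ)
    nlinarith [sq_nonneg (‖fhat f ξ‖ - ‖fhat g ξ‖), norm_nonneg (fhat f ξ + fhat g ξ)]

theorem IntegrableHs.const_mul {s : ℝ} {f : E → ℝ} (hf : IntegrableHs s f) (c : ℝ) :
    IntegrableHs s (fun x => c * f x) := by
  refine ⟨hf.integrable.const_mul c, hf.memLp.const_mul c, ?_⟩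
  refine (hf.energy.const_mul (c ^ 2)).congr (Filter.Eventually.of_forall fun ξ => ?_)
  simp only [fhat_const_mul, norm_mul, Complex.norm_real, Real.norm_eq_abs, mul_pow, sq_abs]
  ring

theorem energyForm_comm (s : ℝ) (f g : E → ℝ) : energyForm s f g = energyForm s g f := by
  unfold energyForm
  congr 1; ext ξ
  congr 1
  simp only [Complex.mul_re, Complex.conj_re, Complex.conj_im]; ring

theorem energyForm_add_left {s : ℝ} {f g h : E → ℝ} (hf : IntegrableHs s f)
    (hg : IntegrableHs s g) (hh : IntegrableHs s h) :
    energyForm s (fun x => f x + g x) h = energyForm s f h + energyForm s g h := by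
  unfold energyForm
  rw [← integral_add (hf.integrable_mixed hh) (hg.integrable_mixed hh)]
  congr 1; ext ξ
  rw [fhat_add hf.integrable hg.integrable, add_mul, Complex.add_re, mul_add]

theorem energyForm_const_mul_left (s c : ℝ) (f g : E → ℝ) :
    energyForm s (fun x => c * f x) g = c * energyForm s f g := by
  unfold energyForm
  rw [← integral_const_mul]
  congr 1; ext ξ
  rw [fhat_const_mul, mul_assoc, Complex.re_ofReal_mul]
  ring

theorem energyForm_add_self {s : ℝ} {f g : E → ℝ} (hf : IntegrableHs s f)
    (hg : IntegrableHs s g) :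
    energyForm s (fun x => f x + g x) (fun x => f x + g x)
      = energyForm s f f + energyForm s g g + 2 * energyForm s f g := by
  rw [energyForm_add_left hf hg (hf.add hg), energyForm_comm s f, energyForm_comm s g,
    energyForm_add_left hf hg hf, energyForm_add_left hf hg hg, energyForm_comm s g f]
  ring

theorem integrableHs_zero (s : ℝ) : IntegrableHs s (fun _ : E => (0 : ℝ)) := by
  have h0 : fhat (fun _ : E => (0 : ℝ)) = 0 := by
    ext ξ; simp [fhat, Real.fourier_eq]
  refine ⟨integrable_zero _ _ _, MemLp.zero', ?_⟩
  simp [h0]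

theorem IntegrableHs.sum {ι : Type*} {s : ℝ} (t : Finset ι) {f : ι → E → ℝ}
    (hf : ∀ i ∈ t, IntegrableHs s (f i)) : IntegrableHs s (fun x => ∑ i ∈ t, f i x) := by
  classical
  induction t using Finset.induction_on with
  | empty => simpa using integrableHs_zero s
  | insert i t hi ih =>
    simp_rw [Finset.sum_insert hi]
    exact (hf i (by simp)).add (ih fun j hj => hf j (by simp [hj]))

theorem energyForm_sum_left {ι : Type*} {s : ℝ} (t : Finset ι) {f : ι → E → ℝ} {g : E → ℝ}
    (hf : ∀ i ∈ t, IntegrableHs s (f i)) (hg : IntegrableHs s g) :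
    energyForm s (fun x => ∑ i ∈ t, f i x) g = ∑ i ∈ t, energyForm s (f i) g := by
  classical
  induction t using Finset.induction_on with
  | empty =>
    have := energyForm_const_mul_left s 0 g g
    simpa using this
  | insert i t hi ih =>
    simp_rw [Finset.sum_insert hi]
    rw [energyForm_add_left (hf i (by simp)) (IntegrableHs.sum t fun j hj => hf j (by simp [hj])) hg,
      ih fun j hj => hf j (by simp [hj])]

/-- The energy of a function that does not vanish almost everywhere is positive, by Plancherel's
theorem. -/
theorem energyForm_self_pos [Nontrivial E] {s : ℝ} {u : E → ℝ} (hu : IntegrableHs s u)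
    (h0 : ¬ u =ᵐ[volume] 0) : 0 < energyForm s u u := by
  refine lt_of_le_of_ne (energyForm_self_nonneg s u) fun h => h0 ?_
  have hnn : ∀ ξ, 0 ≤ freqWeight s ξ * ‖fhat u ξ‖ ^ 2 := fun ξ =>
    mul_nonneg (freqWeight_nonneg _ _) (by positivity)
  have h1 := (integral_eq_zero_iff_of_nonneg hnn hu.energy).1 (by rw [← energyForm_self]; exact h.symm)
  have h2 : (fun ξ => ‖fhat u ξ‖ ^ 2) =ᵐ[volume] 0 := by
    filter_upwards [h1, (measure_singleton (0 : E) : volume {(0 : E)} = 0) |> compl_mem_ae_iff.2]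
      with ξ hξ hne
    have hne' : ξ ≠ 0 := hne
    have : 0 < freqWeight s ξ := by
      unfold freqWeight
      have := norm_pos_iff.2 hne'
      positivity
    simpa [this.ne'] using hξ
  have h3 := (integral_norm_fhat_sq hu.integrable hu.memLp).2
  rw [integral_congr_ae h2] at h3
  simp only [Pi.zero_apply, integral_zero] at h3
  have h4 := (integral_eq_zero_iff_of_nonneg (fun x => sq_nonneg (u x))
    hu.memLp.integrable_sq).1 h3.symm
  filter_upwards [h4] with x hx
  simpa using hx

end FourierSide

/-! ### Dilations, translations and isometries -/

section Dilation

variable {E : Type*} [NormedAddCommGroup E] [InnerProductSpace ℝ E] [FiniteDimensional ℝ E]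
  [MeasurableSpace E] [BorelSpace E]

open Module Filter Topology

theorem quasiMeasurePreserving_dilation {a : ℝ} (ha : 0 < a) (y : E) :
    Measure.QuasiMeasurePreserving (fun x : E => a • x - y) volume volume :=
  (measurePreserving_sub_right volume y).quasiMeasurePreserving.comp
    (Measure.quasiMeasurePreserving_smul volume ha.ne')

theorem integrable_comp_dilation {F : Type*} [NormedAddCommGroup F] {f : E → F}
    (hf : Integrable f) {a : ℝ} (ha : 0 < a) (y : E) : Integrable (fun x => f (a • x - y)) :=
  (hf.comp_sub_right y).comp_smul ha.ne'

theorem memLp_two_comp_dilation {f : E → ℝ} (hf : MemLp f 2) {a : ℝ} (ha : 0 < a) (y : E) :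
    MemLp (fun x => f (a • x - y)) 2 := by
  refine (memLp_two_iff_integrable_sq
    (hf.1.comp_quasiMeasurePreserving (quasiMeasurePreserving_dilation ha y))).2 ?_
  exact integrable_comp_dilation hf.integrable_sq ha y

theorem fhat_dilation (f : E → ℝ) {a : ℝ} (ha : 0 < a) (y ξ : E) :
    fhat (fun x => f (a • x - y)) ξ
      = ((a ^ finrank ℝ E)⁻¹ : ℝ) * ((Real.fourierChar (-(inner ℝ y (a⁻¹ • ξ))) : ℂ)
        * fhat f (a⁻¹ • ξ)) := by
  unfold fhat
  rw [Real.fourier_eq, Real.fourier_eq]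
  set F : E → ℂ := fun z => Real.fourierChar (-(inner ℝ (z + y) (a⁻¹ • ξ))) • ((f z : ℝ) : ℂ) with hF
  have h1 : ∀ x, Real.fourierChar (-(inner ℝ x ξ)) • ((f (a • x - y) : ℝ) : ℂ)
      = (fun z => F (z - y)) (a • x) := by
    intro x
    simp only [hF, sub_add_cancel]
    congr 3
    rw [inner_smul_left, inner_smul_right]
    simp only [conj_trivial]
    field_simp
  simp_rw [h1]
  rw [Measure.integral_comp_smul volume (fun z => F (z - y)) a, integral_sub_right_eq_self F y,
    abs_of_pos (by positivity), Complex.real_smul]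
  refine congrArg _ ?_
  rw [← integral_const_mul]
  refine (integral_congr_ae (.of_forall fun z => ?_))
  simp only [hF, Circle.smul_def, smul_eq_mul, inner_add_left, neg_add, AddChar.map_add_eq_mul,
    Circle.coe_mul]
  ring

theorem norm_fhat_dilation_sq (f : E → ℝ) {a : ℝ} (ha : 0 < a) (y ξ : E) :
    ‖fhat (fun x => f (a • x - y)) ξ‖ ^ 2
      = ((a ^ finrank ℝ E)⁻¹) ^ 2 * ‖fhat f (a⁻¹ • ξ)‖ ^ 2 := by
  rw [fhat_dilation f ha, norm_mul, norm_mul, Circle.norm_coe, one_mul, Complex.norm_real,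
    Real.norm_eq_abs, mul_pow, sq_abs]

theorem freqWeight_smul (s : ℝ) {a : ℝ} (ha : 0 < a) (ξ : E) :
    freqWeight s ξ = a ^ (2 * s) * freqWeight s (a⁻¹ • ξ) := by
  unfold freqWeight
  rw [norm_smul, norm_inv, Real.norm_eq_abs, abs_of_pos ha,
    ← Real.mul_rpow ha.le (by positivity)]
  congr 1
  field_simp

theorem energy_density_dilation (s : ℝ) (f : E → ℝ) {a : ℝ} (ha : 0 < a) (y : E) :
    (fun ξ => freqWeight s ξ * ‖fhat (fun x => f (a • x - y)) ξ‖ ^ 2)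
      = fun ξ => (a ^ (2 * s) * ((a ^ finrank ℝ E)⁻¹) ^ 2) *
        (fun η => freqWeight s η * ‖fhat f η‖ ^ 2) (a⁻¹ • ξ) := by
  ext ξ
  rw [norm_fhat_dilation_sq f ha, freqWeight_smul s ha]
  ring

theorem IntegrableHs.dilation {s : ℝ} {f : E → ℝ} (hf : IntegrableHs s f) {a : ℝ} (ha : 0 < a)
    (y : E) : IntegrableHs s (fun x => f (a • x - y)) := by
  refine ⟨integrable_comp_dilation hf.integrable ha y, memLp_two_comp_dilation hf.memLp ha y, ?_⟩
  rw [energy_density_dilation s f ha y]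
  exact (hf.energy.comp_smul (inv_ne_zero ha.ne')).const_mul _

/-- Scaling of the energy: `𝓔_s(f(a · - y)) = a^{2s-n} 𝓔_s(f)`. -/
theorem energyForm_dilation (s : ℝ) (f : E → ℝ) {a : ℝ} (ha : 0 < a) (y : E) :
    energyForm s (fun x => f (a • x - y)) (fun x => f (a • x - y))
      = a ^ (2 * s - finrank ℝ E) * energyForm s f f := by
  rw [energyForm_self, energyForm_self, energy_density_dilation s f ha y, integral_const_mul,
    Measure.integral_comp_inv_smul volume (fun η => freqWeight s η * ‖fhat f η‖ ^ 2) a,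
    abs_of_pos (by positivity), smul_eq_mul, ← mul_assoc]
  congr 1
  rw [Real.rpow_sub ha, Real.rpow_natCast]
  field_simp

theorem fhat_comp_isometry (f : E → ℝ) (A : E ≃ₗᵢ[ℝ] E) (ξ : E) :
    fhat (fun x => f (A x)) ξ = fhat f (A ξ) :=
  Real.fourier_comp_linearIsometry A (fun x => (f x : ℂ)) ξ

theorem energyForm_comp_isometry (s : ℝ) (f g : E → ℝ) (A : E ≃ₗᵢ[ℝ] E) :
    energyForm s (fun x => f (A x)) (fun x => g (A x)) = energyForm s f g := by
  unfold energyForm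
  rw [← A.measurePreserving.integral_comp A.toHomeomorph.measurableEmbedding
    (fun ξ => freqWeight s ξ * (fhat f ξ * (starRingEnd ℂ) (fhat g ξ)).re)]
  congr 1; ext ξ
  rw [fhat_comp_isometry, fhat_comp_isometry]
  unfold freqWeight
  rw [LinearIsometryEquiv.norm_map]

/-- For a radial function, the interaction with a translated dilated copy depends on the
translation vector only through its norm. -/
theorem energyForm_dilation_of_norm_eq (s : ℝ) {v : E → ℝ} (hv : ∀ x y : E, ‖x‖ = ‖y‖ → v x = v y)
    (a : ℝ) {y z : E} (h : ‖y‖ = ‖z‖) :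
    energyForm s v (fun x => v (a • x - y)) = energyForm s v (fun x => v (a • x - z)) := by
  set A : E ≃ₗᵢ[ℝ] E := (Submodule.span ℝ {z - y})ᗮ.reflection with hA
  have hAz : A z = y := Submodule.reflection_sub h.symm
  rw [← energyForm_comp_isometry s v _ A]
  congr 1
  · ext x; exact hv _ _ (A.norm_map x)
  · ext x
    apply hv
    rw [← hAz, ← map_smul, ← map_sub, A.norm_map]

/-- The interaction of two distant bumps is negligible: it is the Fourier integral of an `L¹`
function, so that the Riemann–Lebesgue lemma applies. -/
theorem exists_abs_energyForm_dilation_lt {s : ℝ} {v : E → ℝ} (hv : IntegrableHs s v) {a : ℝ}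
    (ha : 0 < a) {ε : ℝ} (hε : 0 < ε) :
    ∃ R : ℝ, ∀ y : E, R < ‖y‖ → |energyForm s v (fun x => v (a • x - y))| < ε := by
  set Φ : E → ℂ := fun ξ => ((freqWeight s ξ * (a ^ finrank ℝ E)⁻¹ : ℝ) : ℂ) *
    (fhat v ξ * (starRingEnd ℂ) (fhat v (a⁻¹ • ξ))) with hΦ
  have hre : ∀ y : E, Integrable Φ → energyForm s v (fun x => v (a • x - y))
      = (∫ ξ, Real.fourierChar (-(inner ℝ ξ (-(a⁻¹ • y)))) • Φ ξ).re := by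
    intro y hint
    have hi := (Real.fourierIntegral_convergent_iff (-(a⁻¹ • y))).2 hint
    have : (∫ ξ, Real.fourierChar (-(inner ℝ ξ (-(a⁻¹ • y)))) • Φ ξ).re
        = ∫ ξ, (Real.fourierChar (-(inner ℝ ξ (-(a⁻¹ • y)))) • Φ ξ).re := by
      exact (integral_re hi).symm
    rw [this]
    unfold energyForm
    congr 1; ext ξ
    rw [fhat_dilation v ha, ← Complex.re_ofReal_mul]
    congr 1
    simp only [hΦ, Circle.smul_def, smul_eq_mul, map_mul, Complex.conj_ofReal]
    rw [← Circle.coe_inv_eq_conj, ← AddChar.map_neg_eq_inv]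
    have : -(inner ℝ ξ (-(a⁻¹ • y))) = - -(inner ℝ y (a⁻¹ • ξ)) := by
      rw [inner_neg_right, inner_smul_right, inner_smul_right, real_inner_comm]
    rw [this]
    push_cast
    ring
  have hint : Integrable Φ := by
    have hd := (hv.dilation ha 0)
    refine (hv.energy.add hd.energy).mono' ?_ ?_
    · refine Measurable.aestronglyMeasurable ?_
      have hc := (continuous_fhat hv.integrable)
      exact (Complex.measurable_ofReal.comp ((measurable_freqWeight s).mul_const _)).mul
        (hc.mul (Complex.continuous_conj.comp (hc.comp (continuous_const_smul _)))).measurable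
    · refine Eventually.of_forall fun ξ => ?_
      have hn : ‖Φ ξ‖ = freqWeight s ξ * (‖fhat v ξ‖ * ‖fhat (fun x => v (a • x - 0)) ξ‖) := by
        rw [fhat_dilation v ha]
        simp only [hΦ, norm_mul, Complex.norm_real, Circle.norm_coe, RCLike.norm_conj,
          Real.norm_eq_abs, abs_of_nonneg (freqWeight_nonneg s ξ), one_mul]
        ring
      rw [hn]
      simp only [Pi.add_apply]
      rw [← mul_add]
      refine mul_le_mul_of_nonneg_left ?_ (freqWeight_nonneg s ξ)
      nlinarith [sq_nonneg (‖fhat v ξ‖ - ‖fhat (fun x => v (a • x - 0)) ξ‖),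
        norm_nonneg (fhat v ξ), norm_nonneg (fhat (fun x => v (a • x - 0)) ξ)]
  have hRL := tendsto_integral_exp_inner_smul_cocompact Φ
  rw [Metric.tendsto_nhds] at hRL
  have h2 := hRL ε hε
  rw [← Metric.cobounded_eq_cocompact, ← comap_norm_atTop, eventually_comap] at h2
  obtain ⟨R, hR⟩ := eventually_atTop.1 h2
  refine ⟨a * R, fun y hy => ?_⟩
  rw [hre y hint]
  have h3 := hR ‖-(a⁻¹ • y)‖ (by
    rw [norm_neg, norm_smul, norm_inv, Real.norm_eq_abs, abs_of_pos ha, ← div_eq_inv_mul,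
      le_div_iff₀ ha]
    linarith) _ rfl
  rw [dist_zero_right] at h3
  exact (Complex.abs_re_le_norm _).trans_lt h3

end Dilation

/-! ### Identification of rearrangements -/

section Rearrangement

variable {E : Type*} [NormedAddCommGroup E] [InnerProductSpace ℝ E] [FiniteDimensional ℝ E]
  [MeasurableSpace E] [BorelSpace E]

open Module Filter Topology

theorem ofReal_volume_ball_mul_pow (x : E) :
    ENNReal.ofReal ((volume (Metric.ball (0 : E) 1)).toReal * ‖x‖ ^ finrank ℝ E)
      = volume (Metric.ball (0 : E) 1) * ENNReal.ofReal (‖x‖ ^ finrank ℝ E) := by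
  rw [ENNReal.ofReal_mul ENNReal.toReal_nonneg, ENNReal.ofReal_toReal measure_ball_lt_top.ne]

theorem volume_ball_eq_unit_mul [Nontrivial E] {r : ℝ} (hr : 0 ≤ r) :
    volume (Metric.ball (0 : E) r)
      = volume (Metric.ball (0 : E) 1) * ENNReal.ofReal (r ^ finrank ℝ E) := by
  rw [Measure.addHaar_ball _ _ hr, mul_comm]

/-- The rearrangement at `x` compares superlevel sets of `u` with the ball through `x`. -/
theorem sphRearrangement_eq_sInf [Nontrivial E] (u : E → ℝ) (x : E) :
    sphRearrangement u x
      = sInf {τ : ℝ | 0 ≤ τ ∧ volume {y : E | τ < |u y|} < volume (Metric.ball (0 : E) ‖x‖)} := by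
  unfold sphRearrangement decRearrangement
  rw [ofReal_volume_ball_mul_pow, volume_ball_eq_unit_mul (norm_nonneg x)]

theorem volume_ball_lt_volume_ball [Nontrivial E] {r r' : ℝ} (hr' : 0 ≤ r') (h : r' < r) :
    volume (Metric.ball (0 : E) r') < volume (Metric.ball (0 : E) r) := by
  rw [volume_ball_eq_unit_mul hr', volume_ball_eq_unit_mul (hr'.trans h.le)]
  refine (ENNReal.mul_lt_mul_iff_right (Metric.measure_ball_pos _ _ one_pos).ne'
    measure_ball_lt_top.ne).2 ?_
  refine (ENNReal.ofReal_lt_ofReal_iff (pow_pos (hr'.trans_lt h) _)).2 ?_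
  exact pow_lt_pow_left₀ h hr' finrank_pos.ne'

/-- The rearrangement of `u` agrees with any radially nonincreasing function having the same
distribution function, wherever the profile of the latter is continuous. -/
theorem sphRearrangement_eq_of_continuousAt [Nontrivial E] {u g : E → ℝ} {w : ℝ → ℝ}
    (hw : AntitoneOn w (Ioi 0)) (hw0 : ∀ r, 0 < r → 0 ≤ w r) (hg : ∀ x, g x = w ‖x‖)
    (hdist : ∀ τ, 0 ≤ τ → volume {y : E | τ < |u y|} = volume {y : E | τ < g y})
    {x : E} (hx : x ≠ 0) (hc : ContinuousAt w ‖x‖) : sphRearrangement u x = g x := by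
  have hr : 0 < ‖x‖ := norm_pos_iff.2 hx
  rw [sphRearrangement_eq_sInf, hg]
  have hnull : volume ({0} : Set E) = 0 := measure_singleton 0
  -- By continuity, `{g > w ‖x‖ + ε}` lies in a strictly smaller ball, up to the origin.
  have hmem : ∀ ε, 0 < ε → w ‖x‖ + ε ∈ {τ : ℝ | 0 ≤ τ ∧
      volume {y : E | τ < |u y|} < volume (Metric.ball (0 : E) ‖x‖)} := by
    intro ε hε
    have h0 : 0 ≤ w ‖x‖ + ε := by linarith [hw0 _ hr]
    refine ⟨h0, ?_⟩
    rw [hdist _ h0]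
    have hev : ∀ᶠ r in 𝓝[<] ‖x‖, w r < w ‖x‖ + ε :=
      (hc.eventually (gt_mem_nhds (by linarith))).filter_mono nhdsWithin_le_nhds
    have hev2 : ∀ᶠ r in 𝓝[<] ‖x‖, 0 < r ∧ r < ‖x‖ := Ioo_mem_nhdsLT hr
    obtain ⟨r, hrw, hr0, hrx⟩ := (hev.and hev2).exists
    refine lt_of_le_of_lt ?_ (volume_ball_lt_volume_ball hr0.le hrx)
    have hsub : {y : E | w ‖x‖ + ε < g y} ⊆ Metric.ball (0 : E) r ∪ {0} := by
      intro y hy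
      by_cases hy0 : y = 0
      · right; exact hy0
      · left
        rw [mem_ball_zero_iff]
        by_contra hlt
        have := hw hr0 (norm_pos_iff.2 hy0) (not_lt.1 hlt)
        simp only [mem_ofPred_eq, hg] at hy
        linarith
    refine (measure_mono hsub).trans ((measure_union_le _ _).trans ?_)
    rw [hnull, add_zero]
  apply csInf_eq_of_forall_ge_of_forall_gt_exists_lt
  · exact ⟨_, hmem 1 one_pos⟩
  · rintro τ ⟨hτ0, hτ⟩
    by_contra hlt
    rw [not_le] at hlt
    rw [hdist τ hτ0] at hτ
    refine absurd hτ (not_lt.2 ?_)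
    have hsub : Metric.ball (0 : E) ‖x‖ ⊆ {y : E | τ < g y} ∪ {0} := by
      intro y hy
      by_cases hy0 : y = 0
      · right; exact hy0
      · left
        rw [mem_ball_zero_iff] at hy
        have := hw (norm_pos_iff.2 hy0) hr hy.le
        simp only [mem_ofPred_eq, hg]
        linarith
    refine (measure_mono hsub).trans ((measure_union_le _ _).trans ?_)
    rw [hnull, add_zero]
  · intro c hcw
    exact ⟨_, hmem ((c - w ‖x‖) / 2) (by linarith), by linarith⟩

theorem volume_preimage_norm_countable [Nontrivial E] {C : Set ℝ} (hC : C.Countable) :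
    volume {x : E | ‖x‖ ∈ C} = 0 := by
  have : {x : E | ‖x‖ ∈ C} = ⋃ r ∈ C, Metric.sphere (0 : E) r := by
    ext x; simp
  rw [this, measure_biUnion_null_iff hC]
  exact fun r _ => Measure.addHaar_sphere volume 0 r

/-- A monotone profile is discontinuous at countably many radii only, and spheres are null sets. -/
theorem sphRearrangement_ae_eq [Nontrivial E] {u g : E → ℝ} {w : ℝ → ℝ}
    (hw : AntitoneOn w (Ioi 0)) (hw0 : ∀ r, 0 < r → 0 ≤ w r) (hg : ∀ x, g x = w ‖x‖)
    (hdist : ∀ τ, 0 ≤ τ → volume {y : E | τ < |u y|} = volume {y : E | τ < g y}) :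
    sphRearrangement u =ᵐ[volume] g := by
  have h1 := volume_preimage_norm_countable (E := E) hw.countable_not_continuousWithinAt
  have h2 : volume ({0} : Set E) = 0 := measure_singleton 0
  filter_upwards [compl_mem_ae_iff.2 h1, compl_mem_ae_iff.2 h2] with x hx1 hx2
  have hx0 : x ≠ 0 := hx2
  have hr : 0 < ‖x‖ := norm_pos_iff.2 hx0
  refine sphRearrangement_eq_of_continuousAt hw hw0 hg hdist hx0 ?_
  simp only [mem_compl_iff, mem_ofPred_eq, not_and, not_not] at hx1
  exact (hx1 hr).continuousAt (Ioi_mem_nhds hr)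

/-- The level sets of a dilated translate have proportionally rescaled volume. -/
theorem volume_superlevel_dilation (v : E → ℝ) {a : ℝ} (ha : 0 < a) (y : E) (τ : ℝ) :
    volume {x : E | τ < v (a • x - y)}
      = ENNReal.ofReal ((a ^ finrank ℝ E)⁻¹) * volume {x : E | τ < v x} := by
  have h1 : {x : E | τ < v (a • x - y)} = (a • ·) ⁻¹' ((fun z => z - y) ⁻¹' {x : E | τ < v x}) := rfl
  rw [h1, Measure.addHaar_preimage_smul volume ha.ne', abs_of_pos (by positivity)]
  congr 1
  simp_rw [sub_eq_add_neg]
  exact measure_preimage_add_right _ _ _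

/-- For `|y| > 1 + a` the two bumps of `twoBump v a y` have disjoint supports, up to a null set. -/
theorem twoBump_disjoint_ae {v : E → ℝ} (hv : ∀ᵐ x : E, x ∉ Metric.closedBall (0 : E) 1 → v x = 0)
    {a : ℝ} (ha : 0 < a) {y : E} (hy : 1 + a < ‖y‖) :
    ∀ᵐ x : E, v x = 0 ∨ v (a • x - y) = 0 := by
  have h2 := (quasiMeasurePreserving_dilation ha y).ae hv
  filter_upwards [hv, h2] with x h1 h2
  by_cases hx : x ∈ Metric.closedBall (0 : E) 1
  · right
    apply h2
    rw [mem_closedBall_zero_iff] at hx ⊢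
    have h3 : ‖y‖ ≤ ‖a • x‖ + ‖a • x - y‖ := by
      have := norm_sub_le (a • x) (a • x - y)
      simpa using this
    rw [norm_smul, Real.norm_eq_abs, abs_of_pos ha] at h3
    nlinarith
  · exact Or.inl (h1 hx)

theorem twoBump_factor_pos {a : ℝ} (ha : 0 < a) (n : ℕ) : 0 < a / (1 + a ^ n) ^ (1 / (n : ℝ)) := by
  positivity

theorem twoBump_factor_pow {a : ℝ} (ha : 0 < a) {n : ℕ} (hn : n ≠ 0) :
    (a / (1 + a ^ n) ^ (1 / (n : ℝ))) ^ n = a ^ n / (1 + a ^ n) := by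
  rw [div_pow, one_div, Real.rpow_inv_natCast_pow (by positivity) hn]

/-- The superlevel sets of the two bumps are disjoint and have volumes in the ratio `1 : a^{-n}`, so
that the distribution function of their sum is that of `v` multiplied by `1 + a^{-n} = b^{-n}`. -/
theorem sphRearrangement_twoBump [Nontrivial E] {v : E → ℝ} {w : ℝ → ℝ} (hm : AEStronglyMeasurable v)
    (hv : ∀ᵐ x : E, x ∉ Metric.closedBall (0 : E) 1 → v x = 0) (hv0 : ∀ x, 0 ≤ v x)
    (hw : AntitoneOn w (Ioi 0)) (hvw : ∀ x, v x = w ‖x‖) {a : ℝ} (ha : 0 < a) {y : E}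
    (hy : 1 + a < ‖y‖) :
    sphRearrangement (twoBump v a y) =ᵐ[volume]
      fun x => v ((a / (1 + a ^ finrank ℝ E) ^ (1 / (finrank ℝ E : ℝ))) • x) := by
  set b := a / (1 + a ^ finrank ℝ E) ^ (1 / (finrank ℝ E : ℝ)) with hb
  have hb0 : 0 < b := twoBump_factor_pos ha _
  have hbn : b ^ finrank ℝ E = a ^ finrank ℝ E / (1 + a ^ finrank ℝ E) :=
    twoBump_factor_pow ha finrank_pos.ne'
  refine sphRearrangement_ae_eq (w := fun r => w (b * r)) ?_ ?_ ?_ ?_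
  · intro r hr r' hr' hrr'
    exact hw (mul_pos hb0 hr) (mul_pos hb0 hr') (mul_le_mul_of_nonneg_left hrr' hb0.le)
  · intro r hr
    obtain ⟨x, hx⟩ := exists_norm_eq E (mul_pos hb0 hr).le
    rw [← hx, ← hvw]; exact hv0 x
  · intro x
    rw [hvw, norm_smul, Real.norm_eq_abs, abs_of_pos hb0]
  · intro τ hτ
    have hdis := twoBump_disjoint_ae hv ha hy
    have hnn : ∀ x, 0 ≤ twoBump v a y x := fun x => add_nonneg (hv0 _) (hv0 _)
    have h1 : volume {x : E | τ < |twoBump v a y x|}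
        = volume ({x : E | τ < v x} ∪ {x : E | τ < v (a • x - y)}) := by
      apply measure_congr
      filter_upwards [hdis] with x hx
      apply propext
      change (τ < |twoBump v a y x|) ↔ (τ < v x ∨ τ < v (a • x - y))
      rw [abs_of_nonneg (hnn x), twoBump]
      rcases hx with h | h
      · rw [h, zero_add]; constructor
        · exact Or.inr
        · rintro (h' | h')
          · exact absurd h' (not_lt.2 hτ)
          · exact h'
      · rw [h, add_zero]; constructor
        · exact Or.inl
        · rintro (h' | h')
          · exact h'
          · exact absurd h' (not_lt.2 hτ)
    have hdisj : AEDisjoint volume {x : E | τ < v x} {x : E | τ < v (a • x - y)} := by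
      refine measure_mono_null ?_ hdis
      rintro x ⟨h1, h2⟩
      simp only [mem_ofPred_eq] at h1 h2
      simp only [mem_compl_iff, mem_ofPred_eq, not_or]
      exact ⟨(hτ.trans_lt h1).ne', (hτ.trans_lt h2).ne'⟩
    have hmeas : NullMeasurableSet {x : E | τ < v (a • x - y)} volume :=
      nullMeasurableSet_lt aemeasurable_const
        (hm.comp_quasiMeasurePreserving (quasiMeasurePreserving_dilation ha y)).aemeasurable
    have h2 := volume_superlevel_dilation v hb0 0 τ
    simp only [sub_zero] at h2
    rw [h1, measure_union₀ hmeas hdisj, volume_superlevel_dilation v ha, h2]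
    nth_rw 1 [← one_mul (volume {x : E | τ < v x})]
    rw [← add_mul, ← ENNReal.ofReal_one, ← ENNReal.ofReal_add zero_le_one (by positivity), hbn]
    congr 2
    field_simp
    ring

end Rearrangement

/-! ### Taylor remainders of the exponential and fractional powers -/

section LaplaceRepresentation

open Filter Topology

/-- The Taylor remainder `(-1)^{m+1} (e^{-y} - ∑_{j ≤ m} (-y)^j / j!)`, which is nonnegative for
`y ≥ 0`. -/
noncomputable def expRem : ℕ → ℝ → ℝ
  | 0, y => 1 - Real.exp (-y)
  | m + 1, y => y ^ (m + 1) / (m + 1).factorial - expRem m y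

theorem expRem_succ (m : ℕ) (y : ℝ) :
    expRem (m + 1) y = y ^ (m + 1) / (m + 1).factorial - expRem m y := rfl

theorem continuous_expRem (m : ℕ) : Continuous (expRem m) := by
  induction m with
  | zero =>
    change Continuous fun y : ℝ => 1 - Real.exp (-y)
    fun_prop
  | succ m ih =>
    change Continuous fun y => y ^ (m + 1) / ((m + 1).factorial : ℝ) - expRem m y
    fun_prop

theorem hasDerivAt_expRem_zero (y : ℝ) : HasDerivAt (expRem 0) (Real.exp (-y)) y := by
  change HasDerivAt (fun y : ℝ => 1 - Real.exp (-y)) _ _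
  simpa using ((hasDerivAt_neg y).exp).const_sub 1

theorem hasDerivAt_pow_div_factorial (m : ℕ) (y : ℝ) :
    HasDerivAt (fun y : ℝ => y ^ (m + 1) / (m + 1).factorial) (y ^ m / m.factorial) y := by
  have h := (hasDerivAt_pow (m + 1) y).div_const ((m + 1).factorial : ℝ)
  convert! h using 1
  rw [Nat.factorial_succ]
  push_cast
  have : (m.factorial : ℝ) ≠ 0 := by positivity
  field_simp

theorem hasDerivAt_expRem_succ (m : ℕ) (y : ℝ) :
    HasDerivAt (expRem (m + 1)) (expRem m y) y := by
  induction m generalizing y with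
  | zero =>
    convert! (hasDerivAt_pow_div_factorial 0 y).sub (hasDerivAt_expRem_zero y) using 1
    simp [expRem]
  | succ m ih =>
    exact (hasDerivAt_pow_div_factorial (m + 1) y).sub (ih y)

theorem expRem_zero_right (m : ℕ) : expRem m 0 = 0 := by
  induction m with
  | zero => simp [expRem]
  | succ m ih => rw [expRem_succ, ih]; simp

/-- Each remainder vanishes at `0` and is the derivative of the next one. -/
theorem expRem_pos (m : ℕ) {y : ℝ} (hy : 0 < y) : 0 < expRem m y := by
  have key : ∀ (f f' : ℝ → ℝ), (∀ y, HasDerivAt f (f' y) y) → f 0 = 0 → (∀ y, 0 < y → 0 < f' y) →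
      ∀ y, 0 < y → 0 < f y := by
    intro f f' hf h0 hpos y hy
    have hm : StrictMonoOn f (Ici 0) := by
      refine strictMonoOn_of_deriv_pos (convex_Ici 0)
        (fun x _ => (hf x).continuousAt.continuousWithinAt) fun x hx => ?_
      rw [interior_Ici] at hx
      rw [(hf x).deriv]
      exact hpos x hx
    have := hm (mem_Ici.2 le_rfl) (mem_Ici.2 hy.le) hy
    rwa [h0] at this
  induction m generalizing y with
  | zero => exact key _ _ hasDerivAt_expRem_zero (expRem_zero_right 0) (fun y _ => Real.exp_pos _) y hy
  | succ m ih =>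
    exact key _ _ (hasDerivAt_expRem_succ m) (expRem_zero_right _) (fun y hy => ih hy) y hy

theorem expRem_nonneg (m : ℕ) {y : ℝ} (hy : 0 ≤ y) : 0 ≤ expRem m y := by
  rcases hy.eq_or_lt with rfl | hy
  · rw [expRem_zero_right]
  · exact (expRem_pos m hy).le

theorem expRem_le_pow_succ (m : ℕ) {y : ℝ} (hy : 0 ≤ y) :
    expRem m y ≤ y ^ (m + 1) / (m + 1).factorial := by
  have := expRem_nonneg (m + 1) hy
  rw [expRem_succ] at this
  linarith

theorem expRem_le_pow (m : ℕ) {y : ℝ} (hy : 0 ≤ y) : expRem m y ≤ y ^ m / m.factorial := by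
  cases m with
  | zero => simp [expRem, (Real.exp_pos (-y)).le]
  | succ m =>
    have := expRem_nonneg m hy
    rw [expRem_succ]
    linarith

theorem pow_div_factorial_le {y : ℝ} (hy : 0 ≤ y) (m : ℕ) : y ^ m / m.factorial ≤ y ^ m :=
  div_le_self (by positivity) (by exact_mod_cast Nat.one_le_iff_ne_zero.2 (Nat.factorial_ne_zero m))

/-- The remainder of order `m` is `O(t^{m+1})` at `0` and `O(t^m)` at `∞`. -/
theorem integrableOn_expRem_mul_rpow {m : ℕ} {s : ℝ} (h1 : (m : ℝ) < s) (h2 : s < m + 1) :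
    IntegrableOn (fun t => expRem m t * t ^ (-1 - s)) (Ioi 0) := by
  have hmeas : Measurable (fun t : ℝ => expRem m t * t ^ (-1 - s)) :=
    (continuous_expRem m).measurable.mul (by fun_prop)
  rw [← Ioc_union_Ioi_eq_Ioi (zero_le_one (α := ℝ))]
  refine IntegrableOn.union ?_ ?_
  · have hI : IntegrableOn (fun t : ℝ => t ^ ((m : ℝ) - s)) (Ioc 0 1) :=
      (intervalIntegrable_iff_integrableOn_Ioc_of_le zero_le_one).1
        (intervalIntegral.intervalIntegrable_rpow' (by linarith))
    refine hI.mono' hmeas.aestronglyMeasurable ?_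
    filter_upwards [ae_restrict_mem measurableSet_Ioc] with t ht
    have ht0 : 0 < t := ht.1
    rw [Real.norm_eq_abs, abs_of_nonneg (mul_nonneg (expRem_nonneg m ht0.le) (by positivity))]
    calc expRem m t * t ^ (-1 - s) ≤ t ^ (m + 1) * t ^ (-1 - s) := by
          gcongr
          exact (expRem_le_pow_succ m ht0.le).trans (pow_div_factorial_le ht0.le _)
      _ = t ^ ((m : ℝ) - s) := by
          rw [← Real.rpow_natCast, ← Real.rpow_add ht0]
          congr 1; push_cast; ring
  · have hI : IntegrableOn (fun t : ℝ => t ^ ((m : ℝ) - 1 - s)) (Ioi 1) :=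
      integrableOn_Ioi_rpow_of_lt (by linarith) one_pos
    refine hI.mono' hmeas.aestronglyMeasurable ?_
    filter_upwards [ae_restrict_mem measurableSet_Ioi] with t ht
    have ht0 : 0 < t := one_pos.trans ht
    rw [Real.norm_eq_abs, abs_of_nonneg (mul_nonneg (expRem_nonneg m ht0.le) (by positivity))]
    calc expRem m t * t ^ (-1 - s) ≤ t ^ m * t ^ (-1 - s) := by
          gcongr
          exact (expRem_le_pow m ht0.le).trans (pow_div_factorial_le ht0.le _)
      _ = t ^ ((m : ℝ) - 1 - s) := by
          rw [← Real.rpow_natCast, ← Real.rpow_add ht0]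
          congr 1; ring

/-- The constant in the representation of `y ^ s` by Taylor remainders of `e^{-ty}`. -/
noncomputable def laplaceConst (m : ℕ) (s : ℝ) : ℝ := ∫ t in Ioi 0, expRem m t * t ^ (-1 - s)

theorem laplaceConst_pos {m : ℕ} {s : ℝ} (h1 : (m : ℝ) < s) (h2 : s < m + 1) :
    0 < laplaceConst m s := by
  unfold laplaceConst
  rw [setIntegral_pos_iff_support_of_nonneg_ae _ (integrableOn_expRem_mul_rpow h1 h2)]
  · have : Ioi (0 : ℝ) ⊆ (Function.support fun t => expRem m t * t ^ (-1 - s)) ∩ Ioi 0 := by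
      intro t ht
      exact ⟨(mul_pos (expRem_pos m ht) (Real.rpow_pos_of_pos ht _)).ne', ht⟩
    refine lt_of_lt_of_le ?_ (measure_mono this)
    rw [Real.volume_Ioi]; exact ENNReal.zero_lt_top
  · filter_upwards [ae_restrict_mem measurableSet_Ioi] with t ht
    exact mul_nonneg (expRem_nonneg m (le_of_lt ht)) (Real.rpow_nonneg (le_of_lt ht) _)

theorem expRem_comp_eq {m : ℕ} {s y t : ℝ} (hy : 0 < y) (ht : 0 < t) :
    expRem m (t * y) * t ^ (-1 - s)
      = y ^ (1 + s) * (fun r => expRem m r * r ^ (-1 - s)) (t * y) := by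
  beta_reduce
  rw [Real.mul_rpow ht.le hy.le]
  have : y ^ (1 + s) * y ^ (-1 - s) = 1 := by
    rw [← Real.rpow_add hy]; simp
  linear_combination (-expRem m (t * y) * t ^ (-1 - s)) * this

theorem integrableOn_expRem_comp {m : ℕ} {s : ℝ} (h1 : (m : ℝ) < s) (h2 : s < m + 1) {y : ℝ}
    (hy : 0 ≤ y) : IntegrableOn (fun t => expRem m (t * y) * t ^ (-1 - s)) (Ioi 0) := by
  rcases hy.eq_or_lt with rfl | hy
  · simp [expRem_zero_right]
  have h := (integrableOn_Ioi_comp_mul_right_iff (fun r => expRem m r * r ^ (-1 - s)) 0 hy).2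
    (by simpa using integrableOn_expRem_mul_rpow h1 h2)
  refine IntegrableOn.congr_fun (h.const_mul (y ^ (1 + s))) (fun t ht => ?_) measurableSet_Ioi
  exact (expRem_comp_eq hy ht).symm

/-- For `m < s < m + 1`, the power `y ^ s` is a superposition of the Taylor remainders of
`e^{-ty}` of order `m`. -/
theorem integral_expRem_comp {m : ℕ} {s : ℝ} (h1 : (m : ℝ) < s) {y : ℝ}
    (hy : 0 ≤ y) : ∫ t in Ioi 0, expRem m (t * y) * t ^ (-1 - s) = y ^ s * laplaceConst m s := by
  have hs : 0 < s := (Nat.cast_nonneg m).trans_lt h1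
  rcases hy.eq_or_lt with rfl | hy
  · simp [expRem_zero_right, Real.zero_rpow hs.ne']
  rw [setIntegral_congr_fun measurableSet_Ioi (fun t ht => expRem_comp_eq hy ht),
    integral_const_mul, integral_comp_mul_right_Ioi (fun r => expRem m r * r ^ (-1 - s)) _ hy,
    zero_mul, smul_eq_mul, ← mul_assoc, Real.rpow_add hy, Real.rpow_one]
  unfold laplaceConst
  field_simp

end LaplaceRepresentation

/-! ### The sign of the interaction of separated functions -/

section Interaction

variable {E : Type*} [NormedAddCommGroup E] [InnerProductSpace ℝ E] [FiniteDimensional ℝ E]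
  [MeasurableSpace E] [BorelSpace E]

open Module Filter Topology

/-- The symbol `(2π|ξ|)²` of `-Δ` in ordinary frequency. -/
noncomputable def freqSq (ξ : E) : ℝ := (2 * Real.pi * ‖ξ‖) ^ 2

theorem freqSq_nonneg (ξ : E) : 0 ≤ freqSq ξ := sq_nonneg _

theorem continuous_freqSq : Continuous (freqSq : E → ℝ) := by
  unfold freqSq; fun_prop

theorem freqWeight_eq_rpow (s : ℝ) (ξ : E) : freqWeight s ξ = freqSq ξ ^ s := by
  unfold freqWeight freqSq
  rw [← Real.rpow_natCast, ← Real.rpow_mul (by positivity)]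
  norm_num

/-- The density `Re (f̂ · conj ĝ)` of the `L²` pairing on the Fourier side. -/
noncomputable def crossDensity (f g : E → ℝ) (ξ : E) : ℝ :=
  (fhat f ξ * (starRingEnd ℂ) (fhat g ξ)).re

theorem continuous_crossDensity {f g : E → ℝ} (hf : Integrable f) (hg : Integrable g) :
    Continuous (crossDensity f g) :=
  Complex.continuous_re.comp ((continuous_fhat hf).mul
    (Complex.continuous_conj.comp (continuous_fhat hg)))

/-- The heat kernel `(4πt)^{-n/2} e^{-|w|²/(4t)}`, with the constants left in the form in which the
Fourier transform of the Gaussian `e^{-4π²t|ξ|²}` produces them. -/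
noncomputable def heatKernel (t : ℝ) (w : E) : ℝ :=
  (Real.pi / (4 * Real.pi ^ 2 * t)) ^ ((finrank ℝ E : ℝ) / 2) *
    Real.exp (-Real.pi ^ 2 * ‖w‖ ^ 2 / (4 * Real.pi ^ 2 * t))

theorem heatKernel_nonneg {t : ℝ} (ht : 0 < t) (w : E) : 0 ≤ heatKernel t w := by
  unfold heatKernel; positivity

theorem heatKernel_anti {t : ℝ} (ht : 0 < t) {w : E} {d : ℝ} (hd : 0 ≤ d) (h : d ≤ ‖w‖) :
    heatKernel t w ≤ (Real.pi / (4 * Real.pi ^ 2 * t)) ^ ((finrank ℝ E : ℝ) / 2) *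
      Real.exp (-Real.pi ^ 2 * d ^ 2 / (4 * Real.pi ^ 2 * t)) := by
  unfold heatKernel
  refine mul_le_mul_of_nonneg_left (Real.exp_le_exp.2 ?_) (by positivity)
  rw [neg_mul, neg_mul, neg_div, neg_div, neg_le_neg_iff]
  gcongr

/-- The pairing `⟨e^{tΔ} f, g⟩`, computed on the Fourier side. -/
noncomputable def heatPairing (f g : E → ℝ) (t : ℝ) : ℝ :=
  ∫ ξ, Real.exp (-(t * freqSq ξ)) * crossDensity f g ξ

theorem conj_fhat (g : E → ℝ) (ξ : E) : (starRingEnd ℂ) (fhat g ξ) = fhat g (-ξ) := by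
  unfold fhat
  rw [Real.fourier_eq, Real.fourier_eq, ← integral_conj]
  congr 1; ext x
  simp only [Circle.smul_def, smul_eq_mul, map_mul, Complex.conj_ofReal]
  rw [← Circle.coe_inv_eq_conj, ← AddChar.map_neg_eq_inv, inner_neg_right]

theorem integral_fhat_mul {f : E → ℝ} {k : E → ℂ} (hf : Integrable f) (hk : Integrable k) :
    ∫ ξ, fhat f ξ * k ξ = ∫ x, (f x : ℂ) * 𝓕 k x := by
  simpa using! VectorFourier.integral_bilin_fourierIntegral_eq_flip
      (ContinuousLinearMap.mul ℂ ℂ) (L := innerₗ E)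
      Real.continuous_fourierChar continuous_inner (integrable_complexOfReal hf) hk

theorem integrable_cexp_gaussian {b : ℝ} (hb : 0 < b) (x : E) :
    Integrable fun v : E => Complex.exp (-(b : ℂ) * ‖v‖ ^ 2
      + 2 * Real.pi * Complex.I * (inner ℝ x v : ℝ)) :=
  GaussianFourier.integrable_cexp_neg_mul_sq_norm_add (V := E) (b := b) (by simpa using hb)
    (2 * Real.pi * Complex.I) x

/-- The heat pairing is a double integral against the positive heat kernel. -/
theorem heatPairing_eq {f g : E → ℝ} (hf : Integrable f) (hg : Integrable g) {t : ℝ}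
    (ht : 0 < t) : heatPairing f g t = ∫ x, f x * ∫ z, g z * heatKernel t (x - z) := by
  set b : ℝ := 4 * Real.pi ^ 2 * t with hb
  have hb0 : 0 < b := by positivity
  set K : E → E → ℂ := fun x v => Complex.exp (-(b : ℂ) * ‖v‖ ^ 2
      + 2 * Real.pi * Complex.I * (inner ℝ x v : ℝ)) with hK
  have hK0 : ∀ ξ : E, K 0 ξ = (Real.exp (-(t * freqSq ξ)) : ℝ) := by
    intro ξ
    simp only [hK, inner_zero_left, Complex.ofReal_zero, mul_zero, add_zero, freqSq, hb]
    rw [Complex.ofReal_exp]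
    congr 1
    push_cast
    ring
  have hint : Integrable (fun ξ => K 0 ξ * fhat g (-ξ)) := by
    refine (integrable_cexp_gaussian hb0 0).mul_bdd (c := ∫ x, ‖(g x : ℂ)‖) ?_ ?_
    · exact ((continuous_fhat hg).comp continuous_neg).aestronglyMeasurable
    · exact Eventually.of_forall fun ξ =>
        VectorFourier.norm_fourierIntegral_le_integral_norm _ _ _ _ _
  have hF : ∀ x, 𝓕 (fun ξ => K 0 ξ * fhat g (-ξ)) x
      = ((∫ z, g z * heatKernel t (x - z) : ℝ) : ℂ) := by
    intro x
    rw [Real.fourier_eq, ← integral_neg_eq_self]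
    have h1 : ∀ ξ : E, Real.fourierChar (-(inner ℝ (-ξ) x)) • (K 0 (-ξ) * fhat g (- -ξ))
        = fhat g ξ * K x ξ := by
      intro ξ
      have h2 : Complex.exp (((2 * Real.pi * inner ℝ ξ x : ℝ) : ℂ) * Complex.I) * K 0 (-ξ)
          = K x ξ := by
        simp only [hK]
        rw [← Complex.exp_add]
        congr 1
        rw [inner_zero_left, norm_neg, real_inner_comm]
        push_cast
        ring
      rw [neg_neg, inner_neg_left, neg_neg, Circle.smul_def, smul_eq_mul, Real.fourierChar_apply,
        ← mul_assoc, h2, mul_comm]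
    simp_rw [h1]
    rw [integral_fhat_mul hg (integrable_cexp_gaussian hb0 x), ← integral_complex_ofReal]
    congr 1; ext z
    rw [fourier_gaussian_innerProductSpace' (by simpa using hb0)]
    unfold heatKernel
    rw [← hb]
    push_cast
    rw [Complex.ofReal_cpow (by positivity)]
    push_cast
    rfl
  have h2 : ∫ ξ, fhat f ξ * (K 0 ξ * fhat g (-ξ))
      = ((∫ x, f x * ∫ z, g z * heatKernel t (x - z) : ℝ) : ℂ) := by
    rw [integral_fhat_mul hf hint, ← integral_complex_ofReal]
    congr 1; ext x
    rw [hF]; push_cast; rfl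
  have hint2 : Integrable (fun ξ => fhat f ξ * (K 0 ξ * fhat g (-ξ))) := by
    refine hint.bdd_mul (c := ∫ x, ‖(f x : ℂ)‖) (continuous_fhat hf).aestronglyMeasurable ?_
    exact Eventually.of_forall fun ξ =>
      VectorFourier.norm_fourierIntegral_le_integral_norm _ _ _ _ _
  rw [← Complex.ofReal_re (∫ x, f x * ∫ z, g z * heatKernel t (x - z)), ← h2]
  have h3 : (∫ ξ, fhat f ξ * (K 0 ξ * fhat g (-ξ))).re
      = ∫ ξ, (fhat f ξ * (K 0 ξ * fhat g (-ξ))).re := (integral_re hint2).symm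
  rw [h3]
  unfold heatPairing crossDensity
  congr 1; ext ξ
  rw [conj_fhat, hK0, ← Complex.re_ofReal_mul]
  congr 1
  ring

theorem heatPairing_nonneg {f g : E → ℝ} (hf : Integrable f) (hg : Integrable g)
    (hf0 : ∀ x, 0 ≤ f x) (hg0 : ∀ x, 0 ≤ g x) {t : ℝ} (ht : 0 < t) : 0 ≤ heatPairing f g t := by
  rw [heatPairing_eq hf hg ht]
  exact integral_nonneg fun x => mul_nonneg (hf0 x) (integral_nonneg fun z =>
    mul_nonneg (hg0 z) (heatKernel_nonneg ht _))

/-- Separation of two functions: each vanishes almost everywhere outside a set, and the two sets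
have distance at least `d`. -/
def SeparatedBy (d : ℝ) (f g : E → ℝ) : Prop :=
  ∃ A B : Set E, (∀ᵐ x : E, x ∉ A → f x = 0) ∧ (∀ᵐ x : E, x ∉ B → g x = 0) ∧
    ∀ x ∈ A, ∀ y ∈ B, d ≤ ‖x - y‖

theorem heatPairing_le {f g : E → ℝ} (hf : Integrable f) (hg : Integrable g)
    (hf0 : ∀ x, 0 ≤ f x) (hg0 : ∀ x, 0 ≤ g x) {d : ℝ} (hd : 0 ≤ d) (hs : SeparatedBy d f g)
    {t : ℝ} (ht : 0 < t) :
    heatPairing f g t ≤ (∫ x, f x) * (∫ x, g x) *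
      ((Real.pi / (4 * Real.pi ^ 2 * t)) ^ ((finrank ℝ E : ℝ) / 2) *
        Real.exp (-Real.pi ^ 2 * d ^ 2 / (4 * Real.pi ^ 2 * t))) := by
  obtain ⟨A, B, hA, hB, hAB⟩ := hs
  set C := (Real.pi / (4 * Real.pi ^ 2 * t)) ^ ((finrank ℝ E : ℝ) / 2) *
        Real.exp (-Real.pi ^ 2 * d ^ 2 / (4 * Real.pi ^ 2 * t)) with hC
  have hC0 : 0 ≤ C := by positivity
  rw [heatPairing_eq hf hg ht, mul_assoc, ← integral_mul_const]
  have hinner : ∀ x ∈ A, ∫ z, g z * heatKernel t (x - z) ≤ (∫ z, g z) * C := by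
    intro x hx
    rw [← integral_mul_const]
    refine integral_mono_of_nonneg (Eventually.of_forall fun z =>
      mul_nonneg (hg0 z) (heatKernel_nonneg ht _)) (hg.mul_const C) ?_
    filter_upwards [hB] with z hz
    by_cases hzB : z ∈ B
    · exact mul_le_mul_of_nonneg_left (heatKernel_anti ht hd (hAB x hx z hzB)) (hg0 z)
    · simp [hz hzB]
  refine integral_mono_of_nonneg (Eventually.of_forall fun x => mul_nonneg (hf0 x)
    (integral_nonneg fun z => mul_nonneg (hg0 z) (heatKernel_nonneg ht _))) (hf.mul_const _) ?_
  filter_upwards [hA] with x hx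
  by_cases hxA : x ∈ A
  · exact mul_le_mul_of_nonneg_left (hinner x hxA) (hf0 x)
  · simp [hx hxA]

/-- The heat pairing of separated functions is flat at time `0`: it is at most a multiple of
`t^{-n/2} e^{-d²/(4t)}`. -/
theorem tendsto_heatPairing_div_pow {f g : E → ℝ} (hf : Integrable f) (hg : Integrable g)
    (hf0 : ∀ x, 0 ≤ f x) (hg0 : ∀ x, 0 ≤ g x) {d : ℝ} (hd : 0 < d) (hs : SeparatedBy d f g)
    (m : ℕ) : Tendsto (fun t => heatPairing f g t / t ^ m) (𝓝[>] 0) (𝓝 0) := by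
  set c : ℝ := (Real.pi / (4 * Real.pi ^ 2)) ^ ((finrank ℝ E : ℝ) / 2) with hc
  -- In the variable `r = 1 / t` the bound is a power of `r` times a decaying exponential.
  have hlim : Tendsto (fun t : ℝ => (∫ x, f x) * (∫ x, g x) * c *
      (fun r : ℝ => r ^ ((finrank ℝ E : ℝ) / 2 + m) * Real.exp (-(d ^ 2 / 4) * r)) t⁻¹)
      (𝓝[>] 0) (𝓝 0) := by
    have := ((tendsto_rpow_mul_exp_neg_mul_atTop_nhds_zero ((finrank ℝ E : ℝ) / 2 + m) (d ^ 2 / 4)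
      (by positivity)).comp tendsto_inv_nhdsGT_zero).const_mul ((∫ x, f x) * (∫ x, g x) * c)
    simpa using this
  refine squeeze_zero' ?_ ?_ hlim
  · filter_upwards [self_mem_nhdsWithin] with t ht
    exact div_nonneg (heatPairing_nonneg hf hg hf0 hg0 ht) (pow_nonneg (le_of_lt ht) _)
  · filter_upwards [self_mem_nhdsWithin] with t ht
    have ht0 : 0 < t := ht
    rw [div_le_iff₀ (by positivity)]
    refine (heatPairing_le hf hg hf0 hg0 hd.le hs ht0).trans (le_of_eq ?_)
    have e1 : Real.pi / (4 * Real.pi ^ 2 * t) = Real.pi / (4 * Real.pi ^ 2) * t⁻¹ := by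
      field_simp
    have e2 : -Real.pi ^ 2 * d ^ 2 / (4 * Real.pi ^ 2 * t) = -(d ^ 2 / 4) * t⁻¹ := by
      field_simp
    have e3 : (t⁻¹) ^ (m : ℝ) * t ^ m = 1 := by
      rw [Real.rpow_natCast, ← mul_pow, inv_mul_cancel₀ ht0.ne', one_pow]
    rw [e1, e2, Real.mul_rpow (by positivity) (by positivity), Real.rpow_add (by positivity)]
    linear_combination (-(∫ x, f x) * (∫ x, g x) * c * (t⁻¹) ^ ((finrank ℝ E : ℝ) / 2)
      * Real.exp (-(d ^ 2 / 4) * t⁻¹)) * e3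

theorem rpow_le_one_add_rpow {y p s : ℝ} (hy : 0 ≤ y) (hp : 0 ≤ p) (hps : p ≤ s) :
    y ^ p ≤ 1 + y ^ s := by
  rcases le_total y 1 with h | h
  · have := Real.rpow_le_one hy h hp
    have := Real.rpow_nonneg hy s
    linarith
  · have := Real.rpow_le_rpow_of_exponent_le h hps
    linarith

theorem IntegrableHs.integrable_freqSq_pow_mul {s : ℝ} {f g : E → ℝ} (hf : IntegrableHs s f)
    (hg : IntegrableHs s g) {m : ℕ} (hm : (m : ℝ) ≤ s) :
    Integrable (fun ξ => freqSq ξ ^ m * crossDensity f g ξ) := by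
  have hF := (integral_norm_fhat_sq hf.integrable hf.memLp).1
  have hG := (integral_norm_fhat_sq hg.integrable hg.memLp).1
  refine ((hF.add hG).add (hf.energy.add hg.energy)).mono' ?_ ?_
  · exact ((continuous_freqSq.pow m).mul
      (continuous_crossDensity hf.integrable hg.integrable)).aestronglyMeasurable
  · refine Eventually.of_forall fun ξ => ?_
    have h1 : freqSq ξ ^ m ≤ 1 + freqWeight s ξ := by
      rw [freqWeight_eq_rpow, ← Real.rpow_natCast]
      exact rpow_le_one_add_rpow (freqSq_nonneg ξ) (Nat.cast_nonneg m) hm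
    rw [Real.norm_eq_abs, abs_mul, abs_of_nonneg (pow_nonneg (freqSq_nonneg ξ) m)]
    calc freqSq ξ ^ m * |crossDensity f g ξ|
        ≤ (1 + freqWeight s ξ) * (‖fhat f ξ‖ ^ 2 + ‖fhat g ξ‖ ^ 2) :=
          mul_le_mul h1 (re_mul_conj_le _ _) (abs_nonneg _)
            (by have := freqWeight_nonneg s ξ; linarith)
      _ = _ := by simp only [Pi.add_apply]; ring

theorem integrable_exp_mul_crossDensity {s : ℝ} (hs : 0 ≤ s) {f g : E → ℝ} (hf : IntegrableHs s f)
    (hg : IntegrableHs s g) {t : ℝ} (ht : 0 < t) :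
    Integrable (fun ξ => Real.exp (-(t * freqSq ξ)) * crossDensity f g ξ) := by
  have h0 := hf.integrable_freqSq_pow_mul hg (m := 0) (by simpa using hs)
  simp only [pow_zero, one_mul] at h0
  refine h0.bdd_mul (c := 1) ?_ ?_
  · exact (by have := continuous_freqSq (E := E); fun_prop :
      Continuous fun ξ : E => Real.exp (-(t * freqSq ξ))).aestronglyMeasurable
  · refine Eventually.of_forall fun ξ => ?_
    rw [Real.norm_eq_abs, Real.abs_exp, Real.exp_le_one_iff]
    have := mul_nonneg ht.le (freqSq_nonneg ξ)
    linarith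

theorem integrable_expRem_mul {s : ℝ} {f g : E → ℝ} (hf : IntegrableHs s f)
    (hg : IntegrableHs s g) {m : ℕ} (hm : (m : ℝ) ≤ s) {t : ℝ} (ht : 0 < t) :
    Integrable (fun ξ => expRem m (t * freqSq ξ) * crossDensity f g ξ) := by
  refine ((hf.integrable_freqSq_pow_mul hg hm).norm.const_mul (t ^ m)).mono' ?_ ?_
  · exact (((continuous_expRem m).comp (continuous_freqSq.const_mul t)).mul
      (continuous_crossDensity hf.integrable hg.integrable)).aestronglyMeasurable
  · refine Eventually.of_forall fun ξ => ?_
    have hy := mul_nonneg ht.le (freqSq_nonneg ξ)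
    rw [norm_mul, norm_mul, ← mul_assoc, Real.norm_eq_abs, abs_of_nonneg (expRem_nonneg m hy),
      Real.norm_eq_abs (freqSq ξ ^ m), abs_of_nonneg (pow_nonneg (freqSq_nonneg ξ) m), ← mul_pow]
    exact mul_le_mul_of_nonneg_right
      ((expRem_le_pow m hy).trans (pow_div_factorial_le hy m)) (norm_nonneg _)

/-- If the lower moments vanish and the remainder of order `m` integrates to the heat pairing up to
a polynomial term, flatness of the heat pairing forces the moment of order `m` to vanish. -/
theorem moment_eq_zero_of_expansion {s : ℝ} {f g : E → ℝ} (hf : IntegrableHs s f)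
    (hg : IntegrableHs s g) (hf0 : ∀ x, 0 ≤ f x) (hg0 : ∀ x, 0 ≤ g x) {d : ℝ} (hd : 0 < d)
    (hsep : SeparatedBy d f g) {m : ℕ} (hm : (m : ℝ) ≤ s)
    (hexp : ∀ t, 0 < t → ∫ ξ, expRem m (t * freqSq ξ) * crossDensity f g ξ
      = t ^ m / m.factorial * (∫ ξ, freqSq ξ ^ m * crossDensity f g ξ)
        + (-1) ^ (m + 1) * heatPairing f g t) :
    ∫ ξ, freqSq ξ ^ m * crossDensity f g ξ = 0 := by
  set M := ∫ ξ, freqSq ξ ^ m * crossDensity f g ξ with hM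
  have hflat := tendsto_heatPairing_div_pow hf.integrable hg.integrable hf0 hg0 hd hsep m
  -- The quotient by `t ^ m` has two limits at `0`: one by the expansion, and `0` by dominated
  -- convergence, since `expRem m y = O(y ^ (m + 1))`.
  have h1 : Tendsto (fun t => (∫ ξ, expRem m (t * freqSq ξ) * crossDensity f g ξ) / t ^ m)
      (𝓝[>] 0) (𝓝 (M / m.factorial)) := by
    have h2 : Tendsto (fun t : ℝ => M / m.factorial + (-1) ^ (m + 1) * (heatPairing f g t / t ^ m))
        (𝓝[>] 0) (𝓝 (M / m.factorial + (-1) ^ (m + 1) * 0)) :=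
      tendsto_const_nhds.add (hflat.const_mul _)
    rw [mul_zero, add_zero] at h2
    refine h2.congr' ?_
    filter_upwards [self_mem_nhdsWithin] with t ht
    have ht0 : (0 : ℝ) < t := ht
    rw [hexp t ht0]
    field_simp
  have h2 : Tendsto (fun t => (∫ ξ, expRem m (t * freqSq ξ) * crossDensity f g ξ) / t ^ m)
      (𝓝[>] 0) (𝓝 0) := by
    have h3 : Tendsto (fun t => ∫ ξ, expRem m (t * freqSq ξ) * crossDensity f g ξ / t ^ m)
        (𝓝[>] 0) (𝓝 (∫ ξ : E, (0 : ℝ))) := by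
      refine tendsto_integral_filter_of_dominated_convergence
        (fun ξ => ‖freqSq ξ ^ m * crossDensity f g ξ‖) ?_ ?_
        (hf.integrable_freqSq_pow_mul hg hm).norm ?_
      · exact Eventually.of_forall fun t => ((((continuous_expRem m).comp
          (continuous_freqSq.const_mul t)).mul (continuous_crossDensity hf.integrable
            hg.integrable)).div_const _).aestronglyMeasurable
      · filter_upwards [self_mem_nhdsWithin] with t ht
        have ht0 : (0 : ℝ) < t := ht
        refine Eventually.of_forall fun ξ => ?_
        have hy := mul_nonneg ht0.le (freqSq_nonneg ξ)
        rw [norm_div, norm_mul, norm_mul, norm_pow t, Real.norm_eq_abs t, abs_of_pos ht0,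
          div_le_iff₀ (by positivity), Real.norm_eq_abs, abs_of_nonneg (expRem_nonneg m hy),
          Real.norm_eq_abs (freqSq ξ ^ m), abs_of_nonneg (pow_nonneg (freqSq_nonneg ξ) m)]
        have := (expRem_le_pow m hy).trans (pow_div_factorial_le hy m)
        rw [mul_pow] at this
        nlinarith [norm_nonneg (crossDensity f g ξ),
          mul_le_mul_of_nonneg_right this (norm_nonneg (crossDensity f g ξ))]
      · refine Eventually.of_forall fun ξ => ?_
        have h4 : Tendsto (fun t : ℝ => t * (freqSq ξ ^ (m + 1) * |crossDensity f g ξ|))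
            (𝓝[>] 0) (𝓝 0) := by
          have : Tendsto (fun t : ℝ => t * (freqSq ξ ^ (m + 1) * |crossDensity f g ξ|))
            (𝓝 0) (𝓝 (0 * (freqSq ξ ^ (m + 1) * |crossDensity f g ξ|))) :=
            tendsto_id.mul_const _
          rw [zero_mul] at this
          exact this.mono_left nhdsWithin_le_nhds
        refine squeeze_zero_norm' ?_ h4
        filter_upwards [self_mem_nhdsWithin] with t ht
        have ht0 : (0 : ℝ) < t := ht
        have hy := mul_nonneg ht0.le (freqSq_nonneg ξ)
        rw [norm_div, norm_mul, norm_pow t, Real.norm_eq_abs t, abs_of_pos ht0,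
          div_le_iff₀ (by positivity), Real.norm_eq_abs, abs_of_nonneg (expRem_nonneg m hy),
          Real.norm_eq_abs]
        have := (expRem_le_pow_succ m hy).trans (pow_div_factorial_le hy (m + 1))
        rw [mul_pow] at this
        calc _ ≤ t ^ (m + 1) * freqSq ξ ^ (m + 1) * |crossDensity f g ξ| :=
              mul_le_mul_of_nonneg_right this (abs_nonneg _)
          _ = _ := by ring
    simpa [integral_div] using h3
  have h3 := tendsto_nhds_unique h1 h2
  have : (m.factorial : ℝ) ≠ 0 := by positivity
  simpa [this] using h3

/-- Locality of `(-Δ)^m` in weak form, together with the resulting formula for the Taylor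
remainder: all moments of the cross density up to order `s` vanish. -/
theorem moment_eq_zero_and_expansion {s : ℝ} {f g : E → ℝ} (hf : IntegrableHs s f)
    (hg : IntegrableHs s g) (hf0 : ∀ x, 0 ≤ f x) (hg0 : ∀ x, 0 ≤ g x) {d : ℝ} (hd : 0 < d)
    (hsep : SeparatedBy d f g) (m : ℕ) (hm : (m : ℝ) ≤ s) :
    ∫ ξ, freqSq ξ ^ m * crossDensity f g ξ = 0 ∧
      ∀ t, 0 < t → ∫ ξ, expRem m (t * freqSq ξ) * crossDensity f g ξ
        = (-1) ^ (m + 1) * heatPairing f g t := by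
  have finish : ∀ m : ℕ, (m : ℝ) ≤ s →
      (∀ t, 0 < t → ∫ ξ, expRem m (t * freqSq ξ) * crossDensity f g ξ
      = t ^ m / m.factorial * (∫ ξ, freqSq ξ ^ m * crossDensity f g ξ)
        + (-1) ^ (m + 1) * heatPairing f g t) →
      ∫ ξ, freqSq ξ ^ m * crossDensity f g ξ = 0 ∧
      ∀ t, 0 < t → ∫ ξ, expRem m (t * freqSq ξ) * crossDensity f g ξ
        = (-1) ^ (m + 1) * heatPairing f g t := by
    intro m hm hexp
    have h0 := moment_eq_zero_of_expansion hf hg hf0 hg0 hd hsep hm hexp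
    refine ⟨h0, fun t ht => ?_⟩
    rw [hexp t ht, h0, mul_zero, zero_add]
  induction m with
  | zero =>
    refine finish 0 hm fun t ht => ?_
    have hi0 := hf.integrable_freqSq_pow_mul hg hm
    have hie := integrable_exp_mul_crossDensity (by simpa using hm) hf hg ht
    simp only [pow_zero, Nat.factorial_zero, Nat.cast_one, div_one, one_mul, zero_add,
      pow_one] at hi0 ⊢
    unfold heatPairing
    rw [neg_one_mul, ← sub_eq_add_neg, ← integral_sub hi0 hie]
    congr 1; ext ξ
    simp only [expRem]; ring
  | succ m ih =>
    have hm' : (m : ℝ) ≤ s := by push_cast at hm; linarith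
    refine finish (m + 1) hm fun t ht => ?_
    have h1 := (ih hm').2 t ht
    have hi := (hf.integrable_freqSq_pow_mul hg hm).const_mul (t ^ (m + 1) / (m + 1).factorial)
    have hi2 := integrable_expRem_mul hf hg hm' ht
    have h2 : ∫ ξ, expRem (m + 1) (t * freqSq ξ) * crossDensity f g ξ
        = t ^ (m + 1) / (m + 1).factorial * (∫ ξ, freqSq ξ ^ (m + 1) * crossDensity f g ξ)
          - ∫ ξ, expRem m (t * freqSq ξ) * crossDensity f g ξ := by
      rw [← integral_const_mul, ← integral_sub hi hi2]
      congr 1; ext ξ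
      rw [expRem_succ, mul_pow]; ring
    rw [h2, h1]
    ring

/-- At integer order the interaction of separated functions vanishes, by locality. -/
theorem energyForm_natCast_eq_zero {m : ℕ} {f g : E → ℝ} (hf : IntegrableHs m f)
    (hg : IntegrableHs m g) (hf0 : ∀ x, 0 ≤ f x) (hg0 : ∀ x, 0 ≤ g x) {d : ℝ} (hd : 0 < d)
    (hsep : SeparatedBy d f g) : energyForm m f g = 0 := by
  rw [← (moment_eq_zero_and_expansion hf hg hf0 hg0 hd hsep m le_rfl).1]
  unfold energyForm
  congr 1; ext ξ
  rw [freqWeight_eq_rpow, Real.rpow_natCast]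
  rfl

/-- For `m < s < m + 1` the interaction of nonnegative separated functions has the sign
`(-1)^{m+1}`: it is a superposition of heat pairings with weights of that sign. -/
theorem energyForm_sign {m : ℕ} {s : ℝ} (h1 : (m : ℝ) < s) (h2 : s < m + 1) {f g : E → ℝ}
    (hf : IntegrableHs s f) (hg : IntegrableHs s g) (hf0 : ∀ x, 0 ≤ f x) (hg0 : ∀ x, 0 ≤ g x)
    {d : ℝ} (hd : 0 < d) (hsep : SeparatedBy d f g) :
    0 ≤ (-1) ^ (m + 1) * energyForm s f g := by
  have hC := laplaceConst_pos h1 h2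
  set Φ : E → ℝ → ℝ := fun ξ t => expRem m (t * freqSq ξ) * t ^ (-1 - s) * crossDensity f g ξ with hΦ
  have hmix := hf.integrable_mixed hg
  have hcr := continuous_crossDensity hf.integrable hg.integrable
  have hmeas : AEStronglyMeasurable (Function.uncurry Φ)
      ((volume : Measure E).prod (volume.restrict (Ioi 0))) := by
    refine Measurable.aestronglyMeasurable ?_
    refine Measurable.mul (Measurable.mul ?_ ?_) (hcr.measurable.comp measurable_fst)
    · exact (continuous_expRem m).measurable.comp
        (measurable_snd.mul (continuous_freqSq.measurable.comp measurable_fst))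
    · exact measurable_snd.pow_const _
  have hnorm : ∀ ξ, ∫ t in Ioi 0, ‖Φ ξ t‖ = laplaceConst m s *
      ‖freqWeight s ξ * (fhat f ξ * (starRingEnd ℂ) (fhat g ξ)).re‖ := by
    intro ξ
    have : ∀ t ∈ Ioi (0 : ℝ), ‖Φ ξ t‖
        = expRem m (t * freqSq ξ) * t ^ (-1 - s) * ‖crossDensity f g ξ‖ := by
      intro t ht
      simp only [hΦ]
      rw [norm_mul, Real.norm_eq_abs (expRem m _ * _), abs_of_nonneg (mul_nonneg (expRem_nonneg m
        (mul_nonneg (le_of_lt ht) (freqSq_nonneg ξ))) (Real.rpow_nonneg (le_of_lt ht) _))]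
    rw [setIntegral_congr_fun measurableSet_Ioi this, integral_mul_const,
      integral_expRem_comp h1 (freqSq_nonneg ξ), norm_mul, Real.norm_eq_abs (freqWeight s ξ),
      abs_of_nonneg (freqWeight_nonneg s ξ), freqWeight_eq_rpow]
    unfold crossDensity
    ring
  have hint : Integrable (Function.uncurry Φ)
      ((volume : Measure E).prod (volume.restrict (Ioi 0))) := by
    rw [integrable_prod_iff hmeas]
    constructor
    · exact Eventually.of_forall fun ξ =>
        (integrableOn_expRem_comp h1 h2 (freqSq_nonneg ξ)).mul_const (crossDensity f g ξ)
    · simp only [Function.uncurry_apply_pair, hnorm]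
      exact hmix.norm.const_mul _
  -- The double integral of `Φ` in the order `t`, `ξ` is the interaction, and in the order `ξ`, `t` it
  -- is the superposition of heat pairings.
  have hswap := integral_integral_swap hint
  have hleft : ∫ ξ, ∫ t in Ioi 0, Φ ξ t = laplaceConst m s * energyForm s f g := by
    unfold energyForm
    rw [← integral_const_mul]
    congr 1; ext ξ
    simp only [hΦ]
    rw [integral_mul_const, integral_expRem_comp h1 (freqSq_nonneg ξ), freqWeight_eq_rpow]
    unfold crossDensity
    ring
  have hright : ∫ t in Ioi 0, ∫ ξ, Φ ξ t
      = (-1) ^ (m + 1) * ∫ t in Ioi 0, t ^ (-1 - s) * heatPairing f g t := by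
    rw [← integral_const_mul]
    refine setIntegral_congr_fun measurableSet_Ioi fun t ht => ?_
    have h3 := (moment_eq_zero_and_expansion hf hg hf0 hg0 hd hsep m h1.le).2 t ht
    have h4 : ∀ ξ, Φ ξ t = t ^ (-1 - s) * (expRem m (t * freqSq ξ) * crossDensity f g ξ) := by
      intro ξ; simp only [hΦ]; ring
    simp_rw [h4]
    rw [integral_const_mul, h3]
    ring
  rw [hleft, hright] at hswap
  have hnn : 0 ≤ ∫ t in Ioi 0, t ^ (-1 - s) * heatPairing f g t :=
    setIntegral_nonneg measurableSet_Ioi fun t ht => mul_nonneg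
      (Real.rpow_nonneg (le_of_lt ht) _) (heatPairing_nonneg hf.integrable hg.integrable hf0 hg0 ht)
  have hsq : ((-1 : ℝ) ^ (m + 1)) * (-1) ^ (m + 1) = 1 := by
    rw [← mul_pow]; norm_num
  have h5 : laplaceConst m s * ((-1) ^ (m + 1) * energyForm s f g)
      = ∫ t in Ioi 0, t ^ (-1 - s) * heatPairing f g t := by
    linear_combination (-1) ^ (m + 1) * hswap
      + (∫ t in Ioi 0, t ^ (-1 - s) * heatPairing f g t) * hsq
  exact nonneg_of_mul_nonneg_right (h5 ▸ hnn) hC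

end Interaction

/-! ### Two bumps -/

section TwoBumps

variable {E : Type*} [NormedAddCommGroup E] [InnerProductSpace ℝ E] [FiniteDimensional ℝ E]
  [MeasurableSpace E] [BorelSpace E]

open Module Filter Topology

variable (E) in
/-- Nonnegative separated functions have nonnegative interaction at order `s`. -/
def InteractionNonneg (s : ℝ) : Prop :=
  ∀ f g : E → ℝ, IntegrableHs s f → IntegrableHs s g → (∀ x, 0 ≤ f x) → (∀ x, 0 ≤ g x) →
    ∀ d, 0 < d → SeparatedBy d f g → 0 ≤ energyForm s f g

variable (E) in
/-- Nonnegative separated functions have nonpositive interaction at order `s`. -/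
def InteractionNonpos (s : ℝ) : Prop :=
  ∀ f g : E → ℝ, IntegrableHs s f → IntegrableHs s g → (∀ x, 0 ≤ f x) → (∀ x, 0 ≤ g x) →
    ∀ d, 0 < d → SeparatedBy d f g → energyForm s f g ≤ 0

theorem interactionNonneg_natCast (m : ℕ) : InteractionNonneg E (m : ℝ) :=
  fun _ _ hf hg hf0 hg0 _ hd hs => (energyForm_natCast_eq_zero hf hg hf0 hg0 hd hs).ge

theorem interactionNonneg_of_odd {m : ℕ} (hm : Odd m) {s : ℝ} (h1 : (m : ℝ) < s)
    (h2 : s < m + 1) : InteractionNonneg E s := by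
  intro f g hf hg hf0 hg0 d hd hs
  have := energyForm_sign h1 h2 hf hg hf0 hg0 hd hs
  rwa [hm.add_one.neg_one_pow, one_mul] at this

theorem interactionNonpos_of_even {m : ℕ} (hm : Even m) {s : ℝ} (h1 : (m : ℝ) < s)
    (h2 : s < m + 1) : InteractionNonpos E s := by
  intro f g hf hg hf0 hg0 d hd hs
  have := energyForm_sign h1 h2 hf hg hf0 hg0 hd hs
  rw [hm.add_one.neg_one_pow] at this
  linarith

theorem interaction_nonneg_or_nonpos {s : ℝ} (hs : 0 ≤ s) :
    InteractionNonneg E s ∨ InteractionNonpos E s := by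
  rcases (Nat.floor_le hs).eq_or_lt with h | h
  · left; rw [← h]; exact interactionNonneg_natCast _
  · rcases Nat.even_or_odd ⌊s⌋₊ with he | ho
    · exact Or.inr (interactionNonpos_of_even he h (Nat.lt_floor_add_one s))
    · exact Or.inl (interactionNonneg_of_odd ho h (Nat.lt_floor_add_one s))

theorem interactionNonneg_of_mem_Icc {s : ℝ} (hs : 0 < s) {k : ℕ} (h1 : 2 * (k : ℝ) - 1 ≤ s)
    (h2 : s ≤ 2 * (k : ℝ)) : InteractionNonneg E s := by
  have hk : k ≠ 0 := by rintro rfl; simp at h2; linarith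
  obtain ⟨j, rfl⟩ := Nat.exists_eq_succ_of_ne_zero hk
  have e1 : 2 * ((j.succ : ℕ) : ℝ) - 1 = ((2 * j + 1 : ℕ) : ℝ) := by push_cast; ring
  have e2 : 2 * ((j.succ : ℕ) : ℝ) = ((2 * j + 1 : ℕ) : ℝ) + 1 := by push_cast; ring
  rw [e1] at h1
  rw [e2] at h2
  rcases h1.eq_or_lt with h1 | h1
  · rw [← h1]; exact interactionNonneg_natCast _
  rcases h2.eq_or_lt with h2 | h2
  · have : s = ((2 * j + 1 + 1 : ℕ) : ℝ) := by rw [h2]; push_cast; ring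
    rw [this]; exact interactionNonneg_natCast _
  · exact interactionNonneg_of_odd ⟨j, rfl⟩ h1 h2

theorem separatedBy_of_support {f g : E → ℝ} {a : ℝ} (ha : 0 < a) {p q : E} {ρ σ : ℝ}
    (hf : ∀ᵐ x : E, ρ < ‖a • x - p‖ → f x = 0) (hg : ∀ᵐ x : E, σ < ‖a • x - q‖ → g x = 0) :
    SeparatedBy ((‖p - q‖ - (ρ + σ)) / a) f g := by
  refine ⟨{x | ‖a • x - p‖ ≤ ρ}, {x | ‖a • x - q‖ ≤ σ}, ?_, ?_, ?_⟩
  · filter_upwards [hf] with x hx h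
    exact hx (not_le.1 h)
  · filter_upwards [hg] with x hx h
    exact hx (not_le.1 h)
  · intro x hx y hy
    simp only [mem_ofPred_eq] at hx hy
    rw [div_le_iff₀ ha]
    have h1 : p - q = (a • x - a • y) - (a • x - p) + (a • y - q) := by abel
    have h2 : ‖p - q‖ ≤ ‖a • x - a • y‖ + ‖a • x - p‖ + ‖a • y - q‖ := by
      rw [h1]
      exact (norm_add_le _ _).trans (add_le_add (norm_sub_le _ _) le_rfl)
    rw [← smul_sub, norm_smul, Real.norm_eq_abs, abs_of_pos ha] at h2
    linarith

theorem dilation_support {v : E → ℝ} (hv : ∀ᵐ x : E, x ∉ Metric.closedBall (0 : E) 1 → v x = 0)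
    {a : ℝ} (ha : 0 < a) (y : E) : ∀ᵐ x : E, 1 < ‖a • x - y‖ → v (a • x - y) = 0 := by
  filter_upwards [(quasiMeasurePreserving_dilation ha y).ae hv] with x hx h
  exact hx (by rw [mem_closedBall_zero_iff]; exact not_le.2 h)

theorem separatedBy_bump_dilation {v : E → ℝ}
    (hv : ∀ᵐ x : E, x ∉ Metric.closedBall (0 : E) 1 → v x = 0) {a : ℝ} (ha : 0 < a) (y : E) :
    SeparatedBy ((‖y‖ - (a + 1)) / a) v (fun x => v (a • x - y)) := by
  have h := separatedBy_of_support (p := 0) (q := y) (ρ := a) (σ := 1) (f := v) ha ?_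
    (dilation_support hv ha y)
  · simpa using h
  · filter_upwards [hv] with x hx h
    apply hx
    rw [sub_zero, norm_smul, Real.norm_eq_abs, abs_of_pos ha] at h
    rw [mem_closedBall_zero_iff, not_le]
    nlinarith

theorem integrable_of_memLp_of_support {v : E → ℝ} {r : ℝ} (h : MemLp v 2)
    (hv : ∀ᵐ x : E, x ∉ Metric.closedBall (0 : E) r → v x = 0) : Integrable v := by
  have h1 : IntegrableOn v (Metric.closedBall (0 : E) r) := by
    have : IsFiniteMeasure (volume.restrict (Metric.closedBall (0 : E) r)) :=
      ⟨by simpa using measure_closedBall_lt_top⟩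
    exact ((h.restrict _).integrable (by norm_num))
  have h2 : IntegrableOn v (Metric.closedBall (0 : E) r)ᶜ := by
    refine (integrable_zero E ℝ _).congr ?_
    filter_upwards [ae_restrict_of_ae hv, ae_restrict_mem Metric.isClosed_closedBall.measurableSet.compl]
      with x hx hx'
    exact (hx hx').symm
  rw [← integrableOn_univ, ← union_compl_self (Metric.closedBall (0 : E) r)]
  exact h1.union h2

theorem MemHs0.integrableHs {s : ℝ} {v : E → ℝ} (h : MemHs0 s (Metric.ball 0 1) v) :
    IntegrableHs s v ∧ ∀ᵐ x : E, x ∉ Metric.closedBall (0 : E) 1 → v x = 0 := by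
  have h2 := h.2
  rw [closure_ball (0 : E) one_ne_zero] at h2
  exact ⟨IntegrableHs.of_fracEnergy_lt_top (integrable_of_memLp_of_support h.1.1 h2) h.1.1 h.1.2, h2⟩

theorem energyForm_twoBump {s : ℝ} {v : E → ℝ} (hv : IntegrableHs s v) {a : ℝ} (ha : 0 < a) (y : E) :
    energyForm s (twoBump v a y) (twoBump v a y)
      = energyForm s v v + a ^ (2 * s - finrank ℝ E) * energyForm s v v
        + 2 * energyForm s v (fun x => v (a • x - y)) := by
  rw [← energyForm_dilation s v ha y]
  exact energyForm_add_self hv (hv.dilation ha y)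

theorem IntegrableHs.twoBump {s : ℝ} {v : E → ℝ} (hv : IntegrableHs s v) {a : ℝ} (ha : 0 < a)
    (y : E) : IntegrableHs s (twoBump v a y) :=
  hv.add (hv.dilation ha y)

/-- The points `± r e_i` of an orthonormal basis, the centres of a symmetric configuration of
bumps. -/
noncomputable def crossPoint (r : ℝ) (i : Fin (finrank ℝ E) × Bool) : E :=
  (if i.2 then r else -r) • stdOrthonormalBasis ℝ E i.1

theorem norm_crossPoint {r : ℝ} (hr : 0 ≤ r) (i : Fin (finrank ℝ E) × Bool) :
    ‖(crossPoint r i : E)‖ = r := by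
  unfold crossPoint
  rw [norm_smul, OrthonormalBasis.norm_eq_one, mul_one]
  split_ifs <;> simp [abs_of_nonneg hr]

theorem norm_crossPoint_sub_gt {r : ℝ} (hr : 2 < r) {i j : Fin (finrank ℝ E) × Bool} (hij : i ≠ j) :
    2 < ‖(crossPoint r i : E) - crossPoint r j‖ := by
  have hinner : inner ℝ (crossPoint r i : E) (crossPoint r j) ≤ 0 := by
    unfold crossPoint
    rw [inner_smul_left, inner_smul_right, OrthonormalBasis.inner_eq_ite]
    obtain ⟨i1, i2⟩ := i
    obtain ⟨j1, j2⟩ := j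
    by_cases h : i1 = j1
    · subst h
      cases i2 <;> cases j2 <;> simp at hij ⊢ <;> nlinarith
    · simp [h]
  have h := norm_sub_sq_real (crossPoint r i : E) (crossPoint r j)
  rw [norm_crossPoint (by linarith), norm_crossPoint (by linarith)] at h
  nlinarith [norm_nonneg ((crossPoint r i : E) - crossPoint r j)]

/-- A nonpositive interaction is bounded below by the positivity of the energy, tested on `2 v`
surrounded by `2n` copies of the second bump centred at the points `± |y| e_i`: the copies interact
with one another nonpositively, and each of them interacts with `v` as the bump at `y` does. -/
theorem InteractionNonpos.energyForm_dilation_ge {s : ℝ} (hneg : InteractionNonpos E s)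
    {v : E → ℝ} (hv : IntegrableHs s v)
    (hsupp : ∀ᵐ x : E, x ∉ Metric.closedBall (0 : E) 1 → v x = 0) (hv0 : ∀ x, 0 ≤ v x)
    (hrad : ∀ x y : E, ‖x‖ = ‖y‖ → v x = v y) {a : ℝ} (ha : 1 ≤ a) {y : E} (hy : 1 + a < ‖y‖) :
    0 ≤ 4 * energyForm s v v
      + 2 * finrank ℝ E * (a ^ (2 * s - finrank ℝ E) * energyForm s v v)
      + 8 * finrank ℝ E * energyForm s v (fun x => v (a • x - y)) := by
  have ha0 : 0 < a := by linarith
  set W : Fin (finrank ℝ E) × Bool → E → ℝ :=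
    fun i x => v (a • x - crossPoint ‖y‖ i) with hW
  have hWi : ∀ i, IntegrableHs s (W i) := fun i => hv.dilation ha0 _
  have hcard : ((Finset.univ : Finset (Fin (finrank ℝ E) × Bool)).card : ℝ) = 2 * finrank ℝ E := by
    rw [Finset.card_univ, Fintype.card_prod, Fintype.card_fin, Fintype.card_bool]
    push_cast; ring
  have hsum : IntegrableHs s (fun x => ∑ i, W i x) := IntegrableHs.sum _ fun i _ => hWi i
  have hcross : energyForm s (fun x => ∑ i, W i x) v
      = 2 * finrank ℝ E * energyForm s v (fun x => v (a • x - y)) := by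
    rw [energyForm_sum_left _ (fun i _ => hWi i) hv]
    have : ∀ i ∈ Finset.univ, energyForm s (W i) v = energyForm s v (fun x => v (a • x - y)) := by
      intro i _
      rw [energyForm_comm]
      exact energyForm_dilation_of_norm_eq s hrad a (norm_crossPoint (norm_nonneg y) i)
    rw [Finset.sum_congr rfl this, Finset.sum_const, nsmul_eq_mul, hcard]
  have hself : energyForm s (fun x => ∑ i, W i x) (fun x => ∑ i, W i x)
      ≤ 2 * finrank ℝ E * (a ^ (2 * s - finrank ℝ E) * energyForm s v v) := by
    rw [energyForm_sum_left _ (fun i _ => hWi i) hsum, ← hcard, ← nsmul_eq_mul]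
    refine Finset.sum_le_card_nsmul _ _ _ fun i _ => ?_
    rw [energyForm_comm, energyForm_sum_left _ (fun j _ => hWi j) (hWi i),
      ← energyForm_dilation s v ha0 (crossPoint ‖y‖ i), ← Finset.add_sum_erase _ _ (Finset.mem_univ i)]
    have : ∑ j ∈ Finset.univ.erase i, energyForm s (W j) (W i) ≤ 0 := by
      refine Finset.sum_nonpos fun j hj => ?_
      have hd := norm_crossPoint_sub_gt (E := E) (r := ‖y‖) (by linarith) (Finset.ne_of_mem_erase hj)
      refine hneg _ _ (hWi j) (hWi i) (fun x => hv0 _) (fun x => hv0 _) _ ?_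
        (separatedBy_of_support ha0 (dilation_support hsupp ha0 _) (dilation_support hsupp ha0 _))
      exact div_pos (by linarith) ha0
    linarith
  have h := energyForm_self_nonneg s (fun x => 2 * v x + ∑ i, W i x)
  rw [energyForm_add_self (hv.const_mul 2) hsum, energyForm_const_mul_left, energyForm_comm s v,
    energyForm_const_mul_left, energyForm_const_mul_left,
    energyForm_comm s v (fun x => ∑ i, W i x), hcross] at h
  linarith

/-- With `b = a / (1 + a^n)^{1/n}`: if `2s ≥ n` then `b^{2s-n} ≤ 1`, and otherwise, for
`x = a^{-n} ≤ 1` and `θ = (n - 2s)/n ∈ (0, 1)`, the claim is `(1 + x)^θ < 1 + x^θ`. -/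
theorem twoBump_factor_rpow_lt {a : ℝ} (ha : 1 ≤ a) {n : ℕ} (hn : n ≠ 0) {s : ℝ} (hs : 0 < s) :
    (a / (1 + a ^ n) ^ (1 / (n : ℝ))) ^ (2 * s - n) < 1 + a ^ (2 * s - n) := by
  have ha0 : 0 < a := by linarith
  have hb0 := twoBump_factor_pos ha0 n
  have hbn := twoBump_factor_pow ha0 hn
  set b := a / (1 + a ^ n) ^ (1 / (n : ℝ)) with hb
  have hn0 : (0 : ℝ) < n := by positivity
  rcases le_or_gt 0 (2 * s - n) with hp | hp
  · have hb1 : b ≤ 1 := by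
      have : b ^ n ≤ 1 ^ n := by
        rw [hbn, one_pow, div_le_one (by positivity)]
        linarith
      exact le_of_pow_le_pow_left₀ hn zero_le_one this
    have h1 := Real.rpow_le_one hb0.le hb1 hp
    have h2 := Real.rpow_pos_of_pos ha0 (2 * s - n)
    linarith
  · set θ : ℝ := (n - 2 * s) / n with hθ
    have hθ0 : 0 < θ := div_pos (by linarith) hn0
    have hθ1 : θ < 1 := by rw [hθ, div_lt_one hn0]; linarith
    have hpθ : 2 * s - n = n * (-θ) := by rw [hθ]; field_simp; ring
    set x : ℝ := (a ^ n)⁻¹ with hx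
    have hx0 : 0 < x := by positivity
    have hx1 : x ≤ 1 := inv_le_one_of_one_le₀ (one_le_pow₀ ha)
    have e1 : b ^ (2 * s - n) = (1 + x) ^ θ := by
      rw [hpθ, Real.rpow_mul hb0.le, Real.rpow_natCast, hbn, Real.rpow_neg (by positivity),
        ← Real.inv_rpow (by positivity), inv_div, hx]
      congr 1
      field_simp
      ring
    have e2 : a ^ (2 * s - n) = x ^ θ := by
      rw [hpθ, Real.rpow_mul ha0.le, Real.rpow_natCast, Real.rpow_neg (by positivity),
        ← Real.inv_rpow (by positivity)]
    rw [e1, e2]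
    have h1 := rpow_one_add_lt_one_add_mul_self (s := x) (by linarith) hx0.ne' hθ0 hθ1
    have h2 : x ≤ x ^ θ := by
      simpa using Real.rpow_le_rpow_of_exponent_ge hx0 hx1 hθ1.le
    nlinarith

/-- The numerical inequality against which the configuration of `2n` copies is tested. For `n = 1` it
reads `(1 + a)^{2s-1} > 2`, for `n = 2` and `n ≥ 3` it follows from `b < 1 ≤ a^{2s-n}`. -/
theorem twoBump_factor_rpow_lt' {a : ℝ} (ha : 1 ≤ a) {n : ℕ} (hn : n ≠ 0) {s : ℝ} (hs : 1 < s)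
    (hns : (n : ℝ) ≤ 2 * s) :
    (a / (1 + a ^ n) ^ (1 / (n : ℝ))) ^ (2 * s - n) < 1 - 1 / n + a ^ (2 * s - n) / 2 := by
  have ha0 : 0 < a := by linarith
  have hb0 := twoBump_factor_pos ha0 n
  have hbn := twoBump_factor_pow ha0 hn
  set b := a / (1 + a ^ n) ^ (1 / (n : ℝ)) with hb
  have hp : 0 ≤ 2 * s - n := by linarith
  have hb1 : b < 1 := by
    have : b ^ n < 1 ^ n := by
      rw [hbn, one_pow, div_lt_one (by positivity)]
      linarith
    exact lt_of_pow_lt_pow_left₀ n zero_le_one this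
  have hap : 1 ≤ a ^ (2 * s - n) := Real.one_le_rpow ha hp
  rcases Nat.lt_or_ge n 2 with h | h
  · obtain rfl : n = 1 := by omega
    rw [pow_one, pow_one] at hbn
    rw [hbn, Nat.cast_one, Real.div_rpow ha0.le (by positivity)]
    have h1 : (2 : ℝ) < (1 + a) ^ (2 * s - 1) := by
      calc (2 : ℝ) = 2 ^ (1 : ℝ) := by norm_num
        _ < 2 ^ (2 * s - 1) := Real.rpow_lt_rpow_of_exponent_lt (by norm_num) (by linarith)
        _ ≤ (1 + a) ^ (2 * s - 1) := Real.rpow_le_rpow (by norm_num) (by linarith) (by linarith)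
    rw [div_one, sub_self, zero_add]
    have h2 : 0 < a ^ (2 * s - 1) := by positivity
    exact div_lt_div_of_pos_left h2 two_pos h1
  · rcases h.eq_or_lt with rfl | h
    · have : b ^ (2 * s - (2 : ℕ)) < 1 := Real.rpow_lt_one hb0.le hb1 (by push_cast; linarith)
      push_cast at this hap ⊢
      linarith
    · have h1 : b ^ (2 * s - n) ≤ 1 := Real.rpow_le_one hb0.le hb1.le hp
      have h2 : (1 : ℝ) / n ≤ 1 / 3 := by
        apply one_div_le_one_div_of_le (by norm_num)
        exact_mod_cast h
      linarith

section Comparison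

variable [Nontrivial E] {s : ℝ} {v : E → ℝ} {w : ℝ → ℝ} {a : ℝ} {y : E}

/-- The comparison of energies in terms of the energy of one bump and the interaction. -/
theorem fracEnergy_rearranged_lt (hv : IntegrableHs s v)
    (hsupp : ∀ᵐ x : E, x ∉ Metric.closedBall (0 : E) 1 → v x = 0) (hv0 : ∀ x, 0 ≤ v x)
    (hw : AntitoneOn w (Ioi 0)) (hvw : ∀ x, v x = w ‖x‖) (ha : 1 ≤ a) (hy : 1 + a < ‖y‖)
    (h : (a / (1 + a ^ finrank ℝ E) ^ (1 / (finrank ℝ E : ℝ))) ^ (2 * s - finrank ℝ E)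
        * energyForm s v v < energyForm s v v + a ^ (2 * s - finrank ℝ E) * energyForm s v v
        + 2 * energyForm s v (fun x => v (a • x - y))) :
    fracEnergy s (sphRearrangement (twoBump v a y)) < fracEnergy s (twoBump v a y) := by
  have ha0 : 0 < a := by linarith
  have hb0 := twoBump_factor_pos ha0 (finrank ℝ E)
  rw [fracEnergy_congr_ae s (sphRearrangement_twoBump hv.memLp.1 hsupp hv0 hw hvw ha0 hy),
    (hv.twoBump ha0 y).fracEnergy_eq, energyForm_twoBump hv ha0]
  have hd := hv.dilation hb0 0
  have hE := energyForm_dilation s v hb0 0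
  simp only [sub_zero] at hd hE
  rw [hd.fracEnergy_eq, hE]
  have hnn : 0 ≤ (a / (1 + a ^ finrank ℝ E) ^ (1 / (finrank ℝ E : ℝ))) ^ (2 * s - finrank ℝ E)
        * energyForm s v v := mul_nonneg (by positivity) (energyForm_self_nonneg s v)
  exact (ENNReal.ofReal_lt_ofReal_iff (hnn.trans_lt h)).2 h

theorem fracEnergy_rearranged_lt_of_interaction_nonneg (hs : 0 < s) (hv : IntegrableHs s v)
    (hsupp : ∀ᵐ x : E, x ∉ Metric.closedBall (0 : E) 1 → v x = 0) (hv0 : ∀ x, 0 ≤ v x)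
    (hw : AntitoneOn w (Ioi 0)) (hvw : ∀ x, v x = w ‖x‖) (hne : ¬ v =ᵐ[volume] 0)
    (ha : 1 ≤ a) (hy : 1 + a < ‖y‖) (hpos : InteractionNonneg E s) :
    fracEnergy s (sphRearrangement (twoBump v a y)) < fracEnergy s (twoBump v a y) := by
  have ha0 : 0 < a := by linarith
  refine fracEnergy_rearranged_lt hv hsupp hv0 hw hvw ha hy ?_
  have h1 := twoBump_factor_rpow_lt ha (n := finrank ℝ E) finrank_pos.ne' hs
  have h2 := energyForm_self_pos hv hne
  have h3 := hpos v _ hv (hv.dilation ha0 y) hv0 (fun x => hv0 _) _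
    (div_pos (by linarith) ha0) (separatedBy_bump_dilation hsupp ha0 y)
  have h4 := mul_lt_mul_of_pos_right h1 h2
  linarith

theorem fracEnergy_rearranged_lt_of_finrank_le (hs : 1 < s) (hv : IntegrableHs s v)
    (hsupp : ∀ᵐ x : E, x ∉ Metric.closedBall (0 : E) 1 → v x = 0) (hv0 : ∀ x, 0 ≤ v x)
    (hw : AntitoneOn w (Ioi 0)) (hvw : ∀ x, v x = w ‖x‖) (hne : ¬ v =ᵐ[volume] 0)
    (ha : 1 ≤ a) (hy : 1 + a < ‖y‖) (hns : (finrank ℝ E : ℝ) ≤ 2 * s) :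
    fracEnergy s (sphRearrangement (twoBump v a y)) < fracEnergy s (twoBump v a y) := by
  rcases interaction_nonneg_or_nonpos (E := E) (s := s) (by linarith) with hpos | hneg
  · exact fracEnergy_rearranged_lt_of_interaction_nonneg (by linarith) hv hsupp hv0 hw hvw hne ha hy hpos
  refine fracEnergy_rearranged_lt hv hsupp hv0 hw hvw ha hy ?_
  have h1 := twoBump_factor_rpow_lt' ha (n := finrank ℝ E) finrank_pos.ne' hs hns
  have h2 := energyForm_self_pos hv hne
  have h3 := hneg.energyForm_dilation_ge hv hsupp hv0
    (fun x z hxz => by rw [hvw, hvw, hxz]) ha hy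
  have hn0 : (0 : ℝ) < finrank ℝ E := by exact_mod_cast finrank_pos
  have h4 := mul_lt_mul_of_pos_right h1 h2
  have h5 : 0 ≤ (1 / (finrank ℝ E : ℝ)) * energyForm s v v
      + (a ^ (2 * s - finrank ℝ E) / 2 * energyForm s v v)
      + 2 * energyForm s v (fun x => v (a • x - y)) := by
    have h6 := mul_nonneg (inv_nonneg.2 (by positivity : (0 : ℝ) ≤ 4 * finrank ℝ E)) h3
    have h8 : (finrank ℝ E : ℝ)⁻¹ * finrank ℝ E = 1 := inv_mul_cancel₀ hn0.ne'
    refine h6.trans_eq ?_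
    rw [mul_inv, one_div]
    linear_combination (a ^ (2 * s - finrank ℝ E) / 2 * energyForm s v v
      + 2 * energyForm s v (fun x => v (a • x - y))) * h8
  have h7 : (1 - 1 / (finrank ℝ E : ℝ) + a ^ (2 * s - finrank ℝ E) / 2) * energyForm s v v
      = energyForm s v v - (1 / (finrank ℝ E : ℝ)) * energyForm s v v
        + a ^ (2 * s - finrank ℝ E) / 2 * energyForm s v v := by ring
  linarith

theorem exists_fracEnergy_rearranged_lt (hs : 0 < s) (hv : IntegrableHs s v)
    (hsupp : ∀ᵐ x : E, x ∉ Metric.closedBall (0 : E) 1 → v x = 0) (hv0 : ∀ x, 0 ≤ v x)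
    (hw : AntitoneOn w (Ioi 0)) (hvw : ∀ x, v x = w ‖x‖) (hne : ¬ v =ᵐ[volume] 0)
    (ha : 1 ≤ a) : ∃ R : ℝ, ∀ y : E, R < ‖y‖ →
      fracEnergy s (sphRearrangement (twoBump v a y)) < fracEnergy s (twoBump v a y) := by
  have ha0 : 0 < a := by linarith
  have h1 := twoBump_factor_rpow_lt ha (n := finrank ℝ E) finrank_pos.ne' hs
  have h2 := energyForm_self_pos hv hne
  have h4 := mul_lt_mul_of_pos_right h1 h2
  obtain ⟨R, hR⟩ := exists_abs_energyForm_dilation_lt hv ha0 (half_pos (sub_pos.2 h4))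
  refine ⟨max R (1 + a), fun y hy => ?_⟩
  have hb := abs_lt.1 (hR y ((le_max_left _ _).trans_lt hy))
  refine fracEnergy_rearranged_lt hv hsupp hv0 hw hvw ha ((le_max_right _ _).trans_lt hy) ?_
  linarith [hb.1]

end Comparison

end TwoBumps

/-! ### Energies of piecewise linear functions on the line -/

section PiecewiseLinear

open Filter Topology

/-- The combination `∑ c_i (x - p_i)₊` of ramps. It has compact support when `∑ c_i = 0` and
`∑ c_i p_i = 0`. -/
noncomputable def rampSum {ι : Type*} [Fintype ι] (c p : ι → ℝ) (x : ℝ) : ℝ :=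
  ∑ i, c i * max (x - p i) 0

theorem continuous_rampSum {ι : Type*} [Fintype ι] (c p : ι → ℝ) : Continuous (rampSum c p) := by
  unfold rampSum
  fun_prop

theorem exists_forall_abs_lt {ι : Type*} [Fintype ι] (p : ι → ℝ) : ∃ R : ℝ, 0 < R ∧ ∀ i, |p i| < R := by
  refine ⟨∑ i, |p i| + 1, by positivity, fun i => ?_⟩
  have := Finset.single_le_sum (f := fun i => |p i|) (fun j _ => abs_nonneg _) (Finset.mem_univ i)
  linarith

theorem rampSum_eq_zero {ι : Type*} [Fintype ι] {c p : ι → ℝ} (hc : ∑ i, c i = 0)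
    (hcp : ∑ i, c i * p i = 0) {R : ℝ} (hR : ∀ i, |p i| < R) {x : ℝ} (hx : R ≤ |x|) :
    rampSum c p x = 0 := by
  unfold rampSum
  rcases le_total 0 x with h | h
  · rw [abs_of_nonneg h] at hx
    have : ∀ i, c i * max (x - p i) 0 = c i * x - c i * p i := by
      intro i
      have := (abs_lt.1 (hR i)).2
      rw [max_eq_left (by linarith)]; ring
    simp_rw [this]
    rw [Finset.sum_sub_distrib, ← Finset.sum_mul, hc, hcp]; ring
  · rw [abs_of_nonpos h] at hx
    refine Finset.sum_eq_zero fun i _ => ?_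
    have := (abs_lt.1 (hR i)).1
    rw [max_eq_right (by linarith), mul_zero]

theorem hasCompactSupport_rampSum {ι : Type*} [Fintype ι] {c p : ι → ℝ} (hc : ∑ i, c i = 0)
    (hcp : ∑ i, c i * p i = 0) : HasCompactSupport (rampSum c p) := by
  obtain ⟨R, -, hR⟩ := exists_forall_abs_lt p
  refine HasCompactSupport.intro (isCompact_closedBall (0 : ℝ) R) fun x hx => ?_
  rw [mem_closedBall_zero_iff, Real.norm_eq_abs, not_le] at hx
  exact rampSum_eq_zero hc hcp hR hx.le

/-- An antiderivative of `(x - p) e^{-iωx}`. -/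
theorem hasDerivAt_ramp_antideriv {ω : ℝ} (hω : ω ≠ 0) (p x : ℝ) :
    HasDerivAt (fun x : ℝ => (((x : ℂ) - p) * Complex.I / ω + 1 / (ω : ℂ) ^ 2) *
      Complex.exp (-Complex.I * ω * x)) (((x : ℂ) - p) * Complex.exp (-Complex.I * ω * x)) x := by
  have hω' : (ω : ℂ) ≠ 0 := by exact_mod_cast hω
  have h1 : HasDerivAt (fun x : ℝ => (x : ℂ)) 1 x := Complex.ofRealCLM.hasDerivAt
  have h2 := (((h1.sub_const (p : ℂ)).mul_const Complex.I).div_const (ω : ℂ)).add_const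
    (1 / (ω : ℂ) ^ 2)
  have h3 := (h1.const_mul (-Complex.I * ω)).cexp
  convert! h2.mul h3 using 1
  field_simp
  linear_combination ((x : ℂ) - p) * ω * Complex.I_sq

theorem integral_ramp_mul_exp {ω : ℝ} (hω : ω ≠ 0) {p R : ℝ} (hp : |p| < R) :
    ∫ x in (-R)..R, ((max (x - p) 0 : ℝ) : ℂ) * Complex.exp (-Complex.I * ω * x)
      = (((R : ℂ) - p) * Complex.I / ω + 1 / (ω : ℂ) ^ 2) * Complex.exp (-Complex.I * ω * R)
        - Complex.exp (-Complex.I * ω * p) / (ω : ℂ) ^ 2 := by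
  obtain ⟨hp1, hp2⟩ := abs_lt.1 hp
  have hcont : Continuous fun x : ℝ => ((max (x - p) 0 : ℝ) : ℂ) * Complex.exp (-Complex.I * ω * x) := by
    fun_prop
  rw [← intervalIntegral.integral_add_adjacent_intervals (hcont.intervalIntegrable _ p)
    (hcont.intervalIntegrable p _)]
  have h1 : ∫ x in (-R)..p, ((max (x - p) 0 : ℝ) : ℂ) * Complex.exp (-Complex.I * ω * x) = 0 := by
    rw [intervalIntegral.integral_congr (g := fun _ => 0), intervalIntegral.integral_zero]
    intro x hx
    rw [uIcc_of_le hp1.le] at hx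
    simp only
    rw [max_eq_right (by linarith [hx.2])]
    simp
  have h2 : ∫ x in p..R, ((max (x - p) 0 : ℝ) : ℂ) * Complex.exp (-Complex.I * ω * x)
      = ∫ x in p..R, ((x : ℂ) - p) * Complex.exp (-Complex.I * ω * x) := by
    refine intervalIntegral.integral_congr fun x hx => ?_
    rw [uIcc_of_le hp2.le] at hx
    rw [max_eq_left (by linarith [hx.1])]
    push_cast; rfl
  rw [h1, h2, intervalIntegral.integral_eq_sub_of_hasDerivAt
    (fun x _ => hasDerivAt_ramp_antideriv hω p x)]
  · ring
  · exact (by fun_prop : Continuous fun x : ℝ => ((x : ℂ) - p) *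
      Complex.exp (-Complex.I * ω * x)).intervalIntegrable _ _

/-- The Fourier transform of a compactly supported combination of ramps: its second derivative is
a combination of point masses. -/
theorem fhat_rampSum {ι : Type*} [Fintype ι] {c p : ι → ℝ} (hc : ∑ i, c i = 0)
    (hcp : ∑ i, c i * p i = 0) {ξ : ℝ} (hξ : ξ ≠ 0) :
    fhat (rampSum c p) ξ = -(∑ i, (c i : ℂ) * Complex.exp (-Complex.I * (2 * Real.pi * ξ : ℝ) * p i))
      / ((2 * Real.pi * ξ : ℝ) : ℂ) ^ 2 := by
  obtain ⟨R, hR0, hR⟩ := exists_forall_abs_lt p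
  set ω : ℝ := 2 * Real.pi * ξ with hω
  have hω0 : ω ≠ 0 := by positivity
  have h1 : fhat (rampSum c p) ξ
      = ∫ x in (-R)..R, ((rampSum c p x : ℝ) : ℂ) * Complex.exp (-Complex.I * ω * x) := by
    unfold fhat
    rw [Real.fourier_real_eq_integral_exp_smul, intervalIntegral.integral_of_le (by linarith),
      ← integral_indicator measurableSet_Ioc]
    congr 1; ext x
    by_cases hx : x ∈ Ioc (-R) R
    · rw [indicator_of_mem hx, smul_eq_mul, mul_comm]
      congr 2
      rw [hω]; push_cast; ring
    · rw [indicator_of_notMem hx, rampSum_eq_zero hc hcp hR]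
      · simp
      · rw [mem_Ioc, not_and_or, not_lt, not_le] at hx
        rcases hx with hx | hx
        · rw [abs_of_nonpos (by linarith)]; linarith
        · rw [abs_of_pos (by linarith)]; exact hx.le
  have h2 : ∀ x : ℝ, ((rampSum c p x : ℝ) : ℂ) * Complex.exp (-Complex.I * ω * x)
      = ∑ i, (c i : ℂ) * (((max (x - p i) 0 : ℝ) : ℂ) * Complex.exp (-Complex.I * ω * x)) := by
    intro x
    unfold rampSum
    push_cast
    rw [Finset.sum_mul]
    refine Finset.sum_congr rfl fun i _ => ?_
    ring
  rw [h1]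
  simp_rw [h2]
  rw [intervalIntegral.integral_finsetSum]
  · simp_rw [intervalIntegral.integral_const_mul, integral_ramp_mul_exp hω0 (hR _)]
    have e1 : ∑ i, (c i : ℂ) = 0 := by exact_mod_cast hc
    have e2 : ∑ i, (c i : ℂ) * p i = 0 := by exact_mod_cast hcp
    set e := Complex.exp (-Complex.I * ω * R)
    have e3 : ∀ i, (c i : ℂ) * ((((R : ℂ) - p i) * Complex.I / ω + 1 / (ω : ℂ) ^ 2) * e
        - Complex.exp (-Complex.I * ω * p i) / (ω : ℂ) ^ 2)
        = (R * Complex.I / ω + 1 / (ω : ℂ) ^ 2) * e * (c i : ℂ) - Complex.I / ω * e * ((c i : ℂ) * p i)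
          - ((c i : ℂ) * Complex.exp (-Complex.I * ω * p i)) / (ω : ℂ) ^ 2 := by
      intro i; ring
    simp_rw [e3]
    rw [Finset.sum_sub_distrib, Finset.sum_sub_distrib, ← Finset.mul_sum, ← Finset.mul_sum, e1, e2,
      ← Finset.sum_div]
    ring
  · intro i _
    exact (by fun_prop : Continuous fun x : ℝ => (c i : ℂ) * (((max (x - p i) 0 : ℝ) : ℂ) *
      Complex.exp (-Complex.I * ω * x))).intervalIntegrable _ _

/-- The constant `1` may be inserted because the coefficients sum to zero; it makes each term
integrable against `|ω|^{2s-4}` near `ω = 0`. -/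
theorem norm_sq_sum_exp {ι : Type*} [Fintype ι] {c p : ι → ℝ} (hc : ∑ i, c i = 0) (ω : ℝ) :
    ‖∑ i, (c i : ℂ) * Complex.exp (-Complex.I * ω * p i)‖ ^ 2
      = -∑ i, ∑ j, c i * c j * (1 - Real.cos ((p i - p j) * ω)) := by
  have h0 : ∑ i, ∑ j, c i * c j = 0 := by
    rw [← Finset.sum_mul_sum, hc, zero_mul]
  have h1 : -∑ i, ∑ j, c i * c j * (1 - Real.cos ((p i - p j) * ω))
      = ∑ i, ∑ j, c i * c j * Real.cos ((p i - p j) * ω) := by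
    have : ∀ i j, c i * c j * (1 - Real.cos ((p i - p j) * ω))
        = c i * c j - c i * c j * Real.cos ((p i - p j) * ω) := fun i j => by ring
    simp_rw [this, Finset.sum_sub_distrib]
    rw [h0]; ring
  have h2 : ∀ i, (c i : ℂ) * Complex.exp (-Complex.I * ω * p i)
      = ((c i * Real.cos (p i * ω) : ℝ) : ℂ) + ((-(c i * Real.sin (p i * ω)) : ℝ) : ℂ) * Complex.I := by
    intro i
    have : -Complex.I * ω * p i = ((-(p i * ω) : ℝ) : ℂ) * Complex.I := by push_cast; ring
    rw [this, Complex.exp_mul_I, ← Complex.ofReal_cos, ← Complex.ofReal_sin, Real.cos_neg,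
      Real.sin_neg]
    push_cast; ring
  simp_rw [h2]
  rw [Finset.sum_add_distrib, ← Finset.sum_mul, ← Complex.ofReal_sum, ← Complex.ofReal_sum, h1,
    ← Complex.normSq_eq_norm_sq, Complex.normSq_add_mul_I, Finset.sum_neg_distrib, neg_sq, sq, sq,
    Finset.sum_mul_sum, Finset.sum_mul_sum, ← Finset.sum_add_distrib]
  refine Finset.sum_congr rfl fun i _ => ?_
  rw [← Finset.sum_add_distrib]
  refine Finset.sum_congr rfl fun j _ => ?_
  rw [sub_mul, Real.cos_sub]
  ring

/-- The density `|η|^{2s-4} (1 - cos η)`, whose integral gives the interaction of two corners. -/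
noncomputable def cosKernel (s η : ℝ) : ℝ := |η| ^ (2 * s - 4) * (1 - Real.cos η)

theorem cosKernel_nonneg (s η : ℝ) : 0 ≤ cosKernel s η :=
  mul_nonneg (by positivity) (by linarith [Real.cos_le_one η])

/-- The density is `O(|η|^{2s-2})` at `0`, and `O(|η|^{2s-4})` at `∞`, where `s < 3/2` enters. -/
theorem integrable_cosKernel {s : ℝ} (h1 : 1 < s) (h2 : s < 3 / 2) : Integrable (cosKernel s) := by
  have hmeas : Measurable (cosKernel s) := by unfold cosKernel; fun_prop
  have hIoi : IntegrableOn (cosKernel s) (Ioi 0) := by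
    rw [← Ioc_union_Ioi_eq_Ioi (zero_le_one (α := ℝ))]
    refine IntegrableOn.union ?_ ?_
    · have hI : IntegrableOn (fun t : ℝ => t ^ (2 * s - 2)) (Ioc 0 1) :=
        (intervalIntegrable_iff_integrableOn_Ioc_of_le zero_le_one).1
          (intervalIntegral.intervalIntegrable_rpow' (by linarith))
      refine hI.mono' hmeas.aestronglyMeasurable ?_
      filter_upwards [ae_restrict_mem measurableSet_Ioc] with t ht
      have ht0 : 0 < t := ht.1
      rw [Real.norm_eq_abs, abs_of_nonneg (cosKernel_nonneg s t), cosKernel, abs_of_pos ht0]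
      calc t ^ (2 * s - 4) * (1 - Real.cos t) ≤ t ^ (2 * s - 4) * t ^ (2 : ℝ) := by
            refine mul_le_mul_of_nonneg_left ?_ (by positivity)
            have := Real.one_sub_sq_div_two_le_cos (x := t)
            rw [Real.rpow_two]
            nlinarith
        _ = t ^ (2 * s - 2) := by rw [← Real.rpow_add ht0]; congr 1; ring
    · have hI : IntegrableOn (fun t : ℝ => 2 * t ^ (2 * s - 4)) (Ioi 1) :=
        (integrableOn_Ioi_rpow_of_lt (by linarith) one_pos).const_mul 2
      refine hI.mono' hmeas.aestronglyMeasurable ?_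
      filter_upwards [ae_restrict_mem measurableSet_Ioi] with t ht
      have ht0 : 0 < t := one_pos.trans ht
      rw [Real.norm_eq_abs, abs_of_nonneg (cosKernel_nonneg s t), cosKernel, abs_of_pos ht0, mul_comm]
      exact mul_le_mul_of_nonneg_right (by linarith [Real.neg_one_le_cos t]) (by positivity)
  have hIic : IntegrableOn (cosKernel s) (Iic 0) := by
    have h3 : (fun x => cosKernel s (-x)) = cosKernel s := by
      ext x; simp [cosKernel]
    rw [integrableOn_Iic_iff_integrableOn_Iio]
    have h4 := hIoi.comp_neg
    simpa [h3] using h4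
  rw [← integrableOn_univ, ← Iic_union_Ioi (a := (0 : ℝ))]
  exact hIic.union hIoi

theorem integral_cosKernel_pos {s : ℝ} (h1 : 1 < s) (h2 : s < 3 / 2) : 0 < ∫ η, cosKernel s η := by
  rw [integral_pos_iff_support_of_nonneg (cosKernel_nonneg s) (integrable_cosKernel h1 h2)]
  have : Ioo 0 Real.pi ⊆ Function.support (cosKernel s) := by
    intro x hx
    have h3 : Real.cos x < Real.cos 0 :=
      Real.cos_lt_cos_of_nonneg_of_le_pi le_rfl hx.2.le hx.1
    rw [Real.cos_zero] at h3
    have h4 : 0 < |x| := abs_pos.2 hx.1.ne'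
    exact (mul_pos (Real.rpow_pos_of_pos h4 _) (by linarith)).ne'
  refine lt_of_lt_of_le ?_ (measure_mono this)
  rw [Real.volume_Ioo, ENNReal.ofReal_pos]
  linarith [Real.pi_pos]

theorem corner_density_eq {s : ℝ} {d : ℝ} (hd : d ≠ 0) (ξ : ℝ) :
    |2 * Real.pi * ξ| ^ (2 * s - 4) * (1 - Real.cos (d * (2 * Real.pi * ξ)))
      = |d| ^ (4 - 2 * s) * cosKernel s (d * (2 * Real.pi) * ξ) := by
  unfold cosKernel
  have h0 : 0 < |d| := abs_pos.2 hd
  have e1 : |d * (2 * Real.pi) * ξ| = |d| * |2 * Real.pi * ξ| := by rw [mul_assoc, abs_mul]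
  have e2 : |d| ^ (4 - 2 * s) * |d| ^ (2 * s - 4) = 1 := by
    rw [← Real.rpow_add h0]; simp
  rw [e1, Real.mul_rpow h0.le (abs_nonneg _), ← mul_assoc d]
  linear_combination (-(|2 * Real.pi * ξ| ^ (2 * s - 4) * (1 - Real.cos (d * (2 * Real.pi) * ξ)))) * e2

theorem corner_integral {s : ℝ} (h1 : 1 < s) (h2 : s < 3 / 2) (d : ℝ) :
    Integrable (fun ξ : ℝ => |2 * Real.pi * ξ| ^ (2 * s - 4) * (1 - Real.cos (d * (2 * Real.pi * ξ)))) ∧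
    ∫ ξ : ℝ, |2 * Real.pi * ξ| ^ (2 * s - 4) * (1 - Real.cos (d * (2 * Real.pi * ξ)))
      = (2 * Real.pi)⁻¹ * (∫ η, cosKernel s η) * |d| ^ (3 - 2 * s) := by
  rcases eq_or_ne d 0 with rfl | hd
  · have : (3 : ℝ) - 2 * s ≠ 0 := by linarith
    simp [Real.zero_rpow this]
  have h0 : 0 < |d| := abs_pos.2 hd
  have hne : d * (2 * Real.pi) ≠ 0 := mul_ne_zero hd (by positivity)
  simp_rw [corner_density_eq hd]
  refine ⟨((integrable_cosKernel h1 h2).comp_mul_left' hne).const_mul _, ?_⟩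
  rw [integral_const_mul, Measure.integral_comp_mul_left, smul_eq_mul, abs_inv, abs_mul,
    abs_of_pos (by positivity : 0 < 2 * Real.pi)]
  have e : |d| ^ (4 - 2 * s) = |d| ^ (3 - 2 * s) * |d| := by
    rw [← Real.rpow_add_one h0.ne']; congr 1; ring
  rw [e]
  field_simp

theorem energy_density_rampSum {ι : Type*} [Fintype ι] {c p : ι → ℝ} (hc : ∑ i, c i = 0)
    (hcp : ∑ i, c i * p i = 0) (s : ℝ) {ξ : ℝ} (hξ : ξ ≠ 0) :
    freqWeight s ξ * ‖fhat (rampSum c p) ξ‖ ^ 2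
      = -∑ i, ∑ j, c i * c j * (|2 * Real.pi * ξ| ^ (2 * s - 4) *
          (1 - Real.cos ((p i - p j) * (2 * Real.pi * ξ)))) := by
  have hω : 0 < |2 * Real.pi * ξ| := abs_pos.2 (by positivity)
  rw [fhat_rampSum hc hcp hξ, norm_div, norm_neg, div_pow, norm_sq_sum_exp hc, norm_pow,
    Complex.norm_real, Real.norm_eq_abs]
  have e1 : freqWeight s ξ = |2 * Real.pi * ξ| ^ (2 * s - 4) * |2 * Real.pi * ξ| ^ 4 := by
    unfold freqWeight
    have e0 : 2 * Real.pi * ‖ξ‖ = |2 * Real.pi * ξ| := by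
      rw [Real.norm_eq_abs, abs_mul, abs_of_pos (by positivity : 0 < 2 * Real.pi)]
    rw [e0, ← Real.rpow_natCast |2 * Real.pi * ξ|, ← Real.rpow_add hω]
    congr 1; push_cast; ring
  rw [e1]
  have e2 : ∀ S : ℝ, |2 * Real.pi * ξ| ^ (2 * s - 4) * |2 * Real.pi * ξ| ^ 4 *
      (-S / (|2 * Real.pi * ξ| ^ 2) ^ 2) = -(|2 * Real.pi * ξ| ^ (2 * s - 4) * S) := by
    intro S
    field_simp
  rw [e2, Finset.mul_sum]
  congr 1
  refine Finset.sum_congr rfl fun i _ => ?_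
  rw [Finset.mul_sum]
  refine Finset.sum_congr rfl fun j _ => ?_
  ring

/-- For `1 < s < 3/2`, the energy of a combination of ramps is, up to a positive constant, the
quadratic form of its coefficients with kernel `-|p_i - p_j|^{3-2s}` in the positions of its
corners. -/
theorem energy_rampSum {ι : Type*} [Fintype ι] {c p : ι → ℝ} (hc : ∑ i, c i = 0)
    (hcp : ∑ i, c i * p i = 0) {s : ℝ} (h1 : 1 < s) (h2 : s < 3 / 2) :
    IntegrableHs s (rampSum c p) ∧ energyForm s (rampSum c p) (rampSum c p)
      = (2 * Real.pi)⁻¹ * (∫ η, cosKernel s η) *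
        -∑ i, ∑ j, c i * c j * |p i - p j| ^ (3 - 2 * s) := by
  have hae : (fun ξ : ℝ => freqWeight s ξ * ‖fhat (rampSum c p) ξ‖ ^ 2) =ᵐ[volume] fun ξ =>
      -∑ i, ∑ j, c i * c j * (|2 * Real.pi * ξ| ^ (2 * s - 4) *
          (1 - Real.cos ((p i - p j) * (2 * Real.pi * ξ)))) := by
    filter_upwards [(measure_singleton (0 : ℝ) : volume {(0 : ℝ)} = 0) |> compl_mem_ae_iff.2]
      with ξ hξ
    exact energy_density_rampSum hc hcp s hξ
  have hterm : ∀ i j, Integrable fun ξ : ℝ => c i * c j * (|2 * Real.pi * ξ| ^ (2 * s - 4) *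
          (1 - Real.cos ((p i - p j) * (2 * Real.pi * ξ)))) := fun i j =>
    (corner_integral h1 h2 _).1.const_mul _
  have hcont := continuous_rampSum c p
  have hsupp := hasCompactSupport_rampSum hc hcp
  refine ⟨⟨hcont.integrable_of_hasCompactSupport hsupp, hcont.memLp_of_hasCompactSupport hsupp, ?_⟩, ?_⟩
  · refine (Integrable.neg ?_).congr hae.symm
    exact integrable_finsetSum _ fun i _ => integrable_finsetSum _ fun j _ => hterm i j
  · rw [energyForm_self, integral_congr_ae hae, integral_neg, integral_finsetSum _
      (fun i _ => integrable_finsetSum _ fun j _ => hterm i j), mul_neg, Finset.mul_sum]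
    congr 1
    refine Finset.sum_congr rfl fun i _ => ?_
    rw [integral_finsetSum _ (fun j _ => hterm i j), Finset.mul_sum]
    refine Finset.sum_congr rfl fun j _ => ?_
    rw [integral_const_mul, (corner_integral h1 h2 _).2]
    ring

end PiecewiseLinear

/-! ### The plateau example -/

section Plateau

open Filter Topology

theorem ramp_of_le {x p : ℝ} (h : x ≤ p) : max (x - p) 0 = 0 := max_eq_right (by linarith)

theorem ramp_of_ge {x p : ℝ} (h : p ≤ x) : max (x - p) 0 = x - p := max_eq_left (by linarith)

theorem plateau_eq_rampSum {M : ℝ} (hM : 1 < M) :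
    plateau M = rampSum ![1, -2, 1, -1, 1] ![-2, 0, 1, 2 * M - 1, 2 * M] := by
  ext x
  have e : rampSum ![1, -2, 1, -1, 1] ![-2, 0, 1, 2 * M - 1, 2 * M] x
      = max (x - -2) 0 + -2 * max (x - 0) 0 + max (x - 1) 0 - max (x - (2 * M - 1)) 0
        + max (x - 2 * M) 0 := by
    simp [rampSum, Fin.sum_univ_succ]
    ring
  rw [e]
  unfold plateau
  split_ifs with h1 h2 h3 h4 h5
  · rw [ramp_of_le, ramp_of_le, ramp_of_le, ramp_of_le, ramp_of_le] <;> linarith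
  · rw [ramp_of_ge, ramp_of_le, ramp_of_le, ramp_of_le, ramp_of_le] <;> linarith
  · rw [ramp_of_ge, ramp_of_ge, ramp_of_le, ramp_of_le, ramp_of_le] <;> linarith
  · rw [ramp_of_ge, ramp_of_ge, ramp_of_ge, ramp_of_le, ramp_of_le] <;> linarith
  · rw [ramp_of_ge, ramp_of_ge, ramp_of_ge, ramp_of_ge, ramp_of_le] <;> linarith
  · rw [ramp_of_ge, ramp_of_ge, ramp_of_ge, ramp_of_ge, ramp_of_ge] <;> linarith

theorem plateauStar_eq_rampSum {M : ℝ} (hM : 1 < M) :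
    plateauStar M = rampSum ![1, -1, 1, -2, 1, -1, 1] ![-(M + 1), -M, -1, 0, 1, M, M + 1] := by
  ext x
  have e : rampSum ![1, -1, 1, -2, 1, -1, 1] ![-(M + 1), -M, -1, 0, 1, M, M + 1] x
      = max (x - -(M + 1)) 0 - max (x - -M) 0 + max (x - -1) 0 + -2 * max (x - 0) 0
        + max (x - 1) 0 - max (x - M) 0 + max (x - (M + 1)) 0 := by
    simp [rampSum, Fin.sum_univ_succ]
    ring
  rw [e]
  unfold plateauStar
  rcases le_total 0 x with h | h
  · rw [abs_of_nonneg h, ramp_of_ge (by linarith : -(M + 1) ≤ x), ramp_of_ge (by linarith : -M ≤ x),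
      ramp_of_ge (by linarith : -1 ≤ x), ramp_of_ge h]
    split_ifs with h1 h2 h3
    · rw [ramp_of_le, ramp_of_le, ramp_of_le] <;> linarith
    · rw [ramp_of_ge, ramp_of_le, ramp_of_le] <;> linarith
    · rw [ramp_of_ge, ramp_of_ge, ramp_of_le] <;> linarith
    · rw [ramp_of_ge, ramp_of_ge, ramp_of_ge] <;> linarith
  · rw [abs_of_nonpos h, ramp_of_le h, ramp_of_le (by linarith : x ≤ 1),
      ramp_of_le (by linarith : x ≤ M), ramp_of_le (by linarith : x ≤ M + 1)]
    split_ifs with h1 h2 h3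
    · rw [ramp_of_ge, ramp_of_ge, ramp_of_ge] <;> linarith
    · rw [ramp_of_ge, ramp_of_ge, ramp_of_le] <;> linarith
    · rw [ramp_of_ge, ramp_of_le, ramp_of_le] <;> linarith
    · rw [ramp_of_le, ramp_of_le, ramp_of_le] <;> linarith

theorem plateau_nonneg {M : ℝ} (x : ℝ) : 0 ≤ plateau M x := by
  unfold plateau
  split_ifs <;> linarith

theorem antitoneOn_plateauStar {M : ℝ} : AntitoneOn (plateauStar M) (Ioi 0) := by
  intro x hx y hy hxy
  unfold plateauStar
  rw [abs_of_pos (mem_Ioi.1 hx), abs_of_pos (mem_Ioi.1 hy)]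
  split_ifs <;> linarith

theorem plateauStar_nonneg {M : ℝ} (x : ℝ) : 0 ≤ plateauStar M x := by
  unfold plateauStar
  split_ifs <;> linarith

theorem plateauStar_abs (M x : ℝ) : plateauStar M x = plateauStar M ‖x‖ := by
  unfold plateauStar
  rw [Real.norm_eq_abs, abs_abs]

theorem volume_superlevel_plateau {M : ℝ} (hM : 1 < M) {τ : ℝ} (hτ : 0 ≤ τ) :
    volume {x : ℝ | τ < |plateau M x|} = volume {x : ℝ | τ < plateauStar M x} := by
  simp_rw [abs_of_nonneg (plateau_nonneg _)]
  rcases lt_or_ge τ 1 with h1 | h1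
  · have e1 : {x : ℝ | τ < plateau M x} = Ioo (-2 + τ) (2 * M - τ) := by
      ext x
      simp only [mem_ofPred_eq, mem_Ioo, plateau]
      split_ifs <;> constructor <;> intro h <;> (try constructor) <;> (try cases h) <;> linarith
    have e2 : {x : ℝ | τ < plateauStar M x} = Ioo (-(M + 1 - τ)) (M + 1 - τ) := by
      ext x
      rw [mem_Ioo, ← abs_lt]
      simp only [mem_ofPred_eq, plateauStar]
      split_ifs <;> constructor <;> intro h <;> linarith
    rw [e1, e2, Real.volume_Ioo, Real.volume_Ioo]
    congr 1; ring
  · have e1 : {x : ℝ | τ < plateau M x} = Ioo (-2 + τ) (2 - τ) := by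
      ext x
      simp only [mem_ofPred_eq, mem_Ioo, plateau]
      split_ifs <;> constructor <;> intro h <;> (try constructor) <;> (try cases h) <;> linarith
    have e2 : {x : ℝ | τ < plateauStar M x} = Ioo (-(2 - τ)) (2 - τ) := by
      ext x
      rw [mem_Ioo, ← abs_lt]
      simp only [mem_ofPred_eq, plateauStar]
      split_ifs <;> constructor <;> intro h <;> linarith
    rw [e1, e2, Real.volume_Ioo, Real.volume_Ioo]
    congr 1; ring

theorem sphRearrangement_plateau {M : ℝ} (hM : 1 < M) {x : ℝ} (hx : x ≠ 0) :
    sphRearrangement (plateau M) x = plateauStar M x := by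
  refine sphRearrangement_eq_of_continuousAt antitoneOn_plateauStar
    (fun r _ => plateauStar_nonneg r) (plateauStar_abs M)
    (fun τ hτ => volume_superlevel_plateau hM hτ) hx ?_
  rw [plateauStar_eq_rampSum hM]
  exact (continuous_rampSum _ _).continuousAt

/-- The representation of `d ^ γ` by `1 - e^{-td}`, summed against coefficients. -/
theorem laplaceConst_mul_sum_rpow {ι : Type*} [Fintype ι] (α d : ι → ℝ) (hd : ∀ i, 0 ≤ d i) {γ : ℝ}
    (h1 : 0 < γ) (h2 : γ < 1) :
    IntegrableOn (fun t => (∑ i, α i * expRem 0 (t * d i)) * t ^ (-1 - γ)) (Ioi 0) ∧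
    laplaceConst 0 γ * ∑ i, α i * d i ^ γ
      = ∫ t in Ioi 0, (∑ i, α i * expRem 0 (t * d i)) * t ^ (-1 - γ) := by
  have e : (fun t : ℝ => (∑ i, α i * expRem 0 (t * d i)) * t ^ (-1 - γ))
      = fun t => ∑ i, α i * (expRem 0 (t * d i) * t ^ (-1 - γ)) := by
    ext t
    rw [Finset.sum_mul]
    exact Finset.sum_congr rfl fun i _ => by ring
  have hint : ∀ i, IntegrableOn (fun t => α i * (expRem 0 (t * d i) * t ^ (-1 - γ))) (Ioi 0) :=
    fun i => (integrableOn_expRem_comp (by simpa using h1) (by simpa using h2) (hd i)).const_mul _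
  rw [e]
  refine ⟨integrable_finsetSum _ fun i _ => hint i, ?_⟩
  rw [integral_finsetSum _ fun i _ => hint i, Finset.mul_sum]
  refine Finset.sum_congr rfl fun i _ => ?_
  rw [integral_const_mul, integral_expRem_comp (by simpa using h1) (hd i)]
  ring

/-- Positivity of the mixed fifth-order difference of `d ^ γ` that compares the two corner
configurations: against `1 - e^{-td}` it is the product `(1 - e^{-t})³ (1 - e^{-t(M-1)})²`. -/
theorem corner_difference_pos {M : ℝ} (hM : 1 < M) {γ : ℝ} (h1 : 0 < γ) (h2 : γ < 1) :
    0 < 3 - 3 * 2 ^ γ + 3 ^ γ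
      + 2 * ((M - 1) ^ γ - 3 * M ^ γ + 3 * (M + 1) ^ γ - (M + 2) ^ γ)
      - ((2 * M - 2) ^ γ - 3 * (2 * M - 1) ^ γ + 3 * (2 * M) ^ γ - (2 * M + 1) ^ γ) := by
  set α : Fin 11 → ℝ := ![3, -3, 1, 2, -6, 6, -2, -1, 3, -3, 1] with hα
  set d : Fin 11 → ℝ := ![1, 2, 3, M - 1, M, M + 1, M + 2, 2 * M - 2, 2 * M - 1, 2 * M, 2 * M + 1]
    with hd
  have hd0 : ∀ i, 0 ≤ d i := by
    intro i
    fin_cases i <;> simp [hd] <;> linarith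
  obtain ⟨hint, hsum⟩ := laplaceConst_mul_sum_rpow α d hd0 h1 h2
  have hexp : ∀ t, ∑ i, α i * expRem 0 (t * d i)
      = (1 - Real.exp (-t)) ^ 3 * (1 - Real.exp (-(t * (M - 1)))) ^ 2 := by
    intro t
    set q := Real.exp (-t) with hq
    set r := Real.exp (-(t * (M - 1))) with hr
    have E : ∀ (k l : ℕ) (x : ℝ), x = k + l * (M - 1) → Real.exp (-(t * x)) = q ^ k * r ^ l := by
      intro k l x hx
      rw [hq, hr, ← Real.exp_nat_mul, ← Real.exp_nat_mul, ← Real.exp_add, hx]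
      congr 1; ring
    simp only [hα, hd, Fin.sum_univ_succ, expRem]
    simp
    rw [← hq, ← hr, E 2 0 2 (by norm_num), E 3 0 3 (by norm_num), E 1 1 M (by push_cast; ring),
      E 2 1 (M + 1) (by push_cast; ring), E 3 1 (M + 2) (by push_cast; ring),
      E 0 2 (2 * M - 2) (by push_cast; ring), E 1 2 (2 * M - 1) (by push_cast; ring),
      E 2 2 (2 * M) (by push_cast; ring), E 3 2 (2 * M + 1) (by push_cast; ring)]
    ring
  have hsum2 : ∑ i, α i * d i ^ γ = 3 - 3 * 2 ^ γ + 3 ^ γ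
      + 2 * ((M - 1) ^ γ - 3 * M ^ γ + 3 * (M + 1) ^ γ - (M + 2) ^ γ)
      - ((2 * M - 2) ^ γ - 3 * (2 * M - 1) ^ γ + 3 * (2 * M) ^ γ - (2 * M + 1) ^ γ) := by
    simp only [hα, hd, Fin.sum_univ_succ]
    simp
    ring
  rw [← hsum2]
  have hC := laplaceConst_pos (m := 0) (s := γ) (by simpa using h1) (by simpa using h2)
  refine pos_of_mul_pos_right ?_ hC.le
  rw [hsum]
  simp_rw [hexp] at hint ⊢
  have hpos : ∀ t ∈ Ioi (0 : ℝ), 0 < (1 - Real.exp (-t)) ^ 3 *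
      (1 - Real.exp (-(t * (M - 1)))) ^ 2 * t ^ (-1 - γ) := by
    intro t ht
    have ht0 : 0 < t := ht
    have a1 : 0 < 1 - Real.exp (-t) := by
      rw [sub_pos, Real.exp_lt_one_iff]; linarith
    have a2 : 0 < 1 - Real.exp (-(t * (M - 1))) := by
      rw [sub_pos, Real.exp_lt_one_iff]
      have := mul_pos ht0 (sub_pos.2 hM)
      linarith
    positivity
  rw [setIntegral_pos_iff_support_of_nonneg_ae _ hint]
  · have hsub : Ioi (0 : ℝ) ⊆ (Function.support fun t => (1 - Real.exp (-t)) ^ 3 *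
        (1 - Real.exp (-(t * (M - 1)))) ^ 2 * t ^ (-1 - γ)) ∩ Ioi 0 :=
      fun t ht => ⟨(hpos t ht).ne', ht⟩
    refine lt_of_lt_of_le ?_ (measure_mono hsub)
    rw [Real.volume_Ioi]; exact ENNReal.zero_lt_top
  · filter_upwards [ae_restrict_mem measurableSet_Ioi] with t ht
    exact (hpos t ht).le

/-- The forms of `energy_rampSum` for the corners of `plateau M` and of `plateauStar M`. Their
difference is twice the expression of `corner_difference_pos`. -/
theorem corner_sum_lt {M : ℝ} (hM : 1 < M) {γ : ℝ} (h1 : 0 < γ) (h2 : γ < 1)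
    {c p : Fin 5 → ℝ} {c' p' : Fin 7 → ℝ} (hc : c = ![1, -2, 1, -1, 1])
    (hp : p = ![-2, 0, 1, 2 * M - 1, 2 * M]) (hc' : c' = ![1, -1, 1, -2, 1, -1, 1])
    (hp' : p' = ![-(M + 1), -M, -1, 0, 1, M, M + 1]) :
    -∑ i, ∑ j, c i * c j * |p i - p j| ^ γ < -∑ i, ∑ j, c' i * c' j * |p' i - p' j| ^ γ := by
  have hkey := corner_difference_pos hM h1 h2
  have z : (0 : ℝ) ^ γ = 0 := Real.zero_rpow h1.ne'
  have e1 : -∑ i, ∑ j, c i * c j * |p i - p j| ^ γ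
      = 2 * (3 + 2 * 2 ^ γ - 3 ^ γ + (2 * M - 2) ^ γ - 3 * (2 * M - 1) ^ γ + 2 * (2 * M) ^ γ
        + (2 * M + 1) ^ γ - (2 * M + 2) ^ γ) := by
    set D : Fin 5 → Fin 5 → ℝ := ![![0, 2, 3, 2 * M + 1, 2 * M + 2], ![2, 0, 1, 2 * M - 1, 2 * M],
      ![3, 1, 0, 2 * M - 2, 2 * M - 1], ![2 * M + 1, 2 * M - 1, 2 * M - 2, 0, 1],
      ![2 * M + 2, 2 * M, 2 * M - 1, 1, 0]] with hD
    have h : ∀ i j, |p i - p j| = D i j := by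
      intro i j
      rw [hp, hD]
      fin_cases i <;> fin_cases j <;> simp <;> (try rw [abs_eq (by linarith)]) <;>
        first | (left; ring; done) | (right; ring) | linarith
    simp_rw [h, hc, hD]
    simp [Fin.sum_univ_succ, z]
    ring
  have e2 : -∑ i, ∑ j, c' i * c' j * |p' i - p' j| ^ γ
      = 2 * (6 - 2 ^ γ + 2 * (M - 1) ^ γ - 6 * M ^ γ + 6 * (M + 1) ^ γ - 2 * (M + 2) ^ γ
        - (2 * M) ^ γ + 2 * (2 * M + 1) ^ γ - (2 * M + 2) ^ γ) := by
    set D : Fin 7 → Fin 7 → ℝ := ![![0, 1, M, M + 1, M + 2, 2 * M + 1, 2 * M + 2],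
      ![1, 0, M - 1, M, M + 1, 2 * M, 2 * M + 1], ![M, M - 1, 0, 1, 2, M + 1, M + 2],
      ![M + 1, M, 1, 0, 1, M, M + 1], ![M + 2, M + 1, 2, 1, 0, M - 1, M],
      ![2 * M + 1, 2 * M, M + 1, M, M - 1, 0, 1], ![2 * M + 2, 2 * M + 1, M + 2, M + 1, M, 1, 0]]
      with hD
    have h : ∀ i j, |p' i - p' j| = D i j := by
      intro i j
      rw [hp', hD]
      fin_cases i <;> fin_cases j <;> simp <;> (try rw [abs_eq (by linarith)]) <;>
        first | (left; ring; done) | (right; ring) | linarith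
    simp_rw [h, hc', hD]
    simp [Fin.sum_univ_succ, z]
    ring
  rw [e1, e2]
  linarith

theorem plateau_energy {s M : ℝ} (h1 : 1 < s) (h2 : s < 3 / 2) (hM : 1 < M) :
    MemHs s (plateau M) ∧ MemHs s (sphRearrangement (plateau M)) ∧
      fracEnergy s (plateau M) < fracEnergy s (sphRearrangement (plateau M)) := by
  have hae : plateauStar M =ᵐ[volume] sphRearrangement (plateau M) := by
    filter_upwards [(measure_singleton (0 : ℝ) : volume {(0 : ℝ)} = 0) |> compl_mem_ae_iff.2]
      with x hx
    exact (sphRearrangement_plateau hM hx).symm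
  obtain ⟨a1, b1⟩ := energy_rampSum (c := ![1, -2, 1, -1, 1]) (p := ![-2, 0, 1, 2 * M - 1, 2 * M])
    (by simp [Fin.sum_univ_succ]; try norm_num) (by simp [Fin.sum_univ_succ]; try ring) h1 h2
  obtain ⟨a2, b2⟩ := energy_rampSum (c := ![1, -1, 1, -2, 1, -1, 1])
    (p := ![-(M + 1), -M, -1, 0, 1, M, M + 1])
    (by simp [Fin.sum_univ_succ]; try norm_num) (by simp [Fin.sum_univ_succ]; try ring) h1 h2
  rw [← plateau_eq_rampSum hM] at a1 b1
  rw [← plateauStar_eq_rampSum hM] at a2 b2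
  refine ⟨a1.memHs, a2.memHs.congr_ae hae, ?_⟩
  rw [← fracEnergy_congr_ae s hae, a1.fracEnergy_eq, a2.fracEnergy_eq]
  have hlt : energyForm s (plateau M) (plateau M) < energyForm s (plateauStar M) (plateauStar M) := by
    rw [b1, b2]
    refine mul_lt_mul_of_pos_left (corner_sum_lt hM (by linarith) (by linarith) rfl rfl rfl rfl) ?_
    exact mul_pos (by positivity) (integral_cosKernel_pos h1 h2)
  exact (ENNReal.ofReal_lt_ofReal_iff ((energyForm_self_nonneg s _).trans_lt hlt)).2 hlt

end Plateau

/-! ### Smooth functions of compact support -/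

section SmoothCompact

open Filter Topology Module

variable {E : Type*} [NormedAddCommGroup E] [InnerProductSpace ℝ E] [FiniteDimensional ℝ E]
  [MeasurableSpace E] [BorelSpace E]

theorem integrableHs_of_contDiff {s : ℝ} (hs : 0 ≤ s) {u : E → ℝ} (hu : ContDiff ℝ (⊤ : ℕ∞) u)
    (hc : HasCompactSupport u) : IntegrableHs s u := by
  have hint : Integrable u := hu.continuous.integrable_of_hasCompactSupport hc
  have hg₁ : HasCompactSupport (Complex.ofRealCLM ∘ u) := hc.comp_left rfl
  have hg₂ : ContDiff ℝ (⊤ : ℕ∞) (Complex.ofRealCLM ∘ u) := by fun_prop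
  set F : SchwartzMap E ℂ := 𝓕 (hg₁.toSchwartzMap hg₂) with hF
  have hFu : ∀ ξ, fhat u ξ = F ξ := fun ξ => by
    rw [hF, SchwartzMap.fourier_coe]; rfl
  refine ⟨hint, hu.continuous.memLp_of_hasCompactSupport hc, ?_⟩
  obtain ⟨k, hk⟩ := exists_nat_ge (2 * s)
  set C := SchwartzMap.seminorm ℝ 0 0 F with hC
  have h0 : Integrable (fun ξ => ‖ξ‖ ^ 0 * ‖F ξ‖) := F.integrable_pow_mul volume 0
  have h1 : Integrable (fun ξ => ‖ξ‖ ^ k * ‖F ξ‖) := F.integrable_pow_mul volume k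
  refine ((h0.add (h1.const_mul ((2 * Real.pi) ^ k))).const_mul C).mono' ?_ ?_
  · exact ((measurable_freqWeight s).mul
      ((continuous_fhat hint).measurable.norm.pow_const 2)).aestronglyMeasurable
  · refine Eventually.of_forall fun ξ => ?_
    rw [Real.norm_eq_abs, abs_of_nonneg (mul_nonneg (freqWeight_nonneg _ _) (by positivity)), hFu]
    have hw : freqWeight s ξ ≤ 1 + (2 * Real.pi) ^ k * ‖ξ‖ ^ k := by
      rw [← mul_pow, ← Real.rpow_natCast]
      exact rpow_le_one_add_rpow (by positivity) (by linarith) hk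
    have hb : ‖F ξ‖ ≤ C := SchwartzMap.norm_le_seminorm ℝ F ξ
    have hw0 := freqWeight_nonneg s ξ
    calc freqWeight s ξ * ‖F ξ‖ ^ 2
        ≤ (1 + (2 * Real.pi) ^ k * ‖ξ‖ ^ k) * (C * ‖F ξ‖) := by
          rw [sq]
          gcongr
      _ = _ := by simp only [Pi.add_apply]; ring

theorem IntegrableHs.mono {s t : ℝ} {u : E → ℝ} (h : IntegrableHs s u) (ht : 0 ≤ t) (hts : t ≤ s) :
    IntegrableHs t u := by
  refine ⟨h.integrable, h.memLp, ?_⟩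
  refine ((integral_norm_fhat_sq h.integrable h.memLp).1.add h.energy).mono' ?_ ?_
  · exact ((measurable_freqWeight t).mul
      ((continuous_fhat h.integrable).measurable.norm.pow_const 2)).aestronglyMeasurable
  · refine Eventually.of_forall fun ξ => ?_
    rw [Real.norm_eq_abs, abs_of_nonneg (mul_nonneg (freqWeight_nonneg _ _) (by positivity))]
    have hw : freqWeight t ξ ≤ 1 + freqWeight s ξ :=
      rpow_le_one_add_rpow (by positivity) (by linarith) (by linarith)
    calc freqWeight t ξ * ‖fhat u ξ‖ ^ 2 ≤ (1 + freqWeight s ξ) * ‖fhat u ξ‖ ^ 2 := by gcongr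
      _ = _ := by simp only [Pi.add_apply]; ring

/-- The profile `r ↦ exp (-1 / (1 - r²))` on `[0, 1)`, extended by zero. -/
noncomputable def bumpProfile (r : ℝ) : ℝ := expNegInvGlue (1 - r ^ 2)

theorem antitoneOn_bumpProfile : AntitoneOn bumpProfile (Ioi 0) := by
  intro r hr r' _ h
  refine expNegInvGlue.monotone ?_
  have : r ^ 2 ≤ r' ^ 2 := pow_le_pow_left₀ (le_of_lt hr) h 2
  linarith

theorem bumpProfile_norm_eq_zero {x : E} (hx : x ∉ Metric.closedBall (0 : E) 1) :
    bumpProfile ‖x‖ = 0 := by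
  rw [mem_closedBall_zero_iff, not_le] at hx
  refine expNegInvGlue.zero_of_nonpos ?_
  nlinarith

theorem contDiff_bumpProfile_norm : ContDiff ℝ (⊤ : ℕ∞) (fun x : E => bumpProfile ‖x‖) :=
  expNegInvGlue.contDiff.comp (contDiff_const.sub (contDiff_norm_sq ℝ))

theorem bumpProfile_norm_not_ae_eq_zero : ¬ (fun x : E => bumpProfile ‖x‖) =ᵐ[volume] 0 := by
  intro h
  have h2 := (Continuous.ae_eq_iff_eq volume contDiff_bumpProfile_norm.continuous
    continuous_zero).1 h
  have h3 := congrFun h2 0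
  have h4 : bumpProfile ‖(0 : E)‖ ≠ 0 := by
    rw [norm_zero]
    exact (expNegInvGlue.pos_of_pos (by norm_num)).ne'
  exact h4 h3

/-- In every dimension two distant copies of a smooth radial bump have more energy than their
rearrangement. -/
theorem exists_memHs_fracEnergy_rearrangement_lt [Nontrivial E] {s : ℝ} (hs : 0 < s) :
    ∃ u : E → ℝ, MemHs s u ∧ fracEnergy s (sphRearrangement u) < fracEnergy s u := by
  have hzero := fun x : E => bumpProfile_norm_eq_zero (x := x)
  have hv : IntegrableHs s (fun x : E => bumpProfile ‖x‖) :=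
    integrableHs_of_contDiff hs.le contDiff_bumpProfile_norm
      (HasCompactSupport.intro (isCompact_closedBall 0 1) hzero)
  obtain ⟨R, hR⟩ := exists_fracEnergy_rearranged_lt hs hv (Eventually.of_forall hzero)
    (fun x => expNegInvGlue.nonneg _) antitoneOn_bumpProfile (fun x => rfl)
    bumpProfile_norm_not_ae_eq_zero le_rfl
  obtain ⟨y, hy⟩ := NormedSpace.exists_lt_norm ℝ E R
  exact ⟨twoBump _ 1 y, (hv.twoBump one_pos y).memHs, hR y hy⟩

end SmoothCompact

/-! ### Second differences and corners -/

section Corner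

open Filter Topology

/-- The symmetric second difference of `f` with step `h`, written as a combination of translates
`f (· - y)`. -/
def secondDiff (h : ℝ) (f : ℝ → ℝ) (x : ℝ) : ℝ := f (x - h) + f (x - -h) + -2 * f x

theorem fhat_translate (f : ℝ → ℝ) (y ξ : ℝ) :
    fhat (fun x => f (x - y)) ξ = (Real.fourierChar (-(y * ξ)) : ℂ) * fhat f ξ := by
  have := fhat_dilation f one_pos y ξ
  simpa [mul_comm] using this

theorem integrable_secondDiff {f : ℝ → ℝ} (hf : Integrable f) (h : ℝ) :
    Integrable (secondDiff h f) :=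
  ((hf.comp_sub_right h).add (hf.comp_sub_right (-h))).add (hf.const_mul (-2))

theorem memLp_secondDiff {f : ℝ → ℝ} (hf : MemLp f 2) (h : ℝ) :
    MemLp (secondDiff h f) 2 :=
  ((hf.comp_measurePreserving (measurePreserving_sub_right volume h)).add
    (hf.comp_measurePreserving (measurePreserving_sub_right volume (-h)))).add (hf.const_mul (-2))

/-- The second difference has the multiplier `-4 sin²(πhξ)`. -/
theorem norm_fhat_secondDiff_sq {f : ℝ → ℝ} (hf : Integrable f) (h ξ : ℝ) :
    ‖fhat (secondDiff h f) ξ‖ ^ 2 = 16 * Real.sin (Real.pi * h * ξ) ^ 4 * ‖fhat f ξ‖ ^ 2 := by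
  have e : fhat (secondDiff h f) ξ
      = ((-4 * Real.sin (Real.pi * h * ξ) ^ 2 : ℝ) : ℂ) * fhat f ξ := by
    have hsum : Integrable (fun x => f (x - h) + f (x - -h)) :=
      (hf.comp_sub_right h).add (hf.comp_sub_right (-h))
    unfold secondDiff
    rw [fhat_add hsum (hf.const_mul (-2)),
      fhat_add (hf.comp_sub_right h) (hf.comp_sub_right (-h)), fhat_const_mul, fhat_translate,
      fhat_translate, Real.fourierChar_apply, Real.fourierChar_apply, ← add_mul, ← add_mul]
    congr 1
    have h1 : Real.sin (Real.pi * h * ξ) ^ 2 = 1 / 2 - Real.cos (2 * (Real.pi * h * ξ)) / 2 :=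
      Real.sin_sq_eq_half_sub _
    rw [h1]
    push_cast
    rw [Complex.cos]
    ring_nf
  rw [e, norm_mul, Complex.norm_real, Real.norm_eq_abs, mul_pow, sq_abs]
  ring

/-- Functions of `H^{3/2}(ℝ)` have second differences of order `o(h^{3/2})` in `L²`. On the Fourier
side `sin⁴ y ≤ |y|³` provides the dominating function and `sin⁴ y ≤ y⁴` the pointwise limit. -/
theorem IntegrableHs.tendsto_secondDiff {f : ℝ → ℝ} (hf : IntegrableHs (3 / 2) f) :
    Tendsto (fun h : ℝ => (∫ x, secondDiff h f x ^ 2) / h ^ 3) (𝓝[>] 0) (𝓝 0) := by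
  have e : ∀ h : ℝ, (∫ x, secondDiff h f x ^ 2) / h ^ 3
      = ∫ ξ, 16 * Real.sin (Real.pi * h * ξ) ^ 4 / h ^ 3 * ‖fhat f ξ‖ ^ 2 := by
    intro h
    rw [← (integral_norm_fhat_sq (integrable_secondDiff hf.integrable h)
      (memLp_secondDiff hf.memLp h)).2, ← integral_div]
    congr 1; ext ξ
    rw [norm_fhat_secondDiff_sq hf.integrable]
    ring
  simp_rw [e]
  have h0 : (0 : ℝ) = ∫ _ : ℝ, (0 : ℝ) := by simp
  conv => rhs; rw [h0]
  refine tendsto_integral_filter_of_dominated_convergence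
    (fun ξ => 2 * (freqWeight (3 / 2) ξ * ‖fhat f ξ‖ ^ 2)) ?_ ?_ (hf.energy.const_mul 2) ?_
  · refine Eventually.of_forall fun h => Continuous.aestronglyMeasurable ?_
    have := continuous_fhat hf.integrable
    fun_prop
  · filter_upwards [self_mem_nhdsWithin] with h hh
    have hh' : 0 < h := hh
    refine Eventually.of_forall fun ξ => ?_
    have hw : freqWeight (3 / 2) ξ = 8 * (|Real.pi * ξ| ^ 3) := by
      unfold freqWeight
      rw [show (2 : ℝ) * (3 / 2) = ((3 : ℕ) : ℝ) by norm_num, Real.rpow_natCast, abs_mul,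
        abs_of_pos Real.pi_pos, Real.norm_eq_abs]
      ring
    have h4 : Real.sin (Real.pi * h * ξ) ^ 4 ≤ |Real.pi * ξ| ^ 3 * h ^ 3 := by
      have hs1 : |Real.sin (Real.pi * h * ξ)| ≤ |Real.pi * ξ| * h := by
        refine Real.abs_sin_le_abs.trans (le_of_eq ?_)
        rw [show Real.pi * h * ξ = Real.pi * ξ * h by ring, abs_mul _ h, abs_of_pos hh']
      rw [← (show Even 4 by decide).pow_abs, ← mul_pow]
      calc |Real.sin (Real.pi * h * ξ)| ^ 4 ≤ |Real.sin (Real.pi * h * ξ)| ^ 3 :=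
            pow_le_pow_of_le_one (abs_nonneg _) (Real.abs_sin_le_one _) (by norm_num)
        _ ≤ _ := pow_le_pow_left₀ (abs_nonneg _) hs1 3
    rw [Real.norm_eq_abs, abs_of_nonneg (by positivity), hw, ← mul_assoc]
    refine mul_le_mul_of_nonneg_right ?_ (by positivity)
    rw [div_le_iff₀ (by positivity)]
    linarith
  · refine Eventually.of_forall fun ξ => ?_
    have hlim : Tendsto (fun h : ℝ => 16 * (Real.pi * ξ) ^ 4 * ‖fhat f ξ‖ ^ 2 * h) (𝓝[>] 0)
        (𝓝 0) := by
      have : Tendsto (fun h : ℝ => 16 * (Real.pi * ξ) ^ 4 * ‖fhat f ξ‖ ^ 2 * h) (𝓝 0)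
          (𝓝 (16 * (Real.pi * ξ) ^ 4 * ‖fhat f ξ‖ ^ 2 * 0)) := tendsto_id.const_mul _
      rw [mul_zero] at this
      exact this.mono_left nhdsWithin_le_nhds
    refine squeeze_zero' ?_ ?_ hlim
    · filter_upwards [self_mem_nhdsWithin] with h hh
      have hh' : 0 < h := hh
      positivity
    · filter_upwards [self_mem_nhdsWithin] with h hh
      have hh' : 0 < h := hh
      have hs1 : Real.sin (Real.pi * h * ξ) ^ 4 ≤ (Real.pi * ξ) ^ 4 * h ^ 4 := by
        rw [← (show Even 4 by decide).pow_abs, ← mul_pow,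
          ← (show Even 4 by decide).pow_abs (Real.pi * ξ * h)]
        refine pow_le_pow_left₀ (abs_nonneg _) ?_ 4
        rw [show Real.pi * ξ * h = Real.pi * h * ξ by ring]
        exact Real.abs_sin_le_abs
      calc 16 * Real.sin (Real.pi * h * ξ) ^ 4 / h ^ 3 * ‖fhat f ξ‖ ^ 2
          ≤ 16 * ((Real.pi * ξ) ^ 4 * h ^ 4) / h ^ 3 * ‖fhat f ξ‖ ^ 2 := by gcongr
        _ = _ := by field_simp

/-- A function with a corner is not in `H^{3/2}(ℝ)`: near the corner its second differences are at
least `h / 2` on an interval of length `h / 2`. -/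
theorem not_integrableHs_of_corner {f : ℝ → ℝ} (h1 : ∀ x, 1 < x → x ≤ 2 → f x = 1)
    (h2 : ∀ x, 0 < x → x < 1 → 2 - x ≤ f x) : ¬ IntegrableHs (3 / 2) f := by
  intro hf
  have hlow : ∀ᶠ h : ℝ in 𝓝[>] 0, 1 / 8 ≤ (∫ x, secondDiff h f x ^ 2) / h ^ 3 := by
    filter_upwards [Ioo_mem_nhdsGT (show (0 : ℝ) < 1 / 2 by norm_num)] with h hh
    obtain ⟨hh0, hh1⟩ := hh
    rw [le_div_iff₀ (by positivity)]
    have hint := (memLp_secondDiff hf.memLp h).integrable_sq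
    calc 1 / 8 * h ^ 3 = ∫ x in Ioo 1 (1 + h / 2), (h / 2) ^ 2 := by
          rw [setIntegral_const, measureReal_def, Real.volume_Ioo, ENNReal.toReal_ofReal (by linarith),
            smul_eq_mul]
          ring
      _ ≤ ∫ x in Ioo 1 (1 + h / 2), secondDiff h f x ^ 2 := by
          refine setIntegral_mono_on (integrableOn_const (by simp) (by simp)) hint.integrableOn
            measurableSet_Ioo fun x hx => ?_
          have e1 := h1 x hx.1 (by linarith [hx.2])
          have e2 := h1 (x - -h) (by linarith [hx.1]) (by linarith [hx.2])
          have e3 := h2 (x - h) (by linarith [hx.1]) (by linarith [hx.2])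
          refine pow_le_pow_left₀ (by linarith) ?_ 2
          unfold secondDiff
          rw [e1, e2]
          linarith [hx.2]
      _ ≤ ∫ x, secondDiff h f x ^ 2 :=
          setIntegral_le_integral hint (Eventually.of_forall fun x => sq_nonneg _)
  have := ge_of_tendsto hf.tendsto_secondDiff hlow
  norm_num at this

end Corner

/-! ### A smooth function whose rearrangement has a corner -/

section CornerExample

open Filter Topology

theorem volume_ball_zero (x : ℝ) : volume (Metric.ball (0 : ℝ) ‖x‖) = ENNReal.ofReal (2 * |x|) := by
  rw [Real.volume_ball, Real.norm_eq_abs]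

/-- A nonnegative function of compact support that equals `2 - x²` on `(-1, 1)`, is at most `1`
elsewhere, and equals `1` on `[9, 11]`. The rearrangement is `2 - x²` for `|x| < 1` and, since the
level set `{u = 1}` has positive measure, equals `1` for `1 < |x| ≤ 2`. -/
structure CornerSource (u : ℝ → ℝ) : Prop where
  nonneg : ∀ x, 0 ≤ u x
  cap : ∀ x, |x| < 1 → u x = 2 - x ^ 2
  le_one : ∀ x, 1 ≤ |x| → u x ≤ 1
  shelf : ∀ x, 9 ≤ x → x ≤ 11 → u x = 1
  support : ∀ x, x ∉ Icc (-2 : ℝ) 12 → u x = 0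

namespace CornerSource

variable {u : ℝ → ℝ}

theorem le_two (hu : CornerSource u) (x : ℝ) : u x ≤ 2 := by
  rcases lt_or_ge |x| 1 with h | h
  · rw [hu.cap x h]; nlinarith [sq_nonneg x]
  · linarith [hu.le_one x h]

/-- A linear lower bound for the value `2 - x²` of the rearrangement, enough to detect the corner. -/
theorem rearrangement_ge (hu : CornerSource u) {x : ℝ} (h0 : 0 < x) (h1 : x < 1) :
    2 - x ≤ sphRearrangement u x := by
  rw [sphRearrangement_eq_sInf, volume_ball_zero]
  refine le_csInf ⟨2, by norm_num, ?_⟩ fun τ hτ => ?_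
  · have : {y : ℝ | 2 < |u y|} = ∅ := by
      ext y
      simp only [mem_ofPred_eq, mem_empty_iff_false, iff_false, not_lt]
      rw [abs_of_nonneg (hu.nonneg y)]
      exact hu.le_two y
    rw [this, measure_empty, ENNReal.ofReal_pos]
    have := abs_pos.2 h0.ne'
    linarith
  · by_contra hlt
    push Not at hlt
    refine absurd hτ.2 (not_lt.2 ?_)
    rw [← volume_ball_zero]
    refine measure_mono fun y hy => ?_
    rw [mem_ball_zero_iff, Real.norm_eq_abs, Real.norm_eq_abs, abs_of_pos h0] at hy
    have hy2 : y ^ 2 ≤ x ^ 2 := by rw [← sq_abs y]; exact pow_le_pow_left₀ (abs_nonneg y) hy.le 2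
    change τ < |u y|
    rw [abs_of_nonneg (hu.nonneg y), hu.cap y (by linarith)]
    nlinarith

theorem rearrangement_eq_one (hu : CornerSource u) {x : ℝ} (h1 : 1 < x) (h2 : x ≤ 2) :
    sphRearrangement u x = 1 := by
  rw [sphRearrangement_eq_sInf, volume_ball_zero, abs_of_pos (by linarith)]
  have hmem : (1 : ℝ) ∈ {τ : ℝ | 0 ≤ τ ∧ volume {y : ℝ | τ < |u y|} < ENNReal.ofReal (2 * x)} := by
    refine ⟨zero_le_one, ?_⟩
    have hsub : {y : ℝ | 1 < |u y|} ⊆ Metric.ball 0 1 := by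
      intro y hy
      rw [mem_ball_zero_iff, Real.norm_eq_abs]
      by_contra h
      have hy' : 1 < |u y| := hy
      rw [abs_of_nonneg (hu.nonneg y)] at hy'
      linarith [hu.le_one y (not_lt.1 h)]
    refine (measure_mono hsub).trans_lt ?_
    rw [Real.volume_ball]
    exact (ENNReal.ofReal_lt_ofReal_iff (by linarith)).2 (by linarith)
  refine le_antisymm (csInf_le ⟨0, fun τ hτ => hτ.1⟩ hmem) (le_csInf ⟨1, hmem⟩ fun τ hτ => ?_)
  by_contra hlt
  push Not at hlt
  refine absurd hτ.2 (not_lt.2 ?_)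
  have hsub : Ioo (-1 : ℝ) 1 ∪ Icc 9 11 ⊆ {y : ℝ | τ < |u y|} := by
    rintro y (hy | hy)
    · change τ < |u y|
      have hy1 : |y| < 1 := abs_lt.2 hy
      rw [abs_of_nonneg (hu.nonneg y), hu.cap y hy1]
      have := (sq_lt_one_iff_abs_lt_one y).2 hy1
      linarith
    · change τ < |u y|
      rw [hu.shelf y hy.1 hy.2, abs_one]
      exact hlt
  refine le_trans ?_ (measure_mono hsub)
  rw [measure_union (Set.disjoint_left.2 fun y hy hy' => by linarith [hy.2, hy'.1])
    measurableSet_Icc, Real.volume_Ioo, Real.volume_Icc, ← ENNReal.ofReal_add (by norm_num)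
    (by norm_num)]
  exact ENNReal.ofReal_le_ofReal (by linarith)

theorem rearrangement_eq_zero (hu : CornerSource u) {x : ℝ} (hx : 7 < |x|) :
    sphRearrangement u x = 0 := by
  rw [sphRearrangement_eq_sInf, volume_ball_zero]
  have hmem : (0 : ℝ) ∈ {τ : ℝ | 0 ≤ τ ∧ volume {y : ℝ | τ < |u y|} < ENNReal.ofReal (2 * |x|)} := by
    refine ⟨le_rfl, ?_⟩
    have hsub : {y : ℝ | 0 < |u y|} ⊆ Icc (-2) 12 := by
      intro y hy
      by_contra h
      have hy' : 0 < |u y| := hy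
      rw [hu.support y h, abs_zero] at hy'
      exact lt_irrefl _ hy'
    refine (measure_mono hsub).trans_lt ?_
    rw [Real.volume_Icc]
    exact (ENNReal.ofReal_lt_ofReal_iff (by linarith)).2 (by linarith)
  exact le_antisymm (csInf_le ⟨0, fun τ hτ => hτ.1⟩ hmem) (le_csInf ⟨0, hmem⟩ fun τ hτ => hτ.1)

theorem fracEnergy_rearrangement_eq_top (hu : CornerSource u) {s : ℝ} (hs : 3 / 2 ≤ s) :
    fracEnergy s (sphRearrangement u) = ⊤ := by
  by_contra hne
  have hL : MemLp (fun x => (sphRearrangement u x : ℂ)) 2 := by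
    by_contra h
    exact hne (by rw [fracEnergy, dif_neg h])
  have hL' : MemLp (sphRearrangement u) 2 := by
    simpa using hL.re
  have hint : Integrable (sphRearrangement u) :=
    integrable_of_memLp_of_support (r := 7) hL' (Eventually.of_forall fun x hx =>
      hu.rearrangement_eq_zero (by simpa using hx))
  exact not_integrableHs_of_corner (fun x h h' => hu.rearrangement_eq_one h h')
    (fun x h h' => hu.rearrangement_ge h h')
    ((IntegrableHs.of_fracEnergy_lt_top hint hL' (lt_top_iff_ne_top.2 hne)).mono (by norm_num) hs)

end CornerSource

theorem exists_smooth_cornerSource :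
    ∃ u : ℝ → ℝ, ContDiff ℝ (⊤ : ℕ∞) u ∧ HasCompactSupport u ∧ CornerSource u := by
  -- The outer radius `6/5 < √2` keeps `(2 - x²) η` between `0` and `1` for `|x| ≥ 1`.
  let η : ContDiffBump (0 : ℝ) := ⟨1, 6 / 5, by norm_num, by norm_num⟩
  let ψ : ContDiffBump (10 : ℝ) := ⟨1, 2, by norm_num, by norm_num⟩
  have hη1 : ∀ x : ℝ, |x| ≤ 1 → η x = 1 := fun x hx =>
    η.one_of_mem_closedBall (by simpa using hx)
  have hη0 : ∀ x : ℝ, 6 / 5 ≤ |x| → η x = 0 := fun x hx =>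
    η.zero_of_le_dist (by simpa using hx)
  have hψ1 : ∀ x : ℝ, 9 ≤ x → x ≤ 11 → ψ x = 1 := fun x h h' =>
    ψ.one_of_mem_closedBall (by
      rw [Metric.mem_closedBall, Real.dist_eq]
      exact abs_le.2 ⟨by change -1 ≤ _; linarith, by change _ ≤ 1; linarith⟩)
  have hψ0 : ∀ x : ℝ, 2 ≤ |x - 10| → ψ x = 0 := fun x hx =>
    ψ.zero_of_le_dist (by rw [Real.dist_eq]; exact hx)
  have hsupp : ∀ x : ℝ, x ∉ Icc (-2 : ℝ) 12 → (2 - x ^ 2) * η x + ψ x = 0 := by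
    intro x hx
    have hx' : x < -2 ∨ 12 < x := by
      by_contra h
      push Not at h
      exact hx ⟨h.1, h.2⟩
    rw [hη0 x, hψ0 x, mul_zero, add_zero]
    · rcases hx' with h | h
      · rw [le_abs]; right; linarith
      · rw [le_abs]; left; linarith
    · rcases hx' with h | h
      · rw [le_abs]; right; linarith
      · rw [le_abs]; left; linarith
  have hfar : ∀ x : ℝ, |x| < 6 / 5 → ψ x = 0 := fun x hx =>
    hψ0 x (by rw [le_abs]; right; linarith [(abs_lt.1 hx).2])
  refine ⟨fun x => (2 - x ^ 2) * η x + ψ x, ?_, HasCompactSupport.intro isCompact_Icc hsupp,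
    ⟨fun x => ?_, fun x hx => ?_, fun x hx => ?_, fun x h h' => ?_, hsupp⟩⟩
  · exact ((contDiff_const.sub (contDiff_id.pow 2)).mul η.contDiff).add ψ.contDiff
  · rcases lt_or_ge |x| (6 / 5) with h | h
    · have h2 : x ^ 2 ≤ (6 / 5) ^ 2 := by
        rw [← sq_abs x]; exact pow_le_pow_left₀ (abs_nonneg x) h.le 2
      exact add_nonneg (mul_nonneg (by linarith) η.nonneg) ψ.nonneg
    · simp only [hη0 x h, mul_zero, zero_add]
      exact ψ.nonneg
  · simp only [hη1 x hx.le, hfar x (by linarith), mul_one, add_zero]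
  · rcases lt_or_ge |x| (6 / 5) with h | h
    · simp only [hfar x h, add_zero]
      have h1 : 1 ≤ x ^ 2 := by
        rw [← sq_abs x]; exact one_le_pow₀ hx
      have h2 : x ^ 2 ≤ (6 / 5) ^ 2 := by
        rw [← sq_abs x]; exact pow_le_pow_left₀ (abs_nonneg x) h.le 2
      exact mul_le_one₀ (by linarith) η.nonneg η.le_one
    · simp only [hη0 x h, mul_zero, zero_add]
      exact ψ.le_one
  · simp only [hψ1 x h h', hη0 x (by rw [le_abs]; left; linarith), mul_zero, zero_add]

/-- For `s < 3/2` the plateau has less energy than its rearrangement, and for `s ≥ 3/2` the corner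
makes the energy of the rearrangement of a smooth function infinite. -/
theorem exists_memHs_fracEnergy_lt_rearrangement {s : ℝ} (hs : 1 < s) :
    ∃ u : ℝ → ℝ, MemHs s u ∧ fracEnergy s u < fracEnergy s (sphRearrangement u) := by
  rcases lt_or_ge s (3 / 2) with h | h
  · obtain ⟨h1, -, h3⟩ := plateau_energy hs h (one_lt_two)
    exact ⟨_, h1, h3⟩
  · obtain ⟨u, hu, hc, hsrc⟩ := exists_smooth_cornerSource
    have hH := (integrableHs_of_contDiff (s := s) (by linarith) hu hc).memHs
    exact ⟨u, hH, by rw [hsrc.fracEnergy_rearrangement_eq_top h]; exact hH.2⟩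

end CornerExample

theorem mainTheorem6 :
    -- neither inequality holds, for any `s > 1`
    (∀ s : ℝ, 1 < s →
      (∀ n : ℕ, 1 ≤ n → ∃ u : EuclideanSpace ℝ (Fin n) → ℝ,
        MemHs s u ∧ fracEnergy s (sphRearrangement u) < fracEnergy s u) ∧
      (∃ u : ℝ → ℝ, MemHs s u ∧ fracEnergy s u < fracEnergy s (sphRearrangement u))) ∧
    -- the two-bump example
    (∀ (s : ℝ) (n : ℕ) (v : EuclideanSpace ℝ (Fin n) → ℝ) (a : ℝ),
      1 < s → 1 ≤ n → 1 ≤ a →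
      MemHs0 s (Metric.ball 0 1) v →
      (∀ x, 0 ≤ v x) →
      (∃ w : ℝ → ℝ, AntitoneOn w (Ioi 0) ∧ ∀ x, v x = w ‖x‖) →
      ¬ (v =ᵐ[volume] 0) →
      (∀ x₀ : EuclideanSpace ℝ (Fin n), 1 + a < ‖x₀‖ →
        MemHs s (twoBump v a x₀) ∧
        MemHs s (sphRearrangement (twoBump v a x₀)) ∧
        sphRearrangement (twoBump v a x₀) =ᵐ[volume]
          fun y => v ((a / (1 + a ^ n) ^ (1 / (n : ℝ))) • y)) ∧
      (((∃ k : ℕ, 2 * (k : ℝ) - 1 ≤ s ∧ s ≤ 2 * (k : ℝ)) ∨ (n : ℝ) ≤ 2 * s) →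
        ∀ x₀ : EuclideanSpace ℝ (Fin n), 1 + a < ‖x₀‖ →
          fracEnergy s (sphRearrangement (twoBump v a x₀)) < fracEnergy s (twoBump v a x₀)) ∧
      (∃ R : ℝ, ∀ x₀ : EuclideanSpace ℝ (Fin n), R < ‖x₀‖ →
          fracEnergy s (sphRearrangement (twoBump v a x₀)) < fracEnergy s (twoBump v a x₀))) ∧
    -- the one-dimensional piecewise linear example
    (∀ s M : ℝ, 1 < s → s < 3 / 2 → 1 < M →
      (∀ x : ℝ, x ≠ 0 → sphRearrangement (plateau M) x = plateauStar M x) ∧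
      MemHs s (plateau M) ∧
      MemHs s (sphRearrangement (plateau M)) ∧
      fracEnergy s (plateau M) < fracEnergy s (sphRearrangement (plateau M))) := by
  have hnt : ∀ n : ℕ, 1 ≤ n → Nontrivial (EuclideanSpace ℝ (Fin n)) := fun n hn =>
    Module.nontrivial_of_finrank_pos (R := ℝ) (by rw [finrank_euclideanSpace_fin]; exact hn)
  refine ⟨fun s hs => ⟨fun n hn => ?_, exists_memHs_fracEnergy_lt_rearrangement hs⟩, ?_,
    fun s M h1 h2 hM => ⟨fun x hx => sphRearrangement_plateau hM hx, plateau_energy h1 h2 hM⟩⟩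
  · have := hnt n hn
    exact exists_memHs_fracEnergy_rearrangement_lt (by linarith)
  · rintro s n v a hs hn ha hv hv0 ⟨w, hw, hvw⟩ hne
    have := hnt n hn
    have hs0 : 0 < s := by linarith
    have ha0 : 0 < a := by linarith
    obtain ⟨hI, hsupp⟩ := hv.integrableHs
    refine ⟨fun y hy => ⟨(hI.twoBump ha0 y).memHs, ?_⟩, fun hcase y hy => ?_,
      exists_fracEnergy_rearranged_lt hs0 hI hsupp hv0 hw hvw hne ha⟩
    · have hae := sphRearrangement_twoBump hI.memLp.1 hsupp hv0 hw hvw ha0 hy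
      rw [finrank_euclideanSpace_fin] at hae
      have hb := hI.dilation (twoBump_factor_pos ha0 n) 0
      simp only [sub_zero] at hb
      exact ⟨hb.memHs.congr_ae hae.symm, hae⟩
    · rcases hcase with ⟨k, hk1, hk2⟩ | hns
      · exact fracEnergy_rearranged_lt_of_interaction_nonneg hs0 hI hsupp hv0 hw hvw hne ha hy
          (interactionNonneg_of_mem_Icc hs0 hk1 hk2)
      · exact fracEnergy_rearranged_lt_of_finrank_le hs hI hsupp hv0 hw hvw hne ha hy
          (by rw [finrank_euclideanSpace_fin]; exact hns)
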